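/- Fix an open, simply connected set $U\subset\mathbb C$ with $(0,1)\subset U\subset B(0,1)\setminus\{0\}$ and a number $0<a_0<1$. For $\beta\in\mathbb R$ let $\tilde{\mathcal Q}_\beta$ be the set of real-analytic functions $q:(0,1)\to\mathbb R$ such that: 1. $q$ has a holomorphic extension to $U$; 2. near $a=0$, $q(a)=\sum_{j=0}^{L}q_j(a)\log(a)^j$ with $L<\infty$ and $q_j$ holomorphic on $|z|<a_0$; 3. near $a=1$, $$q(a)=q_{0,0}(1-a)+\sum_{i\ge1}(1-a)^{\beta(i)}\sum_{j=0}^{L_i}q_{i,j}(1-a)\log(1-a)^j,$$ where $q_{0,0}$ and the $q_{i,j}$ are holomorphic on $|y|<a_0$, $\sup_{i\ge1}L_i/i<\infty$, $\beta(i)\ge\beta$, either only finitely many $q_{i,j}$ are not identically zero, or $\beta(i+1)>\beta(i)$ for all $i\geq 1$, $\beta(i)\to\infty$ and $\inf_{i\ge2}(\beta(i)-\beta)/i>0$, and there is $C>0$ with $\sup_{|y|\le a_0/2}|q_{i,j}(y)|\le C^i$ for all $i\ge1$, $0\le j\le L_i$. Let $\mathcal Q_\beta$ be the set of functions $a\mapsto\tilde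 q(a^2)$ on $(0,1)$ with $\tilde q\in\tilde{\mathcal Q}_\beta$, and $a^\delta\mathcal Q_\beta=\{a^\delta g(a): g\in\mathcal Q_\beta\}$. **Theorem.** Let $d\ge1$ be an integer, $\nu,s,i,\beta,\delta\in\mathbb R$ with $s-\nu i>-(d-1)/2$, $k\in\mathbb N=\{0,1,2,\dots\}$, and $q\in a^\delta\mathcal Q_\beta$. Put $\lambda(t)=t^{-1-\nu}$, $R=r\lambda(t)$, $a=r/t$. Then there are functions $Q_0,\dots,Q_k\in a^{\delta+2}\mathcal Q_{\min\{\beta+1,\;s-\nu i+\frac{d-1}{2}\}}$ (with the same $U$ and $a_0$) such that $$v(r,t)=t^sR^i\sum_{l=0}^{k}Q_l(a)\log(R)^l$$ is a classical ($C^2$) solution of $$t^2\Big(-\partial_t^2+\partial_r^2+\frac{d-1}{r}\partial_r\Big)v=t^s\,q(a)\,R^i\log(R)^k\qquad\text{on } 0<r<t.$$ -/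

import Mathlib

open Set Filter Topology

/-- The admissible complex domains `U` on which the profile functions extend holomorphically: open,
simply connected, `(0,1) ⊆ U ⊆ B(0,1)`. The origin, where logarithms are allowed, is not in `U`. -/
structure IsProfileDomain (U : Set ℂ) : Prop where
  isOpen : IsOpen U
  simplyConnected : IsSimplyConnected U
  contains_interval : ∀ x : ℝ, x ∈ Ioo (0 : ℝ) 1 → (x : ℂ) ∈ U
  subset_ball : U ⊆ Metric.ball (0 : ℂ) 1
  zero_notMem : (0 : ℂ) ∉ U

/-- Near `0`, `q(x) = ∑_{j ≤ L} p_j(x) log(x)^j` with `p_j` holomorphic on `|z| < a₀`. -/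
def HasLogExpansionAtZero (a₀ : ℝ) (q : ℝ → ℝ) : Prop :=
  ∃ (L : ℕ) (p : ℕ → ℂ → ℂ),
    (∀ j ≤ L, DifferentiableOn ℂ (p j) (Metric.ball 0 a₀)) ∧
    ∀ᶠ x : ℝ in 𝓝[>] 0,
      (q x : ℂ) = ∑ j ∈ Finset.range (L + 1), p j (x : ℂ) * ((Real.log x : ℝ) : ℂ) ^ j

/-- Near `1`, `q(x)` equals
`p₀(1-x) + ∑_{i ≥ 1} (1-x)^{b i} ∑_{j ≤ L i} p_{i,j}(1-x) log(1-x)^j`,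
with all coefficients holomorphic on `|y| < a₀`, exponents `b i ≥ β`, `L i = O(i)`, either only
finitely many nonzero coefficients or exponents that increase strictly to infinity at least
linearly, and `sup_{|y| ≤ a₀/2} |p_{i,j}(y)| ≤ C^i`. Only the indices `i ≥ 1` of `b`, `L`, `p`
are used. -/
def HasLogPowerExpansionAtOne (a₀ β : ℝ) (q : ℝ → ℝ) : Prop :=
  ∃ (p₀ : ℂ → ℂ) (b : ℕ → ℝ) (L : ℕ → ℕ) (p : ℕ → ℕ → ℂ → ℂ),
    DifferentiableOn ℂ p₀ (Metric.ball 0 a₀) ∧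
    (∀ i, 1 ≤ i → ∀ j ≤ L i, DifferentiableOn ℂ (p i j) (Metric.ball 0 a₀)) ∧
    (∃ M : ℝ, ∀ i, 1 ≤ i → (L i : ℝ) / i ≤ M) ∧
    (∀ i, 1 ≤ i → β ≤ b i) ∧
    ({ij : ℕ × ℕ | 1 ≤ ij.1 ∧ ij.2 ≤ L ij.1 ∧
          ∃ y ∈ Metric.ball (0 : ℂ) a₀, p ij.1 ij.2 y ≠ 0}.Finite ∨
      ((∀ i, 1 ≤ i → b i < b (i + 1)) ∧ Tendsto b atTop atTop ∧
        ∃ c : ℝ, 0 < c ∧ ∀ i, 2 ≤ i → c ≤ (b i - β) / i)) ∧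
    (∃ C : ℝ, 0 < C ∧ ∀ i, 1 ≤ i → ∀ j ≤ L i,
      ∀ y ∈ Metric.closedBall (0 : ℂ) (a₀ / 2), ‖p i j y‖ ≤ C ^ i) ∧
    ∀ᶠ x : ℝ in 𝓝[<] 1,
      HasSum
        (fun n : ℕ => (((1 - x) ^ (b (n + 1)) : ℝ) : ℂ) *
          ∑ j ∈ Finset.range (L (n + 1) + 1),
            p (n + 1) j (1 - (x : ℂ)) * ((Real.log (1 - x) : ℝ) : ℂ) ^ j)
        ((q x : ℂ) - p₀ (1 - (x : ℂ)))

/-- The family `Q̃_β` of real-analytic functions on `(0,1)`, relative to the domain `U` and the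
radius `a₀`. Only the values of `q` on `(0,1)` matter. -/
structure MemQTilde (U : Set ℂ) (a₀ β : ℝ) (q : ℝ → ℝ) : Prop where
  analytic : AnalyticOnNhd ℝ q (Ioo 0 1)
  holomorphic_extension : ∃ f : ℂ → ℂ, DifferentiableOn ℂ f U ∧
    ∀ x : ℝ, x ∈ Ioo (0 : ℝ) 1 → f (x : ℂ) = (q x : ℂ)
  at_zero : HasLogExpansionAtZero a₀ q
  at_one : HasLogPowerExpansionAtOne a₀ β q

/-- The family `Q_β`: functions `a ↦ q̃(a²)` on `(0,1)` with `q̃ ∈ Q̃_β`. -/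
def MemQ (U : Set ℂ) (a₀ β : ℝ) (q : ℝ → ℝ) : Prop :=
  ∃ qt : ℝ → ℝ, MemQTilde U a₀ β qt ∧ ∀ a ∈ Ioo (0 : ℝ) 1, q a = qt (a ^ 2)

/-- The family `a^δ Q_β`. -/
def MemPowMulQ (U : Set ℂ) (a₀ δ β : ℝ) (q : ℝ → ℝ) : Prop :=
  ∃ g : ℝ → ℝ, MemQ U a₀ β g ∧ ∀ a ∈ Ioo (0 : ℝ) 1, q a = a ^ δ * g a

/-- The rate `λ(t) = t^{-1-ν}`. -/
noncomputable def blowupRate (ν t : ℝ) : ℝ := t ^ (-1 - ν)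

/-- A function `f(R,a,t)` read in the coordinates `(r,t)` through `R = r λ(t)`, `a = r / t`. -/
noncomputable def inRadialCoords (ν : ℝ) (f : ℝ → ℝ → ℝ → ℝ) (r t : ℝ) : ℝ :=
  f (r * blowupRate ν t) (r / t) t

/-- `v` is a (classical) solution of `t² (-∂_t² + ∂_r² + (d-1)/r ∂_r) v = e` on the cone
`0 < r < t`. -/
def IsRadialWaveSolution (d : ℕ) (v e : ℝ → ℝ → ℝ) : Prop :=
  ContDiffOn ℝ 2 (fun x : ℝ × ℝ => v x.1 x.2) {x : ℝ × ℝ | 0 < x.1 ∧ x.1 < x.2} ∧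
  ∀ r t : ℝ, 0 < r → r < t →
    t ^ 2 * (-(iteratedDeriv 2 (fun τ => v r τ) t) + iteratedDeriv 2 (fun ρ => v ρ t) r
      + ((d : ℝ) - 1) / r * deriv (fun ρ => v ρ t) r) = e r t

/-! Put `σ = s - ν i`, `γ = 1 + ν`, `x = a²`, `ϑ = x d/dx` and `Λ = log R = log r - γ log t`. The
ansatz becomes `v = t^τ r^μ ∑ f_l(x) Λ^l` with `μ = 2ρ`, `τ = σ - 2ρ` (a `logWave`), on which `r
∂_r` and `t ∂_t` act as `μ + 2ϑ + ∂_Λ` and `τ - 2ϑ - γ ∂_Λ`. Comparing powers of `Λ` turns the wave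
equation into hypergeometric equations `ϑ(ϑ-N) f_l - x(ϑ+A)(ϑ+B) f_l = S_l`, where `S_l` involves
only the given source and `f_{l+1}`, `f_{l+2}`. They are solved downwards from `l = k`
(`exists_profile_cascade`). Here `ρ` is the smaller of the exponents `0` and `1 - d/2` at `x = 0`,
and `N ≥ 0` is their distance. At `x = 1` the exponents are `0` and `κ = 1 - N - A - B = σ +
(d-1)/2`, which is positive by hypothesis.

The core is `exists_profile_solution`: one such equation can be solved inside the class of profiles.
On `U`, variation of constants gives a holomorphic solution, because holomorphic functions on a
simply connected open set have primitives and `FrobeniusBasis` provides homogeneous solutions on all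
of `U`. Near `0`, the same formula applied to a power times a logarithmic polynomial gives a
solution of that shape (`exists_solution_logSum`). The two differ by a homogeneous solution, which
is global and can be subtracted. Near `1`, the reflection `y = 1 - x` exchanges `N` with `κ`, keeps
`A` and `B`, and multiplies the source by `y/(1-y)`. Thus source exponents rise by one, and
homogeneous solutions add only the exponent `κ`, possibly with a logarithm; this is the origin of
`min (β+1) κ`.

Convergence of the series at `1` is the quantitative point. Inverting `ϑ + m` on a logarithmic
polynomial of degree `J` costs a factor `(1+Θ)^J` as long as `J ≤ Θ m`, since each step downwards
multiplies by `j+1` but gains `1/m`. Logarithmic degrees grow at most linearly in the index and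
exponents at least linearly, so one `Θ` serves all late terms and geometric bounds survive
(`IsLogSeries.exists_solution`). -/

/-! ### Primitives on simply connected domains -/

/-- Germs of primitives of a function, as pairs (base point, value). -/
@[ext] structure PrimitiveGerm (g : ℂ → ℂ) where
  base : ℂ
  value : ℂ

/-- The complex numbers with the discrete topology. -/
@[ext] structure DiscreteComplex where
  val : ℂ

instance : TopologicalSpace DiscreteComplex := ⊥

instance : DiscreteTopology DiscreteComplex := ⟨rfl⟩

/-- The finest topology for which `z ↦ (z, G z)` is continuous for each local primitive `G`; the
graphs of local primitives become the sheets over the plane. -/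
instance (g : ℂ → ℂ) : TopologicalSpace (PrimitiveGerm g) where
  IsOpen O := ∀ z w : ℂ, ⟨z, w⟩ ∈ O → ∀ G : ℂ → ℂ,
    (∀ᶠ z' in 𝓝 z, HasDerivAt G (g z') z') → G z = w → ∀ᶠ z' in 𝓝 z, ⟨z', G z'⟩ ∈ O
  isOpen_univ := fun _ _ _ _ _ _ => Eventually.of_forall fun _ => trivial
  isOpen_inter := fun _ _ hs ht z w hz G hG hw =>
    (hs z w hz.1 G hG hw).and (ht z w hz.2 G hG hw)
  isOpen_sUnion := fun S hS z w hz G hG hw => by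
    obtain ⟨t, ht, hzt⟩ := hz
    exact (hS t ht z w hzt G hG hw).mono fun z' hz' => ⟨t, ht, hz'⟩

theorem PrimitiveGerm.isOpen_iff {g : ℂ → ℂ} {O : Set (PrimitiveGerm g)} :
    IsOpen O ↔ ∀ z w : ℂ, ⟨z, w⟩ ∈ O → ∀ G : ℂ → ℂ,
    (∀ᶠ z' in 𝓝 z, HasDerivAt G (g z') z') → G z = w → ∀ᶠ z' in 𝓝 z, ⟨z', G z'⟩ ∈ O := Iff.rfl

theorem eventually_eq_of_local_primitives {g G H : ℂ → ℂ} {z : ℂ}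
    (hG : ∀ᶠ z' in 𝓝 z, HasDerivAt G (g z') z') (hH : ∀ᶠ z' in 𝓝 z, HasDerivAt H (g z') z') :
    ∀ᶠ z' in 𝓝 z, G z' - H z' = G z - H z := by
  obtain ⟨r, hr, hr'⟩ := Metric.eventually_nhds_iff_ball.1 (hG.and hH)
  filter_upwards [Metric.ball_mem_nhds z hr] with z' hz'
  have hd : ∀ x ∈ Metric.ball z r, HasDerivAt (fun x => G x - H x) 0 x := fun x hx => by
    simpa using (hr' x hx).1.fun_sub (hr' x hx).2
  exact (convex_ball z r).is_const_of_fderivWithin_eq_zero (𝕜 := ℂ)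
    (fun x hx => (hd x hx).differentiableAt.differentiableWithinAt)
    (fun x hx => by
      rw [fderivWithin_of_isOpen Metric.isOpen_ball hx]
      ext; simp [(hd x hx).deriv]) hz' (Metric.mem_ball_self hr)

/-- These level sets are the sheets over `D`. They are open because local primitives are unique up
to an additive constant. -/
theorem PrimitiveGerm.isOpen_graph {g G : ℂ → ℂ} {D : Set ℂ} (hD : IsOpen D)
    (hG : ∀ z ∈ D, HasDerivAt G (g z) z) (c : ℂ) :
    IsOpen {e : PrimitiveGerm g | e.base ∈ D ∧ e.value - G e.base = c} := by
  rw [PrimitiveGerm.isOpen_iff]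
  rintro z w ⟨hz, hzw⟩ H hH hw
  have h1 : ∀ᶠ z' in 𝓝 z, z' ∈ D := hD.mem_nhds hz
  filter_upwards [h1, eventually_eq_of_local_primitives hH (h1.mono fun z' h => hG z' h)]
    with z' h1 h2
  refine ⟨h1, ?_⟩
  simp only at hzw ⊢
  rw [h2, hw, hzw]

theorem PrimitiveGerm.isOpen_preimage_base {g : ℂ → ℂ} {D : Set ℂ} (hD : IsOpen D) :
    IsOpen (PrimitiveGerm.base (g := g) ⁻¹' D) := by
  rw [PrimitiveGerm.isOpen_iff]
  intro z w hz H hH hw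
  exact hD.mem_nhds hz

theorem PrimitiveGerm.continuous_section {g G : ℂ → ℂ} {D : Set ℂ} (hD : IsOpen D)
    (hG : ∀ z ∈ D, HasDerivAt G (g z) z) (c : ℂ) :
    Continuous (fun z : D => (⟨z, c + G z⟩ : PrimitiveGerm g)) := by
  rw [continuous_def]
  intro O hO
  rw [isOpen_iff_mem_nhds]
  rintro ⟨z, hz⟩ hzO
  have := PrimitiveGerm.isOpen_iff.1 hO z (c + G z) hzO (fun z => c + G z)
    (Filter.Eventually.mono (hD.mem_nhds hz) fun z' h => (hG z' h).const_add c) rfl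
  exact (continuousAt_subtype_val (x := (⟨z, hz⟩ : D))).eventually this

/-- Over a ball in `U` there is a primitive `G`, and the difference between the value and `G` labels
the sheets. The label has to be locally constant, whence the discrete copy of `ℂ` as fibre. -/
theorem PrimitiveGerm.isCoveringMapOn {g : ℂ → ℂ} {U : Set ℂ} (hU : IsOpen U)
    (hg : DifferentiableOn ℂ g U) : IsCoveringMapOn (PrimitiveGerm.base (g := g)) U := by
  intro x hx
  obtain ⟨r, hr, hrU⟩ := Metric.isOpen_iff.1 hU x hx
  obtain ⟨G, hG⟩ := (hg.mono hrU).isExactOn_ball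
  have hev : IsEvenlyCovered (PrimitiveGerm.base (g := g)) x DiscreteComplex := by
    refine ⟨inferInstance, Metric.ball x r, Metric.mem_ball_self hr, Metric.isOpen_ball,
      PrimitiveGerm.isOpen_preimage_base Metric.isOpen_ball, ?_⟩
    refine ⟨{
      toFun := fun e => (⟨e.1.base, e.2⟩, ⟨e.1.value - G e.1.base⟩)
      invFun := fun p => ⟨⟨p.1, p.2.val + G p.1⟩, p.1.2⟩
      left_inv := ?_
      right_inv := ?_
      continuous_toFun := ?_
      continuous_invFun := ?_ }, ?_⟩
    · rintro ⟨⟨z, w⟩, hz⟩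
      refine Subtype.ext (PrimitiveGerm.ext rfl ?_)
      exact sub_add_cancel w (G z)
    · rintro ⟨⟨z, hz⟩, w⟩
      refine Prod.ext rfl (DiscreteComplex.ext ?_)
      exact add_sub_cancel_right w.val (G z)
    · refine Continuous.prodMk ?_ ?_
      · refine Continuous.subtype_mk ?_ _
        rw [continuous_def]
        exact fun V hV => (PrimitiveGerm.isOpen_preimage_base hV).preimage continuous_subtype_val
      · rw [continuous_discrete_rng]
        intro c
        convert (PrimitiveGerm.isOpen_graph Metric.isOpen_ball hG c.val).preimage
          (continuous_subtype_val (p := fun e : PrimitiveGerm g => e ∈ PrimitiveGerm.base ⁻¹'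
            Metric.ball x r)) using 1
        ext e
        exact ⟨fun h => ⟨e.2, congrArg DiscreteComplex.val h⟩, fun h => DiscreteComplex.ext h.2⟩
    · refine Continuous.subtype_mk ?_ _
      rw [continuous_prod_of_discrete_right]
      exact fun c => PrimitiveGerm.continuous_section Metric.isOpen_ball hG c.val
    · intro e; rfl
  exact hev.to_isEvenlyCovered_preimage

/-- A holomorphic function on a simply connected open set has a primitive. -/
theorem IsSimplyConnected.exists_primitive {U : Set ℂ} (hUc : IsSimplyConnected U)
    (hU : IsOpen U) {g : ℂ → ℂ} (hg : DifferentiableOn ℂ g U) :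
    ∃ G : ℂ → ℂ, ∀ z ∈ U, HasDerivAt G (g z) z := by
  classical
  have := hUc.simplyConnectedSpace
  have := hU.locallyPathConnectedSpace
  obtain ⟨x₀, hx₀⟩ := hUc.nonempty
  -- Simple connectedness enters here: the inclusion of `U` lifts through the covering, and the
  -- value component of the lift is the primitive.
  obtain ⟨F, ⟨-, hF⟩, -⟩ := (PrimitiveGerm.isCoveringMapOn hU hg).existsUnique_continuousMap_lifts
    (A := U) ⟨Subtype.val, continuous_subtype_val⟩ (a₀ := ⟨x₀, hx₀⟩)
    (e₀ := ⟨x₀, 0⟩) rfl (fun a => a.2)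
  refine ⟨fun z => if h : z ∈ U then (F ⟨z, h⟩).value else 0, fun x hx => ?_⟩
  obtain ⟨r, hr, hrU⟩ := Metric.isOpen_iff.1 hU x hx
  obtain ⟨G, hG⟩ := (hg.mono hrU).isExactOn_ball
  set c : ℂ := (F ⟨x, hx⟩).value - G x with hc
  have hfst : ∀ z : U, (F z).base = z := fun z => congrFun hF z
  -- By continuity the lift stays near `x` on the sheet through its value at `x`, so it equals `c +
  -- G` there.
  have hO := (PrimitiveGerm.isOpen_graph Metric.isOpen_ball hG c).preimage F.continuous
  have hmem : (⟨x, hx⟩ : U) ∈ F ⁻¹'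
      {e : PrimitiveGerm g | e.base ∈ Metric.ball x r ∧ e.value - G e.base = c} := by
    refine ⟨?_, ?_⟩
    · rw [hfst]; exact Metric.mem_ball_self hr
    · rw [hfst]
  have hev := hO.mem_nhds hmem
  rw [nhds_subtype_eq_comap, mem_comap] at hev
  obtain ⟨t, ht, htO⟩ := hev
  refine ((hG x (Metric.mem_ball_self hr)).const_add c).congr_of_eventuallyEq ?_
  filter_upwards [ht, hU.mem_nhds hx] with z hz hzU
  have h2 := (htO (show (⟨z, hzU⟩ : U) ∈ Subtype.val ⁻¹' t from hz)).2
  rw [hfst] at h2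
  simp only [hzU, dif_pos]
  rw [← h2]; ring

/-- On a simply connected open set of nonzero numbers that contains `(0,1)` there is a holomorphic
logarithm that extends the real one. -/
theorem IsProfileDomain.exists_log {U : Set ℂ} (hU : IsProfileDomain U) :
    ∃ ℓ : ℂ → ℂ, (∀ z ∈ U, HasDerivAt ℓ (1 / z) z) ∧ (∀ z ∈ U, Complex.exp (ℓ z) = z) ∧
      ∀ x : ℝ, x ∈ Ioo (0 : ℝ) 1 → ℓ x = (Real.log x : ℂ) := by
  have h0 : ∀ z ∈ U, z ≠ 0 := fun z hz h => hU.zero_notMem (h ▸ hz)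
  obtain ⟨G, hG⟩ := hU.simplyConnected.exists_primitive hU.isOpen (g := fun z => 1 / z)
    (fun z hz => ((differentiableAt_const _).div differentiableAt_id
      (h0 z hz)).differentiableWithinAt)
  have hx : ((1 / 2 : ℝ) : ℂ) ∈ U := hU.contains_interval _ (by norm_num)
  -- The primitive is normalised at `1/2`, a point of `U`, so that it agrees there with the real
  -- logarithm; both remaining claims then follow from constancy on a connected set.
  set c : ℂ := (Real.log (1 / 2) : ℂ) - G ((1 / 2 : ℝ) : ℂ) with hc
  have hL : ∀ z ∈ U, HasDerivAt (fun z => c + G z) (1 / z) z := fun z hz => (hG z hz).const_add c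
  have hpre : IsPreconnected U := hU.simplyConnected.isPathConnected.isConnected.isPreconnected
  refine ⟨fun z => c + G z, hL, ?_, ?_⟩
  · intro z hz
    have hd : ∀ z ∈ U, HasDerivAt (fun z => Complex.exp (c + G z) / z) 0 z := by
      intro z hz
      refine (((hL z hz).cexp).fun_div (hasDerivAt_id' z) (h0 z hz)).congr_deriv ?_
      have := h0 z hz
      field_simp
      ring
    have := hU.isOpen.is_const_of_deriv_eq_zero hpre
      (fun z hz => (hd z hz).differentiableAt.differentiableWithinAt)
      (fun z hz => (hd z hz).deriv) hz hx
    rw [hc, sub_add_cancel, ← Complex.ofReal_exp, Real.exp_log (by norm_num), div_self (h0 _ hx),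
      div_eq_one_iff_eq (h0 z hz)] at this
    exact this
  · intro x hx'
    have hd : ∀ y ∈ Ioo (0 : ℝ) 1,
        HasDerivAt (fun y : ℝ => c + G y - (Real.log y : ℂ)) 0 y := by
      intro y hy
      have h1 := (hL y (hU.contains_interval y hy)).comp_ofReal
      have h2 := (Real.hasDerivAt_log hy.1.ne').ofReal_comp
      exact (h1.fun_sub h2).congr_deriv (by simp)
    have := (isOpen_Ioo (a := (0 : ℝ)) (b := 1)).is_const_of_deriv_eq_zero isPreconnected_Ioo
      (fun z hz => (hd z hz).differentiableAt.differentiableWithinAt)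
      (fun z hz => (hd z hz).deriv) hx' (show (1 / 2 : ℝ) ∈ Ioo (0 : ℝ) 1 by norm_num)
    simp only [hc, sub_add_cancel, sub_self] at this
    exact sub_eq_zero.1 this

/-! ### Power series -/

/-- The power series with coefficients `a` converges absolutely in the disc of radius `R`. -/
def HasRadius (R : ℝ) (a : ℕ → ℂ) : Prop :=
  ∀ ρ : ℝ, 0 ≤ ρ → ρ < R → Summable fun n => ‖a n‖ * ρ ^ n

/-- The sum of a power series. -/
noncomputable def powerSum (a : ℕ → ℂ) (z : ℂ) : ℂ := ∑' n, a n * z ^ n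

theorem HasRadius.hasSum {R : ℝ} {a : ℕ → ℂ} (ha : HasRadius R a) {z : ℂ}
    (hz : z ∈ Metric.ball (0 : ℂ) R) : HasSum (fun n => a n * z ^ n) (powerSum a z) := by
  refine Summable.hasSum (Summable.of_norm ?_)
  simpa using ha ‖z‖ (norm_nonneg z) (by simpa using hz)

theorem powerSum_zero (a : ℕ → ℂ) : powerSum a 0 = a 0 := by
  rw [powerSum, tsum_eq_single 0 (fun n hn => by simp [hn])]; simp

theorem HasRadius.of_le {R C : ℝ} {a b : ℕ → ℂ} (ha : HasRadius R a)
    (h : ∀ n, ‖b n‖ ≤ C * ‖a n‖) : HasRadius R b := fun ρ h0 h1 =>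
  Summable.of_nonneg_of_le (fun n => by positivity)
    (fun n => by
      have := mul_le_mul_of_nonneg_right (h n) (pow_nonneg h0 n)
      rwa [mul_assoc] at this) ((ha ρ h0 h1).mul_left C)

theorem HasRadius.add {R : ℝ} {a b : ℕ → ℂ} (ha : HasRadius R a) (hb : HasRadius R b) :
    HasRadius R (fun n => a n + b n) := fun ρ h0 h1 =>
  Summable.of_nonneg_of_le (fun n => by positivity)
    (fun n => by
      rw [← add_mul]
      exact mul_le_mul_of_nonneg_right (norm_add_le _ _) (pow_nonneg h0 n))
    ((ha ρ h0 h1).add (hb ρ h0 h1))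

theorem HasRadius.const_mul {R : ℝ} {a : ℕ → ℂ} (ha : HasRadius R a) (c : ℂ) :
    HasRadius R (fun n => c * a n) := ha.of_le (C := ‖c‖) fun n => by simp

theorem HasRadius.natCast_mul {R : ℝ} {a : ℕ → ℂ} (ha : HasRadius R a) :
    HasRadius R (fun n => n * a n) := by
  intro ρ h0 h1
  obtain ⟨ρ', h2, h3⟩ := exists_between h1
  have h4 : 0 < ρ' := h0.trans_lt h2
  have hlt : ρ / ρ' < 1 := (div_lt_one h4).2 h2
  obtain ⟨C, hC⟩ := (tendsto_self_mul_const_pow_of_lt_one (div_nonneg h0 h4.le) hlt).bddAbove_range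
  refine Summable.of_nonneg_of_le (fun n => by positivity) (fun n => ?_)
    ((ha ρ' h4.le h3).mul_left C)
  have := hC ⟨n, rfl⟩
  simp only at this
  calc ‖(n : ℂ) * a n‖ * ρ ^ n = (n * (ρ / ρ') ^ n) * (‖a n‖ * ρ' ^ n) := by
        rw [norm_mul, Complex.norm_natCast, div_pow]; field_simp
    _ ≤ C * (‖a n‖ * ρ' ^ n) := mul_le_mul_of_nonneg_right this (by positivity)

/-- Multiplication of a power series by the variable. -/
def shiftSeq (a : ℕ → ℂ) : ℕ → ℂ
  | 0 => 0
  | n + 1 => a n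

theorem HasRadius.shiftSeq {R : ℝ} {a : ℕ → ℂ} (ha : HasRadius R a) :
    HasRadius R (shiftSeq a) := fun ρ h0 h1 => by
  rw [← summable_nat_add_iff 1]
  refine ((ha ρ h0 h1).mul_right ρ).congr fun n => ?_
  simp only [_root_.shiftSeq]; ring

theorem powerSum_shiftSeq {R : ℝ} {a : ℕ → ℂ} (ha : HasRadius R a) {z : ℂ}
    (hz : z ∈ Metric.ball (0 : ℂ) R) : powerSum (shiftSeq a) z = z * powerSum a z := by
  have h := (ha.shiftSeq.hasSum hz).summable
  rw [powerSum, h.tsum_eq_zero_add, powerSum, ← tsum_mul_left]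
  simp only [shiftSeq, zero_mul, zero_add]
  exact tsum_congr fun n => by ring

theorem powerSum_add {R : ℝ} {a b : ℕ → ℂ} (ha : HasRadius R a) (hb : HasRadius R b) {z : ℂ}
    (hz : z ∈ Metric.ball (0 : ℂ) R) :
    powerSum (fun n => a n + b n) z = powerSum a z + powerSum b z :=
  ((ha.add hb).hasSum hz).unique (by simpa [add_mul] using (ha.hasSum hz).add (hb.hasSum hz))

theorem powerSum_const_mul (a : ℕ → ℂ) (c z : ℂ) :
    powerSum (fun n => c * a n) z = c * powerSum a z := by
  rw [powerSum, powerSum, ← tsum_mul_left]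
  exact tsum_congr fun n => by ring

theorem powerSum_single (n : ℕ) (c z : ℂ) : powerSum (Pi.single n c) z = c * z ^ n := by
  rw [powerSum, tsum_eq_single n (fun m hm => by simp [hm])]; simp

theorem HasRadius.single (R : ℝ) (n : ℕ) (c : ℂ) : HasRadius R (Pi.single n c) := fun ρ _ _ =>
  summable_of_ne_finset_zero (s := {n}) fun m hm => by
    rw [Finset.mem_singleton] at hm; simp [hm]

theorem HasRadius.hasDerivAt_aux {R : ℝ} {a : ℕ → ℂ} (ha : HasRadius R a) {z : ℂ}
    (hz : z ∈ Metric.ball (0 : ℂ) R) : DifferentiableAt ℂ (powerSum a) z ∧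
      z * deriv (powerSum a) z = powerSum (fun n => n * a n) z := by
  obtain ⟨ρ, h1, h2⟩ := exists_between (show ‖z‖ < R by simpa using hz)
  have h0 : 0 ≤ ρ := (norm_nonneg z).trans h1.le
  have hz' : z ∈ Metric.ball (0 : ℂ) ρ := by simpa using h1
  have hd : ∀ n, DifferentiableOn ℂ (fun z : ℂ => a n * z ^ n) (Metric.ball 0 ρ) := fun n =>
    (by fun_prop : Differentiable ℂ fun z : ℂ => a n * z ^ n).differentiableOn
  have hb : ∀ (n : ℕ) (w : ℂ), w ∈ Metric.ball (0 : ℂ) ρ → ‖a n * w ^ n‖ ≤ ‖a n‖ * ρ ^ n := by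
    intro n w hw
    rw [norm_mul, norm_pow]
    have : ‖w‖ ≤ ρ := (by simpa using hw : ‖w‖ < ρ).le
    gcongr
  refine ⟨(Complex.differentiableOn_tsum_of_summable_norm (ha ρ h0 h2) hd Metric.isOpen_ball
    hb).differentiableAt (Metric.isOpen_ball.mem_nhds hz'), ?_⟩
  have := (Complex.hasSum_deriv_of_summable_norm (ha ρ h0 h2) hd Metric.isOpen_ball hb hz').mul_left z
  refine this.unique ((ha.natCast_mul.hasSum hz).congr_fun fun n => ?_)
  rw [deriv_const_mul_field, deriv_pow_field]
  rcases n with _ | n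
  · simp
  · simp only [Nat.add_sub_cancel]; ring

theorem HasRadius.differentiableOn {R : ℝ} {a : ℕ → ℂ} (ha : HasRadius R a) :
    DifferentiableOn ℂ (powerSum a) (Metric.ball 0 R) :=
  fun _ hz => (ha.hasDerivAt_aux hz).1.differentiableWithinAt

theorem HasRadius.mul_deriv {R : ℝ} {a : ℕ → ℂ} (ha : HasRadius R a) {z : ℂ}
    (hz : z ∈ Metric.ball (0 : ℂ) R) :
    z * deriv (powerSum a) z = powerSum (fun n => n * a n) z := (ha.hasDerivAt_aux hz).2

theorem DifferentiableOn.exists_powerSum {R : ℝ} {f : ℂ → ℂ}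
    (hf : DifferentiableOn ℂ f (Metric.ball 0 R)) :
    ∃ a : ℕ → ℂ, HasRadius R a ∧ ∀ z ∈ Metric.ball (0 : ℂ) R, f z = powerSum a z := by
  have key : ∀ z ∈ Metric.ball (0 : ℂ) R,
      HasSum (fun n : ℕ => ((n.factorial : ℂ)⁻¹ * iteratedDeriv n f 0) * z ^ n) (f z) := by
    intro z hz
    have := Complex.hasSum_taylorSeries_on_ball hf hz
    simp only [smul_eq_mul, sub_zero] at this
    exact this.congr_fun fun n => by ring
  refine ⟨fun n => (n.factorial : ℂ)⁻¹ * iteratedDeriv n f 0, fun ρ h0 h1 => ?_, fun z hz =>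
    (key z hz).tsum_eq.symm⟩
  have := (key (ρ : ℂ) (by simpa [abs_of_nonneg h0] using h1)).summable.norm
  refine this.congr fun n => ?_
  rw [norm_mul, norm_pow, Complex.norm_real, Real.norm_of_nonneg h0]

/-- Coefficients given by a two-term recursion with ratio tending to one. -/
theorem HasRadius.of_recursion {R : ℝ} (hR : R ≤ 1) {e s : ℕ → ℂ} {q : ℕ → ℝ}
    (hs : HasRadius R s) (hq : Tendsto q atTop (𝓝 1))
    (h : ∀ᶠ n in atTop, ‖e (n + 1)‖ ≤ q n * ‖e n‖ + ‖s (n + 1)‖) : HasRadius R e := by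
  intro ρ h0 h1
  have hρ1 : ρ < 1 := h1.trans_le hR
  -- Since `q n * ρ → ρ < 1`, any `θ` between `ρ` and `1` is eventually a contraction factor for the
  -- weighted coefficients.
  obtain ⟨θ, hθ1, hθ2⟩ := exists_between hρ1
  have hlim : Tendsto (fun n => q n * ρ) atTop (𝓝 ρ) := by simpa using hq.mul_const ρ
  obtain ⟨n₀, hn₀⟩ := eventually_atTop.1 (h.and (hlim.eventually_lt_const hθ1))
  rw [← summable_nat_add_iff n₀]
  set u : ℕ → ℝ := fun n => ‖e (n + n₀)‖ * ρ ^ (n + n₀) with hu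
  set v : ℕ → ℝ := fun n => ‖s (n + n₀ + 1)‖ * ρ ^ (n + n₀ + 1) with hv
  have hvs : Summable v := by
    have := (summable_nat_add_iff (n₀ + 1)).2 (hs ρ h0 h1)
    exact this.congr fun n => by simp only [hv, add_assoc]
  have hv0 : ∀ n, 0 ≤ v n := fun n => by positivity
  have hu0 : ∀ n, 0 ≤ u n := fun n => by positivity
  have hstep : ∀ n, u (n + 1) ≤ θ * u n + v n := by
    intro n
    obtain ⟨a, b⟩ := hn₀ (n + n₀) (Nat.le_add_left _ _)
    have h1 : u (n + 1) = ‖e (n + n₀ + 1)‖ * ρ ^ (n + n₀ + 1) := by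
      simp only [hu]; rw [add_right_comm]
    rw [h1]
    calc ‖e (n + n₀ + 1)‖ * ρ ^ (n + n₀ + 1)
        ≤ (q (n + n₀) * ‖e (n + n₀)‖ + ‖s (n + n₀ + 1)‖) * ρ ^ (n + n₀ + 1) :=
          mul_le_mul_of_nonneg_right a (by positivity)
      _ = (q (n + n₀) * ρ) * u n + v n := by simp only [hu, hv]; ring
      _ ≤ θ * u n + v n := by
          have := mul_le_mul_of_nonneg_right b.le (hu0 n)
          linarith
  -- Summing the contraction inequality and absorbing `θ` times the partial sum bounds all partial
  -- sums at once.
  have hbound : ∀ n, (1 - θ) * ∑ i ∈ Finset.range n, u i ≤ u 0 + ∑' i, v i := by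
    intro n
    have h2 : ∑ i ∈ Finset.range (n + 1), u i ≤ u 0 + θ * ∑ i ∈ Finset.range n, u i
        + ∑ i ∈ Finset.range n, v i := by
      rw [Finset.sum_range_succ', Finset.mul_sum]
      have := Finset.sum_le_sum fun i (_ : i ∈ Finset.range n) => hstep i
      rw [Finset.sum_add_distrib] at this
      linarith
    rw [Finset.sum_range_succ] at h2
    have h3 := hvs.sum_le_tsum (Finset.range n) fun i _ => hv0 i
    have := hu0 n
    linarith
  refine summable_of_sum_range_le hu0 (c := (u 0 + ∑' i, v i) / (1 - θ)) fun n => ?_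
  rw [le_div_iff₀ (by linarith), mul_comm]
  exact hbound n

/-! ### First-order Euler equations -/

theorem exists_bound_inv_add (m : ℂ) : ∃ C : ℝ, ∀ n : ℕ, ‖((n : ℂ) + m)⁻¹‖ ≤ C := by
  have h : Tendsto (fun n : ℕ => ‖((n : ℂ) + m)⁻¹‖) atTop (𝓝 0) := by
    simp only [norm_inv]
    refine tendsto_inv_atTop_zero.comp ?_
    have : Tendsto (fun n : ℕ => (n : ℝ) + (-‖m‖)) atTop atTop :=
      tendsto_atTop_add_const_right _ _ tendsto_natCast_atTop_atTop
    refine tendsto_atTop_mono (fun n => ?_) this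
    have := norm_sub_norm_le (n : ℂ) (-m)
    simp only [sub_neg_eq_add, norm_neg, Complex.norm_natCast] at this
    linarith
  obtain ⟨C, hC⟩ := h.bddAbove_range
  exact ⟨C, fun n => hC ⟨n, rfl⟩⟩

/-- On coefficients the equation is division by `n + m`. At most one natural number makes this
vanish, and the coefficient with that index remains as the resonant monomial. -/
theorem exists_euler_solution {R : ℝ} {h : ℂ → ℂ}
    (hh : DifferentiableOn ℂ h (Metric.ball 0 R)) (m : ℂ) :
    ∃ (P : ℂ → ℂ) (r : ℂ) (n : ℕ), DifferentiableOn ℂ P (Metric.ball 0 R) ∧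
      ((n : ℂ) + m = 0 ∨ r = 0) ∧
      ∀ z ∈ Metric.ball (0 : ℂ) R, z * deriv P z + m * P z = h z - r * z ^ n := by
  obtain ⟨a, ha, hfa⟩ := hh.exists_powerSum
  obtain ⟨C, hC⟩ := exists_bound_inv_add m
  -- As `0⁻¹ = 0`, a resonant coefficient is set to zero without a case distinction.
  set b : ℕ → ℂ := fun n => ((n : ℂ) + m)⁻¹ * a n with hb
  have hbR : HasRadius R b := ha.of_le (C := C) fun n => by
    rw [hb, norm_mul]; exact mul_le_mul_of_nonneg_right (hC n) (norm_nonneg _)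
  have hlhs : ∀ z ∈ Metric.ball (0 : ℂ) R, z * deriv (powerSum b) z + m * powerSum b z
      = powerSum (fun n => n * b n + m * b n) z := fun z hz => by
    rw [hbR.mul_deriv hz, powerSum_add hbR.natCast_mul (hbR.const_mul m) hz, powerSum_const_mul]
  by_cases hm : ∃ n₀ : ℕ, (n₀ : ℂ) + m = 0
  · obtain ⟨n₀, hn₀⟩ := hm
    refine ⟨powerSum b, a n₀, n₀, hbR.differentiableOn, Or.inl hn₀, fun z hz => ?_⟩
    rw [hlhs z hz, hfa z hz, sub_eq_add_neg, ← neg_mul, ← powerSum_single n₀ (-a n₀) z,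
      ← powerSum_add ha (HasRadius.single R n₀ _) hz]
    congr 1
    funext n
    rw [← add_mul, hb]
    by_cases hn : n = n₀
    · subst hn; simp [hn₀]
    · have : (n : ℂ) + m ≠ 0 := fun h => hn (by
        have := h.trans hn₀.symm
        exact_mod_cast add_right_cancel this)
      simp [hn, this]
  · push Not at hm
    refine ⟨powerSum b, 0, 0, hbR.differentiableOn, Or.inr rfl, fun z hz => ?_⟩
    rw [hlhs z hz, hfa z hz, zero_mul, sub_zero]
    congr 1
    funext n
    rw [← add_mul, hb]
    simp [hm n]

/-- Along a ray, `s^m P(s z)` has derivative `s^(m-1) (ϑP + mP)(s z)` and vanishes at `s = 0`;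
comparison with `(T/m) s^m` gives the bound. The gain `1/m` later compensates the factors produced
by differentiating powers of the logarithm. -/
theorem norm_le_of_euler {R ρ m T : ℝ} (hρ : ρ < R) (hm : 1 ≤ m) {P : ℂ → ℂ}
    (hP : DifferentiableOn ℂ P (Metric.ball 0 R))
    (hT : ∀ z ∈ Metric.closedBall (0 : ℂ) ρ, ‖z * deriv P z + m * P z‖ ≤ T) {z : ℂ}
    (hz : z ∈ Metric.closedBall (0 : ℂ) ρ) : ‖P z‖ ≤ T / m := by
  have hm0 : 0 < m := by linarith
  have hz' : ‖z‖ ≤ ρ := by simpa using hz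
  have hmem : ∀ s ∈ Icc (0 : ℝ) 1, (s : ℂ) * z ∈ Metric.closedBall (0 : ℂ) ρ := by
    intro s hs
    simp only [Metric.mem_closedBall, dist_zero_right, norm_mul, Complex.norm_real,
      Real.norm_of_nonneg hs.1]
    nlinarith [hs.2, norm_nonneg z]
  have hmem' : ∀ s ∈ Icc (0 : ℝ) 1, (s : ℂ) * z ∈ Metric.ball (0 : ℂ) R := fun s hs =>
    Metric.closedBall_subset_ball hρ (hmem s hs)
  have hder : ∀ s ∈ Icc (0 : ℝ) 1, HasDerivAt (fun s : ℝ => ((s ^ m : ℝ) : ℂ) * P (s * z))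
      (((s ^ (m - 1) : ℝ) : ℂ) * ((s * z) * deriv P (s * z) + m * P (s * z))) s := by
    intro s hs
    have h1 : HasDerivAt (fun s : ℝ => P (s * z)) (deriv P (s * z) * z) s := by
      have h2 : HasDerivAt P (deriv P ((s : ℂ) * z)) ((s : ℂ) * z) :=
        ((hP _ (hmem' s hs)).differentiableAt
          (Metric.isOpen_ball.mem_nhds (hmem' s hs))).hasDerivAt
      have h3 : HasDerivAt (fun s : ℂ => s * z) z (s : ℂ) := by
        simpa using (hasDerivAt_id (s : ℂ)).mul_const z
      exact (HasDerivAt.comp (s : ℂ) h2 h3).comp_ofReal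
    have h4 := (Real.hasDerivAt_rpow_const (x := s) (p := m) (Or.inr hm)).ofReal_comp
    refine (h4.fun_mul h1).congr_deriv ?_
    have h5 : (s ^ m : ℝ) = s ^ (m - 1) * s := by
      rcases hs.1.eq_or_lt with h | h
      · rw [← h, Real.zero_rpow hm0.ne', mul_zero]
      · rw [Real.rpow_sub_one h.ne']; field_simp
    rw [h5]; push_cast; ring
  have hB : ∀ s : ℝ, HasDerivAt (fun s : ℝ => T / m * s ^ m) (T * s ^ (m - 1)) s := fun s => by
    refine ((Real.hasDerivAt_rpow_const (x := s) (p := m) (Or.inr hm)).const_mul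
      (T / m)).congr_deriv ?_
    field_simp
  have := image_norm_le_of_norm_deriv_right_le_deriv_boundary (a := (0 : ℝ)) (b := 1)
    (f := fun s : ℝ => ((s ^ m : ℝ) : ℂ) * P (s * z))
    (f' := fun s : ℝ => ((s ^ (m - 1) : ℝ) : ℂ) * ((s * z) * deriv P (s * z) + m * P (s * z)))
    (fun s hs => (hder s hs).continuousAt.continuousWithinAt)
    (fun s hs => (hder s ⟨hs.1, hs.2.le⟩).hasDerivWithinAt)
    (B := fun s : ℝ => T / m * s ^ m) (B' := fun s => T * s ^ (m - 1))
    (by simp [Real.zero_rpow hm0.ne']) hB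
    (fun s hs => by
      rw [norm_mul, Complex.norm_real, Real.norm_of_nonneg (Real.rpow_nonneg hs.1 _), mul_comm]
      exact mul_le_mul_of_nonneg_right (hT _ (hmem s ⟨hs.1, hs.2.le⟩)) (Real.rpow_nonneg hs.1 _))
    (right_mem_Icc.2 zero_le_one)
  simpa using this

/-! ### The hypergeometric equation as a system in the Euler derivative -/

/-- `G = ϑF` and `ϑ(ϑ-N)F - z(ϑ+A)(ϑ+B)F = S` on `V`, where `ϑ = z d/dz`. -/
structure EulerSys (N A B : ℂ) (V : Set ℂ) (F G S : ℂ → ℂ) : Prop where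
  diff_fst : ∀ z ∈ V, DifferentiableAt ℂ F z
  diff_snd : ∀ z ∈ V, DifferentiableAt ℂ G z
  eq_fst : ∀ z ∈ V, z * deriv F z = G z
  eq_snd : ∀ z ∈ V, z * (1 - z) * deriv G z
    = (N + z * (A + B)) * G z + z * A * B * F z + S z

namespace EulerSys

variable {N A B : ℂ} {V W : Set ℂ} {F G S F' G' S' : ℂ → ℂ}

theorem mono (h : EulerSys N A B V F G S) (hW : W ⊆ V) : EulerSys N A B W F G S :=
  ⟨fun z hz => h.1 z (hW hz), fun z hz => h.2 z (hW hz), fun z hz => h.3 z (hW hz),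
    fun z hz => h.4 z (hW hz)⟩

theorem congr (hV : IsOpen V) (h : EulerSys N A B V F G S) (hF : EqOn F' F V) (hG : EqOn G' G V)
    (hS : EqOn S' S V) : EulerSys N A B V F' G' S' := by
  have e1 : ∀ z ∈ V, F' =ᶠ[𝓝 z] F := fun z hz => hF.eventuallyEq_of_mem (hV.mem_nhds hz)
  have e2 : ∀ z ∈ V, G' =ᶠ[𝓝 z] G := fun z hz => hG.eventuallyEq_of_mem (hV.mem_nhds hz)
  refine ⟨fun z hz => (h.1 z hz).congr_of_eventuallyEq (e1 z hz),
    fun z hz => (h.2 z hz).congr_of_eventuallyEq (e2 z hz), fun z hz => ?_, fun z hz => ?_⟩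
  · rw [(e1 z hz).deriv_eq, hG hz, h.3 z hz]
  · rw [(e2 z hz).deriv_eq, hG hz, hF hz, hS hz, h.4 z hz]

theorem lin (h : EulerSys N A B V F G S) (h' : EulerSys N A B V F' G' S') (c c' : ℂ) :
    EulerSys N A B V (fun z => c * F z + c' * F' z) (fun z => c * G z + c' * G' z)
      (fun z => c * S z + c' * S' z) := by
  refine ⟨fun z hz => ((h.1 z hz).const_mul c).fun_add ((h'.1 z hz).const_mul c'),
    fun z hz => ((h.2 z hz).const_mul c).fun_add ((h'.2 z hz).const_mul c'),
    fun z hz => ?_, fun z hz => ?_⟩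
  · rw [(((h.1 z hz).hasDerivAt.const_mul c).fun_add ((h'.1 z hz).hasDerivAt.const_mul c')).deriv]
    linear_combination c * h.3 z hz + c' * h'.3 z hz
  · rw [(((h.2 z hz).hasDerivAt.const_mul c).fun_add ((h'.2 z hz).hasDerivAt.const_mul c')).deriv]
    linear_combination c * h.4 z hz + c' * h'.4 z hz

/-- Conjugation by `M = z^N` replaces `ϑ` by `ϑ + N`; it moves the exponent `N` at the origin to
`0`. -/
theorem mul_power (h : EulerSys (-N) (A + N) (B + N) V F G S) {M : ℂ → ℂ}
    (hM : ∀ z ∈ V, DifferentiableAt ℂ M z) (hM' : ∀ z ∈ V, z * deriv M z = N * M z) :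
    EulerSys N A B V (fun z => M z * F z) (fun z => M z * (G z + N * F z))
      (fun z => M z * S z) := by
  refine ⟨fun z hz => (hM z hz).fun_mul (h.1 z hz),
    fun z hz => (hM z hz).fun_mul ((h.2 z hz).fun_add ((h.1 z hz).const_mul N)),
    fun z hz => ?_, fun z hz => ?_⟩
  · rw [((hM z hz).hasDerivAt.fun_mul (h.1 z hz).hasDerivAt).deriv]
    linear_combination F z * hM' z hz + M z * h.3 z hz
  · rw [((hM z hz).hasDerivAt.fun_mul
      ((h.2 z hz).hasDerivAt.fun_add ((h.1 z hz).hasDerivAt.const_mul N))).deriv]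
    linear_combination (1 - z) * (G z + N * F z) * hM' z hz + M z * h.4 z hz
      + N * M z * (1 - z) * h.3 z hz

/-- The new source is the commutator of the operator with the logarithm: its symbol `ϑ(ϑ-N) -
z(ϑ+A)(ϑ+B)` differentiated in `ϑ` and applied to `F`. -/
theorem mul_log (h : EulerSys N A B V F G fun _ => 0) {ℓ : ℂ → ℂ}
    (hℓ : ∀ z ∈ V, DifferentiableAt ℂ ℓ z) (hℓ' : ∀ z ∈ V, z * deriv ℓ z = 1) :
    EulerSys N A B V (fun z => ℓ z * F z) (fun z => ℓ z * G z + F z)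
      (fun z => (2 * G z - N * F z) - z * (2 * G z + (A + B) * F z)) := by
  refine ⟨fun z hz => (hℓ z hz).fun_mul (h.1 z hz),
    fun z hz => ((hℓ z hz).fun_mul (h.2 z hz)).fun_add (h.1 z hz),
    fun z hz => ?_, fun z hz => ?_⟩
  · rw [((hℓ z hz).hasDerivAt.fun_mul (h.1 z hz).hasDerivAt).deriv]
    linear_combination F z * hℓ' z hz + ℓ z * h.3 z hz
  · rw [(((hℓ z hz).hasDerivAt.fun_mul (h.2 z hz).hasDerivAt).fun_add (h.1 z hz).hasDerivAt).deriv]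
    linear_combination (1 - z) * G z * hℓ' z hz + ℓ z * h.4 z hz + (1 - z) * h.3 z hz

/-- Variation of constants. -/
theorem variation {φ₁ γ₁ φ₂ γ₂ P₁ P₂ : ℂ → ℂ} (h₁ : EulerSys N A B V φ₁ γ₁ fun _ => 0)
    (h₂ : EulerSys N A B V φ₂ γ₂ fun _ => 0)
    (hw : ∀ z ∈ V, φ₁ z * γ₂ z - φ₂ z * γ₁ z ≠ 0)
    (hP₁ : ∀ z ∈ V, DifferentiableAt ℂ P₁ z) (hP₂ : ∀ z ∈ V, DifferentiableAt ℂ P₂ z)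
    (e₁ : ∀ z ∈ V, z * deriv P₁ z * (1 - z) * (φ₁ z * γ₂ z - φ₂ z * γ₁ z) = φ₁ z * S z)
    (e₂ : ∀ z ∈ V, z * deriv P₂ z * (1 - z) * (φ₁ z * γ₂ z - φ₂ z * γ₁ z) = φ₂ z * S z)
    (h1 : ∀ z ∈ V, z ≠ 1) :
    EulerSys N A B V (fun z => φ₂ z * P₁ z - φ₁ z * P₂ z) (fun z => γ₂ z * P₁ z - γ₁ z * P₂ z)
      S := by
  refine ⟨fun z hz => ((h₂.1 z hz).fun_mul (hP₁ z hz)).fun_sub ((h₁.1 z hz).fun_mul (hP₂ z hz)),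
    fun z hz => ((h₂.2 z hz).fun_mul (hP₁ z hz)).fun_sub ((h₁.2 z hz).fun_mul (hP₂ z hz)),
    fun z hz => ?_, fun z hz => ?_⟩
  · rw [(((h₂.1 z hz).hasDerivAt.fun_mul (hP₁ z hz).hasDerivAt).fun_sub
      ((h₁.1 z hz).hasDerivAt.fun_mul (hP₂ z hz).hasDerivAt)).deriv]
    have h3 : (1 - z) * (φ₁ z * γ₂ z - φ₂ z * γ₁ z) ≠ 0 :=
      mul_ne_zero (sub_ne_zero.2 (h1 z hz).symm) (hw z hz)
    refine mul_right_cancel₀ h3 ?_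
    linear_combination (1 - z) * (φ₁ z * γ₂ z - φ₂ z * γ₁ z) * (P₁ z * h₂.3 z hz
      - P₂ z * h₁.3 z hz) + φ₂ z * e₁ z hz - φ₁ z * e₂ z hz
  · rw [(((h₂.2 z hz).hasDerivAt.fun_mul (hP₁ z hz).hasDerivAt).fun_sub
      ((h₁.2 z hz).hasDerivAt.fun_mul (hP₂ z hz).hasDerivAt)).deriv]
    refine mul_right_cancel₀ (hw z hz) ?_
    linear_combination (φ₁ z * γ₂ z - φ₂ z * γ₁ z) * (P₁ z * h₂.4 z hz - P₂ z * h₁.4 z hz)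
      + γ₂ z * e₁ z hz - γ₁ z * e₂ z hz

end EulerSys

/-! ### Power series solutions at the singular point `0` -/

theorem tendsto_inv_natCast_add (m : ℂ) :
    Tendsto (fun n : ℕ => ((n : ℂ) + m)⁻¹) atTop (𝓝 0) := by
  rw [tendsto_zero_iff_norm_tendsto_zero]
  simp only [norm_inv]
  refine tendsto_inv_atTop_zero.comp ?_
  have : Tendsto (fun n : ℕ => (n : ℝ) + (-‖m‖)) atTop atTop :=
    tendsto_atTop_add_const_right _ _ tendsto_natCast_atTop_atTop
  refine tendsto_atTop_mono (fun n => ?_) this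
  have := norm_sub_norm_le (n : ℂ) (-m)
  simp only [sub_neg_eq_add, norm_neg, Complex.norm_natCast] at this
  linarith

theorem tendsto_natCast_add_div (a b : ℂ) :
    Tendsto (fun n : ℕ => ((n : ℂ) + a) * ((n : ℂ) + b)⁻¹) atTop (𝓝 1) := by
  have h := ((tendsto_inv_natCast_add b).const_mul (a - b)).const_add 1
  simp only [mul_zero, add_zero] at h
  refine h.congr' ?_
  have hne : ∀ᶠ n : ℕ in atTop, (n : ℂ) + b ≠ 0 := by
    by_cases hb : ∃ n₀ : ℕ, (n₀ : ℂ) + b = 0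
    · obtain ⟨n₀, hn₀⟩ := hb
      filter_upwards [eventually_gt_atTop n₀] with n hn h
      have := h.trans hn₀.symm
      exact hn.ne' (by exact_mod_cast add_right_cancel this)
    · push Not at hb
      exact Eventually.of_forall hb
  filter_upwards [hne] with n hn
  field_simp
  ring

/-- Solution by a power series, up to a resonant monomial. -/
theorem EulerSys.exists_powerSum {R : ℝ} (hR : R ≤ 1) (hR0 : 0 < R) (N A B : ℂ) {s : ℂ → ℂ}
    (hs : DifferentiableOn ℂ s (Metric.ball 0 R)) (hs0 : s 0 = 0) (e₀ : ℂ) :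
    ∃ (E : ℂ → ℂ) (r : ℂ) (n : ℕ), DifferentiableOn ℂ E (Metric.ball 0 R) ∧ E 0 = e₀ ∧
      (((n : ℂ) = N ∧ 1 ≤ n) ∨ r = 0) ∧
      EulerSys N A B (Metric.ball 0 R) E (fun z => z * deriv E z) (fun z => s z - r * z ^ n) := by
  obtain ⟨a, ha, hsa⟩ := hs.exists_powerSum
  have ha0 : a 0 = 0 := by
    rw [← powerSum_zero a, ← hsa 0 (Metric.mem_ball_self hR0), hs0]
  -- The recursion divides by `(n+1)(n+1-N)`. At a resonance `n + 1 = N` the inverse of zero gives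
  -- the coefficient zero, and the defect in the recursion becomes the residue `r`.
  let e : ℕ → ℂ := fun n => Nat.rec (motive := fun _ => ℂ) e₀
    (fun n x => (((n : ℂ) + A) * (n + B) * x + a (n + 1)) * (((n : ℂ) + 1)⁻¹ * ((n : ℂ) + (1 - N))⁻¹))
    n
  have he0 : e 0 = e₀ := rfl
  have hes : ∀ n, e (n + 1) = (((n : ℂ) + A) * (n + B) * e n + a (n + 1)) *
    (((n : ℂ) + 1)⁻¹ * ((n : ℂ) + (1 - N))⁻¹) := fun n => rfl
  have he : HasRadius R e := by
    -- The ratio `(n+A)(n+B) / ((n+1)(n+1-N))` tends to `1`, so the series converges as far as the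
    -- source does inside the unit disc.
    refine HasRadius.of_recursion hR ha (q := fun n =>
      ‖((n : ℂ) + A) * ((n : ℂ) + 1)⁻¹ * (((n : ℂ) + B) * ((n : ℂ) + (1 - N))⁻¹)‖) ?_ ?_
    · simpa using ((tendsto_natCast_add_div A 1).mul (tendsto_natCast_add_div B (1 - N))).norm
    · have h1 := ((tendsto_inv_natCast_add 1).mul (tendsto_inv_natCast_add (1 - N))).norm
      simp only [mul_zero, norm_zero] at h1
      filter_upwards [h1.eventually_le_const zero_lt_one] with n hn
      rw [hes, add_mul]
      refine (norm_add_le _ _).trans (add_le_add (le_of_eq ?_) ?_)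
      · rw [← norm_mul]; congr 1; ring
      · rw [norm_mul]
        exact mul_le_of_le_one_right (norm_nonneg _) hn
  have hk := he.natCast_mul
  have hd1 : ∀ z ∈ Metric.ball (0 : ℂ) R, (fun z => z * deriv (powerSum e) z) =ᶠ[𝓝 z]
      powerSum (fun n => n * e n) := fun z hz => by
    filter_upwards [Metric.isOpen_ball.mem_nhds hz] with w hw
    exact he.mul_deriv hw
  have main : ∀ (r : ℂ) (n₀ : ℕ), (∀ n : ℕ, ((n : ℂ) + 1) * ((n : ℂ) + (1 - N)) * e (n + 1) =
      ((n : ℂ) + A) * (n + B) * e n + a (n + 1) - (Pi.single n₀ r : ℕ → ℂ) (n + 1)) →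
      (Pi.single n₀ r : ℕ → ℂ) 0 = 0 →
      EulerSys N A B (Metric.ball 0 R) (powerSum e) (fun z => z * deriv (powerSum e) z)
        (fun z => s z - r * z ^ n₀) := by
    intro r n₀ hrec hr0
    refine ⟨fun z hz => (he.hasDerivAt_aux hz).1, fun z hz => differentiableAt_id.fun_mul
      ((he.differentiableOn.deriv Metric.isOpen_ball).differentiableAt
        (Metric.isOpen_ball.mem_nhds hz)), fun z hz => rfl, fun z hz => ?_⟩
    rw [(hd1 z hz).deriv_eq, (hd1 z hz).eq_of_nhds, hsa z hz, ← powerSum_single n₀ r z]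
    have hkk := hk.mul_deriv hz
    have hkR := hk.natCast_mul
    set b : ℕ → ℂ := fun n => ((n : ℂ) * (n * e n) + (A + B) * (n * e n)) + A * B * e n with hb
    have hbR : HasRadius R b := (hkR.add (hk.const_mul _)).add (he.const_mul _)
    have e1 : powerSum b z = (powerSum (fun n => (n : ℂ) * (n * e n)) z
        + (A + B) * powerSum (fun n => (n : ℂ) * e n) z) + A * B * powerSum e z := by
      rw [hb, powerSum_add (hkR.add (hk.const_mul _)) (he.const_mul _) hz,
        powerSum_add hkR (hk.const_mul _) hz, powerSum_const_mul, powerSum_const_mul]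
    have e2 := powerSum_shiftSeq hbR hz
    set c : ℕ → ℂ := fun n => (((n : ℂ) * (n * e n) + (-N) * (n * e n)) + (-1) * a n)
      + (Pi.single n₀ r : ℕ → ℂ) n with hc
    have e3 : powerSum c z = ((powerSum (fun n => (n : ℂ) * (n * e n)) z
        + (-N) * powerSum (fun n => (n : ℂ) * e n) z) + (-1) * powerSum a z)
        + powerSum (Pi.single n₀ r) z := by
      rw [hc, powerSum_add ((hkR.add (hk.const_mul _)).add (ha.const_mul _))
        (HasRadius.single R n₀ r) hz, powerSum_add (hkR.add (hk.const_mul _)) (ha.const_mul _) hz,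
        powerSum_add hkR (hk.const_mul _) hz, powerSum_const_mul, powerSum_const_mul]
    -- The differential equation is this comparison of coefficients: `ϑ(ϑ-N)` against `z(ϑ+A)(ϑ+B)`,
    -- the factor `z` being an index shift.
    have e4 : c = shiftSeq b := by
      funext n
      rcases n with _ | n
      · simp [hc, shiftSeq, ha0, hr0]
      · simp only [hc, shiftSeq, hb]
        push_cast
        linear_combination hrec n
    rw [e4] at e3
    linear_combination (1 - z) * hkk - e3 + e2 + z * e1
  by_cases hN : ∃ n₁ : ℕ, (n₁ : ℂ) + (1 - N) = 0
  · obtain ⟨n₁, hn₁⟩ := hN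
    refine ⟨powerSum e, ((n₁ : ℂ) + A) * (n₁ + B) * e n₁ + a (n₁ + 1), n₁ + 1,
      he.differentiableOn, by rw [powerSum_zero, he0], Or.inl ⟨?_, by omega⟩, main _ _ ?_ ?_⟩
    · push_cast; linear_combination hn₁
    · intro n
      by_cases hn : n = n₁
      · subst hn; simp [hn₁]
      · have h1 : (n : ℂ) + (1 - N) ≠ 0 := fun h => hn (by
          have := h.trans hn₁.symm
          exact_mod_cast add_right_cancel this)
        have h2 : (n : ℂ) + 1 ≠ 0 := by exact_mod_cast n.succ_ne_zero
        rw [hes, Pi.single_eq_of_ne (by omega)]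
        field_simp
        ring
    · rw [Pi.single_eq_of_ne (by omega)]
  · push Not at hN
    refine ⟨powerSum e, 0, 0, he.differentiableOn, by rw [powerSum_zero, he0], Or.inr rfl,
      main _ _ ?_ ?_⟩
    · intro n
      have h2 : (n : ℂ) + 1 ≠ 0 := by exact_mod_cast n.succ_ne_zero
      have h1 := hN n
      rw [hes]
      simp only [Pi.single_zero, Pi.zero_apply]
      field_simp
      ring
    · simp

/-! ### Logarithm domains and the Frobenius basis -/

/-- An open subset of the punctured unit disc with a holomorphic logarithm. -/
structure IsLogDomain (V : Set ℂ) (ℓ : ℂ → ℂ) : Prop where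
  isOpen : IsOpen V
  subset_ball : V ⊆ Metric.ball 0 1
  ne_zero : ∀ z ∈ V, z ≠ 0
  hasDerivAt : ∀ z ∈ V, HasDerivAt ℓ (1 / z) z
  exp_eq : ∀ z ∈ V, Complex.exp (ℓ z) = z

theorem IsLogDomain.ne_one {V : Set ℂ} {ℓ : ℂ → ℂ} (h : IsLogDomain V ℓ) {z : ℂ} (hz : z ∈ V) :
    z ≠ 1 := fun h1 => by
  have := h.subset_ball hz
  simp [h1] at this

theorem IsLogDomain.mul_deriv {V : Set ℂ} {ℓ : ℂ → ℂ} (h : IsLogDomain V ℓ) {z : ℂ} (hz : z ∈ V) :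
    z * deriv ℓ z = 1 := by
  rw [(h.hasDerivAt z hz).deriv, mul_one_div_cancel (h.ne_zero z hz)]

theorem IsLogDomain.hasDerivAt_exp {V : Set ℂ} {ℓ : ℂ → ℂ} (h : IsLogDomain V ℓ) (m : ℂ) {z : ℂ}
    (hz : z ∈ V) : HasDerivAt (fun z => Complex.exp (m * ℓ z))
      (Complex.exp (m * ℓ z) * (m * (1 / z))) z :=
  ((h.hasDerivAt z hz).const_mul m).cexp

theorem IsLogDomain.mul_deriv_exp {V : Set ℂ} {ℓ : ℂ → ℂ} (h : IsLogDomain V ℓ) (m : ℂ) {z : ℂ}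
    (hz : z ∈ V) : z * deriv (fun z => Complex.exp (m * ℓ z)) z = m * Complex.exp (m * ℓ z) := by
  rw [(h.hasDerivAt_exp m hz).deriv]
  have := h.ne_zero z hz
  field_simp

theorem IsLogDomain.exp_natCast {V : Set ℂ} {ℓ : ℂ → ℂ} (h : IsLogDomain V ℓ) (n : ℕ) {z : ℂ}
    (hz : z ∈ V) : Complex.exp (n * ℓ z) = z ^ n := by
  rw [Complex.exp_nat_mul, h.exp_eq z hz]

/-- A fundamental system of the homogeneous equation near its singular point `0`, in terms of
functions that are holomorphic in the unit disc. -/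
structure FrobeniusBasis (N A B : ℂ) where
  h₁ : ℂ → ℂ
  k₁ : ℂ → ℂ
  h₂ : ℂ → ℂ
  k₂ : ℂ → ℂ
  Z : ℂ → ℂ
  K : ℂ
  diff_h₁ : DifferentiableOn ℂ h₁ (Metric.ball 0 1)
  diff_h₂ : DifferentiableOn ℂ h₂ (Metric.ball 0 1)
  diff_k₂ : DifferentiableOn ℂ k₂ (Metric.ball 0 1)
  diff_Z : DifferentiableOn ℂ Z (Metric.ball 0 1)
  k₁_eq : ∀ z ∈ Metric.ball (0 : ℂ) 1, k₁ z = z * deriv h₁ z + Z z * h₂ z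
  Z_eq : ∀ (V : Set ℂ) (ℓ : ℂ → ℂ), IsLogDomain V ℓ → ∀ z ∈ V, Z z = K * Complex.exp (N * ℓ z)
  sol₁ : ∀ (V : Set ℂ) (ℓ : ℂ → ℂ), IsLogDomain V ℓ → EulerSys N A B V
    (fun z => h₁ z + ℓ z * (Z z * h₂ z)) (fun z => k₁ z + ℓ z * (Z z * k₂ z)) (fun _ => 0)
  sol₂ : ∀ (V : Set ℂ) (ℓ : ℂ → ℂ), IsLogDomain V ℓ → EulerSys N A B V
    (fun z => Complex.exp (N * ℓ z) * h₂ z) (fun z => Complex.exp (N * ℓ z) * k₂ z) (fun _ => 0)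
  wronskian : ∀ z ∈ Metric.ball (0 : ℂ) 1, h₁ z * k₂ z - h₂ z * k₁ z ≠ 0

theorem eq_of_mul_deriv_eq_zero {R : ℝ} {f : ℂ → ℂ} (hf : DifferentiableOn ℂ f (Metric.ball 0 R))
    (h : ∀ z ∈ Metric.ball (0 : ℂ) R, z * deriv f z = 0) {z : ℂ} (hz : z ∈ Metric.ball (0 : ℂ) R) :
    f z = f 0 := by
  have h0 : (0 : ℂ) ∈ Metric.ball (0 : ℂ) R := Metric.mem_ball_self (Metric.pos_of_mem_ball hz)
  have hd : ∀ z ∈ Metric.ball (0 : ℂ) R, deriv f z = 0 := by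
    intro w hw
    by_cases hw0 : w = 0
    · subst hw0
      have hc : ContinuousAt (deriv f) 0 := ((hf.deriv Metric.isOpen_ball).differentiableAt
        (Metric.isOpen_ball.mem_nhds h0)).continuousAt
      have h1 : Tendsto (deriv f) (𝓝[≠] 0) (𝓝 0) := by
        refine tendsto_const_nhds.congr' ?_
        filter_upwards [self_mem_nhdsWithin,
          mem_nhdsWithin_of_mem_nhds (Metric.isOpen_ball.mem_nhds h0)] with u hu hu'
        exact ((mul_eq_zero.1 (h u hu')).resolve_left hu).symm
      exact tendsto_nhds_unique (hc.tendsto.mono_left nhdsWithin_le_nhds) h1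
    · exact (mul_eq_zero.1 (h w hw)).resolve_left hw0
  exact Metric.isOpen_ball.is_const_of_deriv_eq_zero (convex_ball (0 : ℂ) R).isPreconnected hf hd
    hz h0

/-- The function `(1-z)^c ω` is constant in the unit disc, with the principal branch of the power,
since `1 - z` has positive real part there. -/
theorem ne_zero_of_euler {ω : ℂ → ℂ} (hω : DifferentiableOn ℂ ω (Metric.ball 0 1)) {c : ℂ}
    (h : ∀ z ∈ Metric.ball (0 : ℂ) 1, z * (1 - z) * deriv ω z = z * c * ω z) (h0 : ω 0 ≠ 0) {z : ℂ}
    (hz : z ∈ Metric.ball (0 : ℂ) 1) : ω z ≠ 0 := by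
  have hslit : ∀ w ∈ Metric.ball (0 : ℂ) 1, 1 - w ∈ Complex.slitPlane := fun w hw => by
    refine Or.inl ?_
    have h1 : ‖w‖ < 1 := by simpa using hw
    have := (Complex.abs_re_le_norm w).trans_lt h1
    simp only [Complex.sub_re, Complex.one_re]
    linarith [(abs_lt.1 this).2]
  have hd : ∀ w ∈ Metric.ball (0 : ℂ) 1, HasDerivAt (fun w => ω w * Complex.exp (c * Complex.log (1 - w)))
      (deriv ω w * Complex.exp (c * Complex.log (1 - w)) + ω w *
        (Complex.exp (c * Complex.log (1 - w)) * (c * (-1 / (1 - w))))) w := fun w hw =>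
    ((hω.differentiableAt (Metric.isOpen_ball.mem_nhds hw)).hasDerivAt).fun_mul
      (((((hasDerivAt_id' w).const_sub 1).clog (hslit w hw)).const_mul c).cexp)
  have := eq_of_mul_deriv_eq_zero (fun w hw => (hd w hw).differentiableAt.differentiableWithinAt)
    (fun w hw => by
      rw [(hd w hw).deriv]
      have h1 : 1 - w ≠ 0 := Complex.slitPlane_ne_zero (hslit w hw)
      field_simp
      linear_combination Complex.exp (c * Complex.log (1 - w)) * h w hw) hz
  intro hz0
  simp [hz0] at this
  exact h0 this.symm

/-- The solution `z^N h₂` never meets a resonance, because `h₂` satisfies an equation with exponents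
`0` and `-N ≤ 0`. For the exponent `0` there are three cases: a resonance at `n = N ≥ 1`, whose
residue a logarithm with `K = r/n` cancels; `N = 0`, where the exponents coincide and `K = 1`;
otherwise a plain power series and `K = 0`. In every case `Z = K z^N` is holomorphic at the origin.
-/
theorem exists_frobeniusBasis {N : ℝ} (hN : 0 ≤ N) (A B : ℂ) :
    Nonempty (FrobeniusBasis (N : ℂ) A B) := by
  have hno : ∀ n : ℕ, ¬ ((n : ℂ) = -(N : ℂ) ∧ 1 ≤ n) := by
    rintro n ⟨h1, h2⟩
    have h3 : (n : ℝ) = -N := by exact_mod_cast h1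
    have h4 : (1 : ℝ) ≤ n := by exact_mod_cast h2
    linarith
  have hB0 : (0 : ℂ) ∈ Metric.ball (0 : ℂ) 1 := Metric.mem_ball_self one_pos
  obtain ⟨h₂, r₂, n₂, dh₂, h₂0, hr₂, H₂⟩ := EulerSys.exists_powerSum le_rfl one_pos (-(N : ℂ))
    (A + N) (B + N) (s := fun _ => 0) (differentiableOn_const 0) rfl 1
  rw [hr₂.resolve_left (hno n₂)] at H₂
  simp only [zero_mul, sub_zero] at H₂
  have dd₂ : DifferentiableOn ℂ (fun z => z * deriv h₂ z) (Metric.ball 0 1) := fun z hz =>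
    (H₂.2 z hz).differentiableWithinAt
  set k₂ : ℂ → ℂ := fun z => z * deriv h₂ z + N * h₂ z with hk₂
  have dk₂ : DifferentiableOn ℂ k₂ (Metric.ball 0 1) := dd₂.fun_add (dh₂.const_mul _)
  -- `z^N w` is the source created by multiplying `z^N h₂` by the logarithm.
  set w : ℂ → ℂ := fun z => (2 * k₂ z - N * h₂ z) - z * (2 * k₂ z + (A + B) * h₂ z) with hw
  have dw : DifferentiableOn ℂ w (Metric.ball 0 1) :=
    ((dk₂.const_mul _).fun_sub (dh₂.const_mul _)).fun_sub
      (differentiableOn_id.fun_mul ((dk₂.const_mul _).fun_add (dh₂.const_mul _)))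
  have w0 : w 0 = N := by simp [hw, hk₂, h₂0]; ring
  -- The source has to vanish at `0`, so `w(0) = N` is split off. This constant is what cancels the
  -- resonant monomial below, and it is zero when `N = 0`.
  obtain ⟨g, r₃, n₃, dg, g0, hr₃, Hg⟩ := EulerSys.exists_powerSum le_rfl one_pos (-(N : ℂ))
    (A + N) (B + N) (s := fun z => w z - N) (dw.sub_const _) (by simp [w0]) 0
  rw [hr₃.resolve_left (hno n₃)] at Hg
  simp only [zero_mul, sub_zero] at Hg
  obtain ⟨f, r, n, df, f0, hr, Hf⟩ := EulerSys.exists_powerSum le_rfl one_pos (N : ℂ)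
    A B (s := fun _ => 0) (differentiableOn_const 0) rfl 1
  obtain ⟨K, Z, h₁, dZ, hZN, hZV, dh₁, H₁, hω0⟩ : ∃ (K : ℂ) (Z h₁ : ℂ → ℂ),
      DifferentiableOn ℂ Z (Metric.ball 0 1) ∧
      (∀ z ∈ Metric.ball (0 : ℂ) 1, z * deriv Z z = N * Z z) ∧
      (∀ (V : Set ℂ) (ℓ : ℂ → ℂ), IsLogDomain V ℓ → ∀ z ∈ V,
        Z z = K * Complex.exp (N * ℓ z)) ∧
      DifferentiableOn ℂ h₁ (Metric.ball 0 1) ∧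
      EulerSys N A B (Metric.ball 0 1) h₁ (fun z => z * deriv h₁ z) (fun z => -(Z z * w z)) ∧
      h₁ 0 * N - Z 0 ≠ 0 := by
    rcases hr with ⟨hnN, hn⟩ | hr
    -- With `n = N`, the sources `-r z^n` of `f` and `-(r/n) z^n (w - N)` of the correction add up
    -- to `-(r/n) z^n w = -Z w`, opposite to the source of the logarithmic term.
    · refine ⟨r / n, fun z => r / n * z ^ n, fun z => f z - r / n * (z ^ n * g z), ?_, ?_, ?_, ?_,
        ?_, ?_⟩
      · fun_prop
      · intro z hz
        rw [deriv_const_mul_field, deriv_pow_field, ← hnN]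
        obtain ⟨m, rfl⟩ : ∃ m, n = m + 1 := ⟨n - 1, by omega⟩
        simp only [Nat.add_sub_cancel]; ring
      · intro V ℓ h z hz
        rw [← hnN, h.exp_natCast n hz]
      · exact df.fun_sub (((by fun_prop : DifferentiableOn ℂ (fun z : ℂ => z ^ n) _).fun_mul
          dg).const_mul _)
      · have h1 := Hg.mul_power (M := fun z => z ^ n) (fun z hz => by fun_prop) (fun z hz => by
          rw [deriv_pow_field, ← hnN]
          obtain ⟨m, rfl⟩ : ∃ m, n = m + 1 := ⟨n - 1, by omega⟩
          simp only [Nat.add_sub_cancel]; ring)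
        have h2 := Hf.lin h1 1 (-(r / n))
        refine h2.congr Metric.isOpen_ball (fun z hz => by ring) (fun z hz => ?_) (fun z hz => ?_)
        · rw [← h2.eq_fst z hz]
          congr 2
          funext z; ring
        · have : (n : ℂ) ≠ 0 := by exact_mod_cast (by omega : n ≠ 0)
          simp only [← hnN]
          field_simp
          ring
      · have hn0 : n ≠ 0 := by omega
        simp [f0, hn0, ← hnN]
    · rw [hr] at Hf
      simp only [zero_mul, sub_zero] at Hf
      rcases hN.eq_or_lt with hN0 | hN0
      · subst hN0
        refine ⟨1, fun _ => 1, fun z => -g z, differentiableOn_const _, by simp, by simp, dg.fun_neg,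
          ?_, by simp⟩
        simp only [Complex.ofReal_zero, neg_zero, add_zero, sub_zero] at Hg
        have h2 := Hg.lin Hg (-1) 0
        refine h2.congr Metric.isOpen_ball (fun z hz => by ring) (fun z hz => ?_)
          (fun z hz => by ring)
        rw [← h2.eq_fst z hz]
        congr 2
        funext z; ring
      · refine ⟨0, fun _ => 0, f, differentiableOn_const _, by simp, by simp, df, ?_, ?_⟩
        · simpa using Hf
        · simpa [f0] using hN0.ne'
  have hsolZ : EulerSys N A B (Metric.ball 0 1) (fun z => Z z * h₂ z) (fun z => Z z * k₂ z)
      (fun _ => 0) := by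
    refine (H₂.mul_power (M := Z) (fun z hz => dZ.differentiableAt (Metric.isOpen_ball.mem_nhds hz))
      hZN).congr Metric.isOpen_ball (fun z hz => rfl) (fun z hz => rfl) (fun z hz => by simp)
  refine ⟨⟨h₁, fun z => z * deriv h₁ z + Z z * h₂ z, h₂, k₂, Z, K, dh₁, dh₂, dk₂, dZ,
    fun z hz => rfl, hZV, ?_, ?_, ?_⟩⟩
  · intro V ℓ hV
    have h1 := (hsolZ.mono hV.subset_ball).mul_log
      (fun z hz => (hV.hasDerivAt z hz).differentiableAt) (fun z hz => hV.mul_deriv hz)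
    refine ((H₁.mono hV.subset_ball).lin h1 1 1).congr hV.isOpen (fun z hz => by ring)
      (fun z hz => by ring) (fun z hz => ?_)
    simp only [hw]
    ring
  · intro V ℓ hV
    exact ((H₂.mono hV.subset_ball).mul_power (M := fun z => Complex.exp (N * ℓ z))
      (fun z hz => (hV.hasDerivAt_exp N hz).differentiableAt)
      (fun z hz => hV.mul_deriv_exp N hz)).congr hV.isOpen (fun z hz => rfl) (fun z hz => rfl)
        (fun z hz => by simp)
  · intro z hz
    have da : ∀ {u : ℂ → ℂ}, DifferentiableOn ℂ u (Metric.ball 0 1) →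
        ∀ z ∈ Metric.ball (0 : ℂ) 1, HasDerivAt u (deriv u z) z := fun hu z hz =>
      (hu.differentiableAt (Metric.isOpen_ball.mem_nhds hz)).hasDerivAt
    have hder : ∀ z ∈ Metric.ball (0 : ℂ) 1, HasDerivAt
        (fun z => h₁ z * k₂ z - h₂ z * (z * deriv h₁ z + Z z * h₂ z)) _ z := fun z hz =>
      ((da dh₁ z hz).fun_mul ((H₂.2 z hz).hasDerivAt.fun_add ((da dh₂ z hz).const_mul _))).fun_sub
        ((da dh₂ z hz).fun_mul ((H₁.2 z hz).hasDerivAt.fun_add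
          ((da dZ z hz).fun_mul (da dh₂ z hz))))
    -- Abel's identity with the factor `z^N` removed from the Wronskian. It then suffices that the
    -- value `h₁(0) N - Z(0)` at the origin is nonzero.
    refine ne_zero_of_euler (c := A + B + N) (fun z hz =>
      (hder z hz).differentiableAt.differentiableWithinAt) (fun z hz => ?_) ?_ hz
    · rw [(hder z hz).deriv]
      have a1 := H₁.4 z hz
      have a2 := H₂.4 z hz
      have a3 := hZN z hz
      simp only [hk₂, hw] at a1 a2 ⊢
      linear_combination h₁ z * a2 - h₂ z * a1 - (1 - z) * h₂ z ^ 2 * a3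
    · simp only [hk₂, h₂0, zero_mul, zero_add, mul_one, one_mul]
      exact hω0

/-! ### Logarithmic polynomials -/

/-- `∑_{j ≤ J} p_j(z) ℓ^j`. -/
noncomputable def logSum (p : ℕ → ℂ → ℂ) (J : ℕ) (ℓ z : ℂ) : ℂ :=
  ∑ j ∈ Finset.range (J + 1), p j z * ℓ ^ j

/-- Coefficients of a logarithmic polynomial multiplied by the logarithm. -/
def shiftLog (p : ℕ → ℂ → ℂ) : ℕ → ℂ → ℂ
  | 0 => 0
  | j + 1 => p j

theorem logSum_of_le {p : ℕ → ℂ → ℂ} {J J' : ℕ} (hJ : J ≤ J') (hp : ∀ j, J < j → p j = 0)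
    (ℓ z : ℂ) : logSum p J' ℓ z = logSum p J ℓ z := by
  refine (Finset.sum_subset (Finset.range_mono (by omega)) fun j _ hj => ?_).symm
  rw [hp j (by simpa using hj)]; simp

theorem logSum_shiftLog (p : ℕ → ℂ → ℂ) (J : ℕ) (ℓ z : ℂ) :
    logSum (shiftLog p) (J + 1) ℓ z = ℓ * logSum p J ℓ z := by
  rw [logSum, Finset.sum_range_succ', logSum, Finset.mul_sum]
  simp only [shiftLog, Pi.zero_apply, zero_mul, add_zero]
  exact Finset.sum_congr rfl fun j _ => by ring

theorem logSum_add (p q : ℕ → ℂ → ℂ) (J : ℕ) (ℓ z : ℂ) :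
    logSum (fun j z => p j z + q j z) J ℓ z = logSum p J ℓ z + logSum q J ℓ z := by
  simp only [logSum, add_mul, Finset.sum_add_distrib]

theorem logSum_mul (f : ℂ → ℂ) (p : ℕ → ℂ → ℂ) (J : ℕ) (ℓ z : ℂ) :
    logSum (fun j z => f z * p j z) J ℓ z = f z * logSum p J ℓ z := by
  simp only [logSum, Finset.mul_sum, mul_assoc]

theorem differentiableOn_shiftLog {p : ℕ → ℂ → ℂ} {D : Set ℂ}
    (hp : ∀ j, DifferentiableOn ℂ (p j) D) (j : ℕ) : DifferentiableOn ℂ (shiftLog p j) D := by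
  rcases j with _ | j
  · exact differentiableOn_const 0
  · exact hp j

theorem norm_shiftLog_le {p : ℕ → ℂ → ℂ} {T : ℝ} (hT : 0 ≤ T) {z : ℂ} (hp : ∀ j, ‖p j z‖ ≤ T)
    (j : ℕ) : ‖shiftLog p j z‖ ≤ T := by
  rcases j with _ | j
  · simpa [shiftLog] using hT
  · exact hp j

/-- Primitives of logarithmic polynomials with respect to `ϑ + m`. -/
theorem exists_log_euler_solution {R : ℝ} (m : ℂ) (J : ℕ) : ∀ p : ℕ → ℂ → ℂ,
    (∀ j, DifferentiableOn ℂ (p j) (Metric.ball 0 R)) → (∀ j, J < j → p j = 0) →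
    ∃ P : ℕ → ℂ → ℂ, (∀ j, DifferentiableOn ℂ (P j) (Metric.ball 0 R)) ∧
      (∀ j, J + 1 < j → P j = 0) ∧
      (∀ j, ∀ z ∈ Metric.ball (0 : ℂ) R,
        z * deriv (P j) z + m * P j z + (j + 1) * P (j + 1) z = p j z) ∧
      (∀ m' : ℝ, m = m' → 1 ≤ m' → ∀ z, P (J + 1) z = 0) ∧
      ∀ (m' ρ Θ S T : ℝ), m = m' → 1 ≤ m' → ρ < R → 0 ≤ Θ → J ≤ Θ * m' → 0 ≤ S → S ≤ T →
        (∀ j, ∀ z ∈ Metric.closedBall (0 : ℂ) ρ, ‖p j z‖ ≤ if j < J then S else T) →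
        ∀ j, ∀ z ∈ Metric.closedBall (0 : ℂ) ρ, ‖P j z‖ ≤ T * (1 + Θ) ^ J := by
  -- In the range `m ≥ 1`, where bounds are needed, resonances do not occur and the logarithmic
  -- degree does not rise.
  have noRes : ∀ (m' : ℝ) (n : ℕ) (r : ℂ), m = m' → 1 ≤ m' → ((n : ℂ) + m = 0 ∨ r = 0) →
      r = 0 := by
    intro m' n r hm h1 h
    refine h.resolve_left fun h2 => ?_
    rw [hm] at h2
    have h3 : (n : ℝ) + m' = 0 := by exact_mod_cast h2
    have h4 : (0 : ℝ) ≤ n := n.cast_nonneg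
    linarith
  -- A resonant monomial is annihilated by `ϑ + m`, so it may serve as the coefficient of one more
  -- power of the logarithm.
  have hpow : ∀ (r : ℂ) (n : ℕ), ((n : ℂ) + m = 0 ∨ r = 0) → ∀ (c z : ℂ),
      z * deriv (fun z => r * z ^ n / c) z + m * (r * z ^ n / c) = 0 := by
    intro r n h c z
    have hd : HasDerivAt (fun z : ℂ => r * z ^ n / c) (r * (n * z ^ (n - 1)) / c) z :=
      ((hasDerivAt_pow n z).const_mul r).div_const c
    rw [hd.deriv]
    rcases h with h | h
    · rcases n with _ | n
      · have : m = 0 := by simpa using h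
        simp [this]
      · simp only [Nat.add_sub_cancel]
        rw [eq_neg_of_add_eq_zero_right h]
        ring
    · simp [h]
  have bnd : ∀ (m' ρ T : ℝ) (P q : ℂ → ℂ), DifferentiableOn ℂ P (Metric.ball 0 R) →
      m = m' → 1 ≤ m' → ρ < R → 0 ≤ T →
      (∀ z ∈ Metric.ball (0 : ℂ) R, z * deriv P z + m * P z = q z) →
      (∀ z ∈ Metric.closedBall (0 : ℂ) ρ, ‖q z‖ ≤ T) →
      ∀ z ∈ Metric.closedBall (0 : ℂ) ρ, ‖P z‖ ≤ T / m' := by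
    intro m' ρ T P q hP hm h1 hρ hT he hq z hz
    refine norm_le_of_euler hρ h1 hP (fun w hw => ?_) hz
    rw [← hm, he w (Metric.closedBall_subset_ball hρ hw)]
    exact hq w hw
  induction J with
  | zero =>
    intro p hp hsupp
    obtain ⟨P, r, n, hP, hr, hPe⟩ := exists_euler_solution (hp 0) m
    refine ⟨fun j => if j = 0 then P else if j = 1 then fun z => r * z ^ n / 1 else 0, ?_, ?_, ?_,
      ?_, ?_⟩
    · intro j
      rcases j with _ | _ | j
      · simpa using hP
      · simp only [zero_add, one_ne_zero, if_false, if_true]; fun_prop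
      · simp
    · intro j hj
      have h1 : j ≠ 0 := by omega
      have h2 : j ≠ 1 := by omega
      simp [h1, h2]
    · intro j z hz
      rcases j with _ | _ | j
      · simp only [if_true, zero_add, one_ne_zero, if_false, Nat.cast_zero, one_mul, div_one]
        linear_combination hPe z hz
      · have h2 : ((1 : ℕ) + 1) ≠ 1 := by norm_num
        simp only [zero_add, one_ne_zero, if_false, if_true, h2, hpow r n hr 1 z]
        simp [hsupp 1 one_pos]
      · simp [hsupp (j + 2) (by omega)]
    · intro m' hm h1 z
      simp [noRes m' n r hm h1 hr]
    · intro m' ρ Θ S T hm h1 hρ hΘ hJ hS hST hb j z hz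
      have hr0 := noRes m' n r hm h1 hr
      have hT : 0 ≤ T := hS.trans hST
      rcases j with _ | _ | j
      · simp only [if_true, pow_zero, mul_one]
        have := bnd m' ρ T P (p 0) hP hm h1 hρ hT (fun z hz => by rw [hPe z hz, hr0]; ring)
          (by simpa using hb 0) z hz
        exact this.trans (div_le_self hT h1)
      · simpa [hr0] using hT
      · simpa using hT
  | succ J ih =>
    intro p hp hsupp
    obtain ⟨P, r, n, hP, hr, hPe⟩ := exists_euler_solution (hp (J + 1)) m
    -- The top coefficient `P` is found first. Its contribution `(J+1) P` to the next lower equation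
    -- is moved to the source, which lowers the degree by one.
    set p' : ℕ → ℂ → ℂ := fun j => if j < J then p j else
      if j = J then fun z => p J z - (J + 1) * P z else 0 with hp'
    obtain ⟨Q, hQ, hQs, hQe, hQ0, hQb⟩ := ih p' (fun j => by
        rcases lt_trichotomy j J with h | h | h
        · simpa [hp', h] using hp j
        · subst h; simpa [hp'] using (hp j).fun_sub (hP.const_mul _)
        · simp [hp', h.not_gt, h.ne'])
      (fun j hj => by simp [hp', hj.not_gt, hj.ne'])
    -- Differentiating the logarithm to the power `J + 2` restores the residue of the top equation.
    -- The possible extra coefficient `Q (J + 1)` from the lower problem lies in the kernel of `ϑ +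
    -- m`, so adding it to `P` does no harm.
    refine ⟨fun j => if j = J + 1 then fun z => Q (J + 1) z + P z else
      if j = J + 2 then fun z => r * z ^ n / ((J : ℂ) + 1 + 1) else Q j, ?_, ?_, ?_, ?_, ?_⟩
    · intro j
      by_cases h1 : j = J + 1
      · simpa [h1] using (hQ (J + 1)).fun_add hP
      · by_cases h2 : j = J + 2
        · simp only [h2, if_true]
          simp only [show J + 2 ≠ J + 1 by omega, if_false]
          fun_prop
        · simpa [h1, h2] using hQ j
    · intro j hj
      have h1 : j ≠ J + 1 := by omega
      have h2 : j ≠ J + 2 := by omega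
      simp only [h1, h2, if_false]
      exact hQs j (by omega)
    · intro j z hz
      have hQe' := hQe j z hz
      have dQ : ∀ j, DifferentiableAt ℂ (Q j) z := fun j =>
        (hQ j).differentiableAt (Metric.isOpen_ball.mem_nhds hz)
      have dP : DifferentiableAt ℂ P z := hP.differentiableAt (Metric.isOpen_ball.mem_nhds hz)
      rcases lt_trichotomy j J with h | h | h
      · simp only [show j ≠ J + 1 by omega, show j ≠ J + 2 by omega, show j + 1 ≠ J + 1 by omega,
          show j + 1 ≠ J + 2 by omega, if_false]
        rw [hQe']; simp [hp', h]
      · subst h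
        simp only [hp', lt_irrefl, if_false, if_true] at hQe'
        simp only [show j ≠ j + 1 by omega, show j ≠ j + 2 by omega, if_false, if_true]
        linear_combination hQe'
      · simp only [hp', h.not_gt, h.ne', if_false, Pi.zero_apply] at hQe'
        by_cases h1 : j = J + 1
        · subst h1
          simp only [if_true, show J + 1 + 1 ≠ J + 1 by omega, if_false]
          rw [(((dQ (J + 1)).hasDerivAt).fun_add dP.hasDerivAt).deriv]
          have h3 : ((J : ℂ) + 1 + 1) ≠ 0 := by exact_mod_cast (J + 1).succ_ne_zero
          have h4 := hPe z hz
          rw [hQs (J + 1 + 1) (by omega)] at hQe'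
          push_cast at hQe' ⊢
          simp only [Pi.zero_apply] at hQe'
          field_simp
          linear_combination hQe' + h4
        · by_cases h2 : j = J + 2
          · subst h2
            simp only [show J + 2 ≠ J + 1 by omega, show J + 2 + 1 ≠ J + 1 by omega,
              show J + 2 + 1 ≠ J + 2 by omega, if_false, if_true]
            rw [hpow r n hr ((J : ℂ) + 1 + 1) z, hQs (J + 2 + 1) (by omega),
              hsupp (J + 2) (by omega)]
            simp
          · simp only [h1, h2, show j + 1 ≠ J + 1 by omega, show j + 1 ≠ J + 2 by omega, if_false]
            rw [hQe', hsupp j (by omega)]; rfl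
    · intro m' hm h1 z
      simp [noRes m' n r hm h1 hr]
    · intro m' ρ Θ S T hm h1 hρ hΘ hJ hS hST hb j z hz
      have hr0 := noRes m' n r hm h1 hr
      have hT : 0 ≤ T := hS.trans hST
      have hm0 : 0 < m' := by linarith
      have hPb := bnd m' ρ T P (p (J + 1)) hP hm h1 hρ hT
        (fun z hz => by rw [hPe z hz, hr0]; ring) (by simpa using hb (J + 1))
      push_cast at hJ
      have hΘ1 : T ≤ T * (1 + Θ) := by nlinarith
      have hQb' := hQb m' ρ Θ S (T * (1 + Θ)) hm h1 hρ hΘ (by linarith) hS (hST.trans hΘ1) (by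
        intro j z hz
        rcases lt_trichotomy j J with h | h | h
        · have := hb j z hz
          rw [if_pos (by omega)] at this
          simpa [hp', h] using this
        · subst h
          have h3 := hb j z hz
          rw [if_pos (by omega)] at h3
          -- The factor `j + 1 ≤ Θ m'` is balanced by the gain `1/m'` in the bound of `P`, so each
          -- step down costs only `1 + Θ`.
          have h4 : ‖((j : ℂ) + 1) * P z‖ ≤ T * Θ := by
            rw [norm_mul]
            have : ‖(j : ℂ) + 1‖ = j + 1 := by
              rw [← Nat.cast_one, ← Nat.cast_add, Complex.norm_natCast]; push_cast; rfl
            rw [this]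
            calc ((j : ℝ) + 1) * ‖P z‖ ≤ (Θ * m') * (T / m') :=
                  mul_le_mul hJ (hPb z hz) (norm_nonneg _) (by positivity)
              _ = T * Θ := by field_simp
          simp only [hp', lt_irrefl, if_false, if_true]
          refine (norm_sub_le _ _).trans ?_
          linarith
        · simp only [hp', h.not_gt, h.ne', if_false]
          simp only [Pi.zero_apply, norm_zero]
          positivity)
      have hTT : T ≤ T * (1 + Θ) ^ (J + 1) := le_mul_of_one_le_right hT (one_le_pow₀ (by linarith))
      by_cases h2 : j = J + 1
      · simp only [h2, if_true, hQ0 m' hm h1 z, zero_add]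
        exact ((hPb z hz).trans (div_le_self hT h1)).trans hTT
      · by_cases h3 : j = J + 2
        · subst h3
          simp only [show J + 2 ≠ J + 1 by omega, if_false, if_true, hr0]
          simp only [zero_mul, zero_div, norm_zero]
          positivity
        · simp only [h2, h3, if_false]
          refine (hQb' j z hz).trans (le_of_eq ?_)
          ring

/-- The coefficient identities `he` express `(ϑ + m) ∑ P_j ℓ^j = ∑ p_j ℓ^j`, so the recursive
solution supplies primitives with respect to `dz/z`. -/
theorem IsLogDomain.hasDerivAt_logSum {V : Set ℂ} {ℓ : ℂ → ℂ} (hV : IsLogDomain V ℓ) {R : ℝ}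
    (hVR : V ⊆ Metric.ball 0 R) {m : ℂ} {J : ℕ} {p P : ℕ → ℂ → ℂ}
    (hP : ∀ j, DifferentiableOn ℂ (P j) (Metric.ball 0 R)) (hPs : ∀ j, J + 1 < j → P j = 0)
    (hp : ∀ j, J < j → p j = 0)
    (he : ∀ j, ∀ z ∈ Metric.ball (0 : ℂ) R,
      z * deriv (P j) z + m * P j z + (j + 1) * P (j + 1) z = p j z) {z : ℂ} (hz : z ∈ V) :
    HasDerivAt (fun z => Complex.exp (m * ℓ z) * logSum P (J + 1) (ℓ z) z)
      (Complex.exp (m * ℓ z) * logSum p J (ℓ z) z / z) z := by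
  have hz0 := hV.ne_zero z hz
  have dP : ∀ j, HasDerivAt (P j) (deriv (P j) z) z := fun j =>
    ((hP j).differentiableAt (Metric.isOpen_ball.mem_nhds (hVR hz))).hasDerivAt
  have h1 : HasDerivAt (fun z => logSum P (J + 1) (ℓ z) z)
      (∑ j ∈ Finset.range (J + 2),
        (deriv (P j) z * ℓ z ^ j + P j z * (j * ℓ z ^ (j - 1) * (1 / z)))) z := by
    simp only [logSum]
    exact HasDerivAt.fun_sum fun j _ => (dP j).fun_mul ((hV.hasDerivAt z hz).fun_pow j)
  refine ((hV.hasDerivAt_exp m hz).fun_mul h1).congr_deriv ?_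
  have h2 : ∑ j ∈ Finset.range (J + 2), P j z * (j * ℓ z ^ (j - 1))
      = ∑ j ∈ Finset.range (J + 2), (j + 1) * P (j + 1) z * ℓ z ^ j := by
    rw [Finset.sum_range_succ', Finset.sum_range_succ _ (J + 1), hPs (J + 1 + 1) (by omega)]
    simp only [Nat.cast_zero, zero_mul, mul_zero, add_zero, Pi.zero_apply]
    refine Finset.sum_congr rfl fun j _ => ?_
    simp only [Nat.add_sub_cancel]; push_cast; ring
  rw [← logSum_of_le (Nat.le_succ J) hp]
  have h3 : logSum p (J + 1) (ℓ z) z = (z * ∑ j ∈ Finset.range (J + 2), deriv (P j) z * ℓ z ^ j)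
      + m * logSum P (J + 1) (ℓ z) z
      + ∑ j ∈ Finset.range (J + 2), P j z * (j * ℓ z ^ (j - 1)) := by
    rw [h2]
    simp only [logSum, Finset.mul_sum, ← Finset.sum_add_distrib]
    refine Finset.sum_congr rfl fun j _ => ?_
    rw [← he j z (hVR hz)]; ring
  have h4 : ∑ j ∈ Finset.range (J + 2),
        (deriv (P j) z * ℓ z ^ j + P j z * (j * ℓ z ^ (j - 1) * (1 / z)))
      = (∑ j ∈ Finset.range (J + 2), deriv (P j) z * ℓ z ^ j)
        + (∑ j ∈ Finset.range (J + 2), P j z * (j * ℓ z ^ (j - 1))) * (1 / z) := by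
    rw [Finset.sum_mul, ← Finset.sum_add_distrib]
    exact Finset.sum_congr rfl fun j _ => by ring
  rw [h4, h3]
  field_simp
  ring

theorem exists_norm_le_of_differentiableOn {R ρ : ℝ} (hρ : ρ < R) {f : ℂ → ℂ}
    (hf : DifferentiableOn ℂ f (Metric.ball 0 R)) :
    ∃ C, ∀ z ∈ Metric.closedBall (0 : ℂ) ρ, ‖f z‖ ≤ C :=
  (isCompact_closedBall (0 : ℂ) ρ).exists_bound_of_continuousOn
    (hf.continuousOn.mono (Metric.closedBall_subset_ball hρ))

/-! ### Variation of constants with logarithmic sources -/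

namespace FrobeniusBasis

variable {N A B : ℂ}

theorem diff_k₁ (b : FrobeniusBasis N A B) : DifferentiableOn ℂ b.k₁ (Metric.ball 0 1) :=
  ((differentiableOn_id.fun_mul (b.diff_h₁.deriv Metric.isOpen_ball)).fun_add
    (b.diff_Z.fun_mul b.diff_h₂)).congr b.k₁_eq

theorem wronskian_eq (b : FrobeniusBasis N A B) (ℓ : ℂ → ℂ) (z : ℂ) :
    (b.h₁ z + ℓ z * (b.Z z * b.h₂ z)) * (Complex.exp (N * ℓ z) * b.k₂ z)
      - (Complex.exp (N * ℓ z) * b.h₂ z) * (b.k₁ z + ℓ z * (b.Z z * b.k₂ z))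
      = Complex.exp (N * ℓ z) * (b.h₁ z * b.k₂ z - b.h₂ z * b.k₁ z) := by ring

theorem wronskian_ne_zero (b : FrobeniusBasis N A B) {V : Set ℂ} {ℓ : ℂ → ℂ}
    (hV : IsLogDomain V ℓ) {z : ℂ} (hz : z ∈ V) :
    (b.h₁ z + ℓ z * (b.Z z * b.h₂ z)) * (Complex.exp (N * ℓ z) * b.k₂ z)
      - (Complex.exp (N * ℓ z) * b.h₂ z) * (b.k₁ z + ℓ z * (b.Z z * b.k₂ z)) ≠ 0 := by
  rw [b.wronskian_eq]
  exact mul_ne_zero (Complex.exp_ne_zero _) (b.wronskian z (hV.subset_ball hz))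

/-- Solution of the inhomogeneous equation whose source is a power times a logarithmic
polynomial. -/
theorem exists_solution_logSum {N : ℝ} (hN : 0 ≤ N) (b : FrobeniusBasis (N : ℂ) A B) {R ρ : ℝ}
    (hR : R ≤ 1) (hρ : ρ < R) : ∃ C₀ : ℝ, 0 ≤ C₀ ∧ ∀ (e : ℝ) (J : ℕ) (p : ℕ → ℂ → ℂ),
      (∀ j, DifferentiableOn ℂ (p j) (Metric.ball 0 R)) → (∀ j, J < j → p j = 0) →
      ∃ P Q : ℕ → ℂ → ℂ, (∀ j, DifferentiableOn ℂ (P j) (Metric.ball 0 R)) ∧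
        (∀ j, DifferentiableOn ℂ (Q j) (Metric.ball 0 R)) ∧
        (∀ j, J + 2 < j → P j = 0) ∧ (∀ j, J + 2 < j → Q j = 0) ∧
        (∀ V ℓ, IsLogDomain V ℓ → V ⊆ Metric.ball 0 R → EulerSys N A B V
          (fun z => Complex.exp (e * ℓ z) * logSum P (J + 2) (ℓ z) z)
          (fun z => Complex.exp (e * ℓ z) * logSum Q (J + 2) (ℓ z) z)
          (fun z => Complex.exp (e * ℓ z) * logSum p J (ℓ z) z)) ∧
        ∀ Θ S : ℝ, 1 ≤ e - N → 0 ≤ Θ → (J : ℝ) + 1 ≤ Θ * (e - N) → 0 ≤ S →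
          (∀ j, ∀ z ∈ Metric.closedBall (0 : ℂ) ρ, ‖p j z‖ ≤ S) →
          ∀ j, ∀ z ∈ Metric.closedBall (0 : ℂ) ρ,
            ‖P j z‖ ≤ C₀ * (S * (1 + Θ) ^ (J + 1)) ∧ ‖Q j z‖ ≤ C₀ * (S * (1 + Θ) ^ (J + 1)) := by
  have hsub : Metric.ball (0 : ℂ) R ⊆ Metric.ball 0 1 := Metric.ball_subset_ball hR
  have hω : ∀ z ∈ Metric.ball (0 : ℂ) 1, (1 - z) * (b.h₁ z * b.k₂ z - b.h₂ z * b.k₁ z) ≠ 0 :=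
    fun z hz => mul_ne_zero (sub_ne_zero.2 fun h => by simp [← h] at hz) (b.wronskian z hz)
  have dω : DifferentiableOn ℂ (fun z => (1 - z) * (b.h₁ z * b.k₂ z - b.h₂ z * b.k₁ z))
      (Metric.ball 0 1) := ((differentiableOn_const 1).fun_sub differentiableOn_id).fun_mul
    ((b.diff_h₁.fun_mul b.diff_k₂).fun_sub (b.diff_h₂.fun_mul b.diff_k₁))
  -- The Wronskian is `z^N` times a nonvanishing holomorphic function. In the integrand of `P₂` the
  -- factor `z^N` cancels; in that of `P₁` it lowers the exponent to `e - N`.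
  set g₁ : ℂ → ℂ := fun z => b.h₁ z / ((1 - z) * (b.h₁ z * b.k₂ z - b.h₂ z * b.k₁ z)) with hg₁
  set g₂ : ℂ → ℂ := fun z => b.h₂ z / ((1 - z) * (b.h₁ z * b.k₂ z - b.h₂ z * b.k₁ z)) with hg₂
  have dg₁ : DifferentiableOn ℂ g₁ (Metric.ball 0 R) := (b.diff_h₁.fun_div dω hω).mono hsub
  have dg₂ : DifferentiableOn ℂ g₂ (Metric.ball 0 R) := (b.diff_h₂.fun_div dω hω).mono hsub
  have dh₁ := b.diff_h₁.mono hsub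
  have dh₂ := b.diff_h₂.mono hsub
  have dk₁ := b.diff_k₁.mono hsub
  have dk₂ := b.diff_k₂.mono hsub
  have dZ := b.diff_Z.mono hsub
  obtain ⟨c1, hc1⟩ := exists_norm_le_of_differentiableOn hρ dg₁
  obtain ⟨c2, hc2⟩ := exists_norm_le_of_differentiableOn hρ dg₂
  obtain ⟨c3, hc3⟩ := exists_norm_le_of_differentiableOn hρ dh₁
  obtain ⟨c4, hc4⟩ := exists_norm_le_of_differentiableOn hρ dh₂
  obtain ⟨c5, hc5⟩ := exists_norm_le_of_differentiableOn hρ dk₁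
  obtain ⟨c6, hc6⟩ := exists_norm_le_of_differentiableOn hρ dk₂
  obtain ⟨c7, hc7⟩ := exists_norm_le_of_differentiableOn hρ dZ
  obtain ⟨C, hC⟩ : ∃ C : ℝ, 1 ≤ C ∧ c1 ≤ C ∧ c2 ≤ C ∧ c3 ≤ C ∧ c4 ≤ C ∧ c5 ≤ C ∧ c6 ≤ C ∧
      c7 ≤ C := by
    refine ⟨1 + |c1| + |c2| + |c3| + |c4| + |c5| + |c6| + |c7|, ?_⟩
    have := le_abs_self c1
    have := le_abs_self c2
    have := le_abs_self c3
    have := le_abs_self c4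
    have := le_abs_self c5
    have := le_abs_self c6
    have := le_abs_self c7
    have := abs_nonneg c1
    have := abs_nonneg c2
    have := abs_nonneg c3
    have := abs_nonneg c4
    have := abs_nonneg c5
    have := abs_nonneg c6
    have := abs_nonneg c7
    refine ⟨?_, ?_, ?_, ?_, ?_, ?_, ?_, ?_⟩ <;> linarith
  obtain ⟨hC1, h1, h2, h3, h4, h5, h6, h7⟩ := hC
  have hC0 : 0 ≤ C := by linarith
  -- The constant depends only on bounds for the basis on the disc of radius `ρ`, not on `e`, `J` or
  -- `p`. Series can therefore be treated term by term.
  refine ⟨4 * C ^ 3, by positivity, fun e J p hp hps => ?_⟩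
  obtain ⟨P₂, dP₂, sP₂, eP₂, -, bP₂⟩ := exists_log_euler_solution (R := R) (e : ℂ) J
    (fun j z => g₂ z * p j z) (fun j => dg₂.fun_mul (hp j))
    (fun j hj => by funext z; simp [hps j hj])
  -- The logarithm in the first basis function raises the degree of this source to `J + 1`, and
  -- integration raises it to at most `J + 2`.
  set p₁ : ℕ → ℂ → ℂ := fun j z => g₁ z * p j z + (b.Z z * g₂ z) * shiftLog p j z with hp₁
  have sp₁ : ∀ j, J + 1 < j → p₁ j = 0 := fun j hj => by
    obtain ⟨i, rfl⟩ : ∃ i, j = i + 1 := ⟨j - 1, by omega⟩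
    funext z; simp [hp₁, shiftLog, hps (i + 1) (by omega), hps i (by omega)]
  obtain ⟨P₁, dP₁, sP₁, eP₁, -, bP₁⟩ := exists_log_euler_solution (R := R) ((e : ℂ) - N) (J + 1)
    p₁ (fun j => (dg₁.fun_mul (hp j)).fun_add
      ((dZ.fun_mul dg₂).fun_mul (differentiableOn_shiftLog hp j))) sp₁
  have sh : ∀ j, J + 2 < j → shiftLog P₂ j = 0 := fun j hj => by
    obtain ⟨i, rfl⟩ : ∃ i, j = i + 1 := ⟨j - 1, by omega⟩
    exact sP₂ i (by omega)
  refine ⟨fun j z => (b.h₂ z * P₁ j z - b.h₁ z * P₂ j z) - (b.Z z * b.h₂ z) * shiftLog P₂ j z,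
    fun j z => (b.k₂ z * P₁ j z - b.k₁ z * P₂ j z) - (b.Z z * b.k₂ z) * shiftLog P₂ j z,
    fun j => ((dh₂.fun_mul (dP₁ j)).fun_sub (dh₁.fun_mul (dP₂ j))).fun_sub
      ((dZ.fun_mul dh₂).fun_mul (differentiableOn_shiftLog dP₂ j)),
    fun j => ((dk₂.fun_mul (dP₁ j)).fun_sub (dk₁.fun_mul (dP₂ j))).fun_sub
      ((dZ.fun_mul dk₂).fun_mul (differentiableOn_shiftLog dP₂ j)),
    fun j hj => by funext z; simp [sP₁ j hj, sP₂ j (by omega), sh j hj],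
    fun j hj => by funext z; simp [sP₁ j hj, sP₂ j (by omega), sh j hj], ?_, ?_⟩
  · intro V ℓ hV hVR
    have D₂ := fun z (hz : z ∈ V) => hV.hasDerivAt_logSum hVR dP₂ sP₂
      (fun j hj => by funext z; simp [hps j hj]) eP₂ hz
    have D₁ := fun z (hz : z ∈ V) => hV.hasDerivAt_logSum hVR dP₁ sP₁ sp₁ eP₁ hz
    have hM : ∀ z, Complex.exp (e * ℓ z)
        = Complex.exp (((e : ℂ) - N) * ℓ z) * Complex.exp (N * ℓ z) := fun z => by
      rw [← Complex.exp_add]; congr 1; ring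
    have expand : ∀ (u v : ℂ → ℂ) (z : ℂ),
        logSum (fun j z => (u z * P₁ j z - v z * P₂ j z) - (b.Z z * u z) * shiftLog P₂ j z)
          (J + 2) (ℓ z) z = u z * logSum P₁ (J + 2) (ℓ z) z - v z * logSum P₂ (J + 1) (ℓ z) z
            - ℓ z * (b.Z z * u z) * logSum P₂ (J + 1) (ℓ z) z := by
      intro u v z
      have a1 : logSum (fun j z => (u z * P₁ j z - v z * P₂ j z) - (b.Z z * u z) * shiftLog P₂ j z)
          (J + 2) (ℓ z) z = u z * logSum P₁ (J + 2) (ℓ z) z - v z * logSum P₂ (J + 2) (ℓ z) z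
            - (b.Z z * u z) * logSum (shiftLog P₂) (J + 2) (ℓ z) z := by
        simp only [logSum, Finset.mul_sum, ← Finset.sum_sub_distrib]
        exact Finset.sum_congr rfl fun j _ => by ring
      rw [a1, logSum_shiftLog, logSum_of_le (J := J + 1) (by omega) sP₂]
      ring
    have hp₁e : ∀ z, logSum p₁ (J + 1) (ℓ z) z
        = (g₁ z + ℓ z * (b.Z z * g₂ z)) * logSum p J (ℓ z) z := fun z => by
      rw [hp₁, logSum_add, logSum_mul, logSum_mul (fun z => b.Z z * g₂ z), logSum_shiftLog,
        logSum_of_le (J := J) (by omega) hps]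
      ring
    refine ((b.sol₁ V ℓ hV).variation (b.sol₂ V ℓ hV)
      (S := fun z => Complex.exp (e * ℓ z) * logSum p J (ℓ z) z)
      (fun z hz => b.wronskian_ne_zero hV hz) (fun z hz => (D₁ z hz).differentiableAt)
      (fun z hz => (D₂ z hz).differentiableAt) (fun z hz => ?_) (fun z hz => ?_)
      (fun z hz => hV.ne_one hz)).congr hV.isOpen (fun z hz => ?_) (fun z hz => ?_)
      (fun z hz => rfl)
    · rw [(D₁ z hz).deriv, b.wronskian_eq, hp₁e, hM, hg₁, hg₂]
      have := hω z (hV.subset_ball hz)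
      have h0 := hV.ne_zero z hz
      have h1' := left_ne_zero_of_mul this
      have h2' := right_ne_zero_of_mul this
      field_simp
    · rw [(D₂ z hz).deriv, b.wronskian_eq, logSum_mul, hg₂]
      have := hω z (hV.subset_ball hz)
      have h0 := hV.ne_zero z hz
      have h1' := left_ne_zero_of_mul this
      have h2' := right_ne_zero_of_mul this
      field_simp
    · rw [expand, hM]
      ring
    · rw [expand, hM]
      ring
  · intro Θ S he hΘ hJ hS hb j z hz
    have hge : (1 : ℝ) ≤ 1 + Θ := by linarith
    have bnd₂ : ∀ j, ∀ z ∈ Metric.closedBall (0 : ℂ) ρ, ‖P₂ j z‖ ≤ C * (S * (1 + Θ) ^ (J + 1)) := by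
      intro j z hz
      have := bP₂ e ρ Θ (C * S) (C * S) rfl (by linarith) hρ hΘ (by nlinarith) (by positivity)
        le_rfl (fun j z hz => by
          rw [ite_self, norm_mul]
          exact mul_le_mul ((hc2 z hz).trans h2) (hb j z hz) (norm_nonneg _) hC0) j z hz
      refine this.trans ?_
      rw [mul_assoc]
      gcongr
      omega
    have bnd₁ : ∀ j, ∀ z ∈ Metric.closedBall (0 : ℂ) ρ,
        ‖P₁ j z‖ ≤ 2 * C ^ 2 * (S * (1 + Θ) ^ (J + 1)) := by
      intro j z hz
      have := bP₁ (e - N) ρ Θ (2 * C ^ 2 * S) (2 * C ^ 2 * S) (by push_cast; rfl) he hρ hΘ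
        (by push_cast; exact hJ) (by positivity) le_rfl (fun j z hz => by
          rw [ite_self]
          have a1 : ‖g₁ z * p j z‖ ≤ C * S := by
            rw [norm_mul]
            exact mul_le_mul ((hc1 z hz).trans h1) (hb j z hz) (norm_nonneg _) hC0
          have a2 : ‖b.Z z * g₂ z * shiftLog p j z‖ ≤ C * C * S := by
            rw [norm_mul, norm_mul]
            exact mul_le_mul (mul_le_mul ((hc7 z hz).trans h7) ((hc2 z hz).trans h2)
              (norm_nonneg _) hC0) (norm_shiftLog_le hS (fun j => hb j z hz) j) (norm_nonneg _)
              (by positivity)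
          refine (norm_add_le _ _).trans ?_
          nlinarith [mul_nonneg hC0 hS]) j z hz
      rwa [mul_assoc] at this
    set X := S * (1 + Θ) ^ (J + 1) with hX
    have hX0 : 0 ≤ X := by positivity
    have fin : ∀ u v : ℂ → ℂ, ‖u z‖ ≤ C → ‖v z‖ ≤ C →
        ‖(u z * P₁ j z - v z * P₂ j z) - (b.Z z * u z) * shiftLog P₂ j z‖ ≤ 4 * C ^ 3 * X := by
      intro u v hu hv
      have a1 : ‖u z * P₁ j z‖ ≤ C * (2 * C ^ 2 * X) := by
        rw [norm_mul]; exact mul_le_mul hu (bnd₁ j z hz) (norm_nonneg _) hC0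
      have a2 : ‖v z * P₂ j z‖ ≤ C * (C * X) := by
        rw [norm_mul]; exact mul_le_mul hv (bnd₂ j z hz) (norm_nonneg _) hC0
      have a3 : ‖b.Z z * u z * shiftLog P₂ j z‖ ≤ C * C * (C * X) := by
        rw [norm_mul, norm_mul]
        exact mul_le_mul (mul_le_mul ((hc7 z hz).trans h7) hu (norm_nonneg _) hC0)
          (norm_shiftLog_le (by positivity) (fun j => bnd₂ j z hz) j) (norm_nonneg _)
          (by positivity)
      have a4 : C * (C * X) ≤ C ^ 3 * X := by
        have : C ^ 2 * X * 1 ≤ C ^ 2 * X * C := mul_le_mul_of_nonneg_left hC1 (by positivity)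
        nlinarith
      have := norm_sub_le (u z * P₁ j z - v z * P₂ j z) (b.Z z * u z * shiftLog P₂ j z)
      have := norm_sub_le (u z * P₁ j z) (v z * P₂ j z)
      nlinarith
    exact ⟨fin b.h₂ b.h₁ ((hc4 z hz).trans h4) ((hc3 z hz).trans h3),
      fin b.k₂ b.k₁ ((hc6 z hz).trans h6) ((hc5 z hz).trans h5)⟩

end FrobeniusBasis

/-! ### The system on real intervals -/

/-- Restriction of `EulerSys` to a set of real numbers. -/
structure RealEulerSys (N A B : ℂ) (I : Set ℝ) (F G S : ℝ → ℂ) : Prop where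
  fst : ∀ x ∈ I, HasDerivAt F (G x / x) x
  snd : ∀ x ∈ I, HasDerivAt G
    (((N + x * (A + B)) * G x + x * A * B * F x + S x) / (x * (1 - x))) x

theorem EulerSys.restrict_real {N A B : ℂ} {V : Set ℂ} {I : Set ℝ} {F G S : ℂ → ℂ}
    (h : EulerSys N A B V F G S) (hI : ∀ x ∈ I, (x : ℂ) ∈ V) (h0 : ∀ z ∈ V, z ≠ 0)
    (h1 : ∀ z ∈ V, z ≠ 1) :
    RealEulerSys N A B I (fun x => F x) (fun x => G x) (fun x => S x) := by
  refine ⟨fun x hx => ?_, fun x hx => ?_⟩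
  · have := (h.1 x (hI x hx)).hasDerivAt.comp_ofReal
    rwa [eq_div_of_mul_eq (h0 _ (hI x hx)) ((mul_comm _ _).trans (h.3 x (hI x hx)))] at this
  · have := (h.2 x (hI x hx)).hasDerivAt.comp_ofReal
    have hne : (x : ℂ) * (1 - x) ≠ 0 :=
      mul_ne_zero (h0 _ (hI x hx)) (sub_ne_zero.2 (h1 _ (hI x hx)).symm)
    rwa [eq_div_of_mul_eq hne ((mul_comm _ _).trans (h.4 x (hI x hx)))] at this

namespace RealEulerSys

variable {N A B : ℂ} {I I' : Set ℝ} {F G S F' G' S' : ℝ → ℂ}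

theorem mono (h : RealEulerSys N A B I F G S) (hI : I' ⊆ I) : RealEulerSys N A B I' F G S :=
  ⟨fun x hx => h.1 x (hI hx), fun x hx => h.2 x (hI hx)⟩

theorem congr (hI : IsOpen I) (h : RealEulerSys N A B I F G S) (hF : EqOn F' F I)
    (hG : EqOn G' G I) (hS : EqOn S' S I) : RealEulerSys N A B I F' G' S' := by
  refine ⟨fun x hx => ?_, fun x hx => ?_⟩
  · rw [hG hx]
    exact (h.1 x hx).congr_of_eventuallyEq (hF.eventuallyEq_of_mem (hI.mem_nhds hx))
  · rw [hG hx, hF hx, hS hx]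
    exact (h.2 x hx).congr_of_eventuallyEq (hG.eventuallyEq_of_mem (hI.mem_nhds hx))

theorem lin (h : RealEulerSys N A B I F G S) (h' : RealEulerSys N A B I F' G' S') (c c' : ℂ) :
    RealEulerSys N A B I (fun x => c * F x + c' * F' x) (fun x => c * G x + c' * G' x)
      (fun x => c * S x + c' * S' x) := by
  refine ⟨fun x hx => ?_, fun x hx => ?_⟩
  · exact (((h.1 x hx).const_mul c).fun_add ((h'.1 x hx).const_mul c')).congr_deriv (by ring)
  · exact (((h.2 x hx).const_mul c).fun_add ((h'.2 x hx).const_mul c')).congr_deriv (by ring)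

theorem sub_self_source (h : RealEulerSys N A B I F G S) (h' : RealEulerSys N A B I F' G' S) :
    RealEulerSys N A B I (fun x => F x - F' x) (fun x => G x - G' x) (fun _ => 0) := by
  refine ⟨fun x hx => ?_, fun x hx => ?_⟩
  · exact ((h.1 x hx).fun_sub (h'.1 x hx)).congr_deriv (by ring)
  · exact ((h.2 x hx).fun_sub (h'.2 x hx)).congr_deriv (by ring)

/-- On an interval, solutions of the homogeneous system are combinations of two solutions with
nonvanishing Wronskian. -/
theorem exists_eq_combination {l r : ℝ} (hl : 0 ≤ l) (hr : r ≤ 1) {φ₁ γ₁ φ₂ γ₂ : ℝ → ℂ}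
    (h : RealEulerSys N A B (Ioo l r) F G fun _ => 0)
    (h₁ : RealEulerSys N A B (Ioo l r) φ₁ γ₁ fun _ => 0)
    (h₂ : RealEulerSys N A B (Ioo l r) φ₂ γ₂ fun _ => 0)
    (hw : ∀ x ∈ Ioo l r, φ₁ x * γ₂ x - φ₂ x * γ₁ x ≠ 0) :
    ∃ c₁ c₂ : ℂ, ∀ x ∈ Ioo l r, F x = c₁ * φ₁ x + c₂ * φ₂ x ∧ G x = c₁ * γ₁ x + c₂ * γ₂ x := by
  -- All cross products of homogeneous solutions satisfy the same scalar equation, so their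
  -- quotients by the Wronskian are constant; Cramer's rule then expresses `F` and `G`.
  have cross : ∀ {f g f' g' : ℝ → ℂ}, RealEulerSys N A B (Ioo l r) f g (fun _ => 0) →
      RealEulerSys N A B (Ioo l r) f' g' (fun _ => 0) → ∀ x ∈ Ioo l r,
      HasDerivAt (fun x => f x * g' x - f' x * g x)
        ((N + x * (A + B)) / (x * (1 - x)) * (f x * g' x - f' x * g x)) x := by
    intro f g f' g' hf hf' x hx
    refine (((hf.1 x hx).fun_mul (hf'.2 x hx)).fun_sub
      ((hf'.1 x hx).fun_mul (hf.2 x hx))).congr_deriv ?_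
    have hx0 : (x : ℂ) ≠ 0 := by exact_mod_cast (hl.trans_lt hx.1).ne'
    have hx1 : (1 : ℂ) - x ≠ 0 := by
      rw [sub_ne_zero]; exact_mod_cast (hx.2.trans_le hr).ne'
    field_simp
    ring
  have const : ∀ {f g f' g' : ℝ → ℂ}, RealEulerSys N A B (Ioo l r) f g (fun _ => 0) →
      RealEulerSys N A B (Ioo l r) f' g' (fun _ => 0) → ∃ c : ℂ, ∀ x ∈ Ioo l r,
      f x * g' x - f' x * g x = c * (φ₁ x * γ₂ x - φ₂ x * γ₁ x) := by
    intro f g f' g' hf hf'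
    have hd : ∀ x ∈ Ioo l r, HasDerivAt
        (fun x => (f x * g' x - f' x * g x) / (φ₁ x * γ₂ x - φ₂ x * γ₁ x)) 0 x := by
      intro x hx
      refine ((cross hf hf' x hx).fun_div (cross h₁ h₂ x hx) (hw x hx)).congr_deriv ?_
      rw [div_eq_zero_iff]
      left; ring
    by_cases hne : (Ioo l r).Nonempty
    · obtain ⟨x₀, hx₀⟩ := hne
      refine ⟨(f x₀ * g' x₀ - f' x₀ * g x₀) / (φ₁ x₀ * γ₂ x₀ - φ₂ x₀ * γ₁ x₀), fun x hx => ?_⟩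
      have := isOpen_Ioo.is_const_of_deriv_eq_zero isPreconnected_Ioo
        (fun z hz => (hd z hz).differentiableAt.differentiableWithinAt)
        (fun z hz => (hd z hz).deriv) hx hx₀
      rw [div_eq_iff (hw x hx)] at this
      exact this
    · exact ⟨0, fun x hx => (hne ⟨x, hx⟩).elim⟩
  obtain ⟨c₁, hc₁⟩ := const h h₂
  obtain ⟨c₂, hc₂⟩ := const h₁ h
  refine ⟨c₁, c₂, fun x hx => ⟨mul_right_cancel₀ (hw x hx) ?_, mul_right_cancel₀ (hw x hx) ?_⟩⟩
  · linear_combination φ₁ x * hc₁ x hx + φ₂ x * hc₂ x hx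
  · linear_combination γ₁ x * hc₁ x hx + γ₂ x * hc₂ x hx

/-- The substitution `x ↦ 1 - x`. -/
theorem reflect (h : RealEulerSys N A B I F G S) (hI : I ⊆ Ioo 0 1) :
    RealEulerSys (1 - N - A - B) A B {y | 1 - y ∈ I} (fun y => F (1 - y))
      (fun y => -(y / (1 - y)) * G (1 - y)) (fun y => y / (1 - y) * S (1 - y)) := by
  refine ⟨fun y hy => ?_, fun y hy => ?_⟩
  all_goals
    have h1 := hI hy
    have hy0 : (y : ℂ) ≠ 0 := by
      have : y ≠ 0 := by rintro rfl; simp at h1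
      exact_mod_cast this
    have hy1 : (1 : ℂ) - y ≠ 0 := by
      have : 1 - y ≠ 0 := h1.1.ne'
      exact_mod_cast this
    have hsub : HasDerivAt (fun y : ℝ => 1 - y) (-1) y := (hasDerivAt_id' y).const_sub 1
  · have := (h.1 _ hy).scomp y hsub
    refine this.congr_deriv ?_
    simp only [neg_smul, one_smul]
    push_cast
    field_simp
  · have h2 := (h.2 _ hy).scomp y hsub
    have h3 : HasDerivAt (fun y : ℝ => -((y : ℂ) / (1 - y))) (-(1 / (1 - y) ^ 2)) y := by
      have h4 : HasDerivAt (fun y : ℝ => (y : ℂ)) 1 y := Complex.ofRealCLM.hasDerivAt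
      refine ((h4.fun_div (h4.const_sub 1) hy1).neg).congr_deriv ?_
      field_simp
      ring
    refine (h3.fun_mul h2).congr_deriv ?_
    simp only [neg_smul, one_smul, Function.comp]
    push_cast
    rw [sub_sub_cancel]
    field_simp
    ring

end RealEulerSys

theorem isLogDomain_slit {R : ℝ} (hR : R ≤ 1) :
    IsLogDomain (Complex.slitPlane ∩ Metric.ball 0 R) Complex.log where
  isOpen := Complex.isOpen_slitPlane.inter Metric.isOpen_ball
  subset_ball := inter_subset_right.trans (Metric.ball_subset_ball hR)
  ne_zero := fun _ hz => Complex.slitPlane_ne_zero hz.1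
  hasDerivAt := fun z hz => by
    rw [one_div]; exact Complex.hasDerivAt_log hz.1
  exp_eq := fun _ hz => Complex.exp_log (Complex.slitPlane_ne_zero hz.1)

theorem ofReal_mem_slit_ball {R x : ℝ} (hx : x ∈ Ioo 0 R) :
    (x : ℂ) ∈ Complex.slitPlane ∩ Metric.ball 0 R :=
  ⟨Complex.ofReal_mem_slitPlane.2 hx.1, by simpa [abs_of_pos hx.1] using hx.2⟩

theorem exp_mul_log_ofReal {x : ℝ} (hx : 0 < x) (e : ℝ) :
    Complex.exp (e * Complex.log x) = ((x ^ e : ℝ) : ℂ) := by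
  rw [← Complex.ofReal_log hx.le, Real.rpow_def_of_pos hx]; push_cast; ring_nf

theorem EulerSys.restrict_slit {N A B : ℂ} {R : ℝ} (hR : R ≤ 1) {F G S : ℂ → ℂ}
    (h : EulerSys N A B (Complex.slitPlane ∩ Metric.ball 0 R) F G S) :
    RealEulerSys N A B (Ioo 0 R) (fun x => F x) (fun x => G x) (fun x => S x) :=
  h.restrict_real (fun _ hx => ofReal_mem_slit_ball hx) (isLogDomain_slit hR).ne_zero
    (fun _ hz => (isLogDomain_slit hR).ne_one hz)

namespace FrobeniusBasis

variable {A B : ℂ}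

theorem real₁ {N : ℂ} (b : FrobeniusBasis N A B) : RealEulerSys N A B (Ioo 0 1)
    (fun x => b.h₁ x + Real.log x * (b.Z x * b.h₂ x))
    (fun x => b.k₁ x + Real.log x * (b.Z x * b.k₂ x)) (fun _ => 0) :=
  (b.sol₁ _ _ (isLogDomain_slit le_rfl)).restrict_slit le_rfl |>.congr isOpen_Ioo
    (fun x hx => by simp only [Complex.ofReal_log hx.1.le])
    (fun x hx => by simp only [Complex.ofReal_log hx.1.le]) (fun x hx => rfl)

theorem real₂ {N : ℝ} (b : FrobeniusBasis (N : ℂ) A B) : RealEulerSys N A B (Ioo 0 1)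
    (fun x => ((x ^ N : ℝ) : ℂ) * b.h₂ x) (fun x => ((x ^ N : ℝ) : ℂ) * b.k₂ x) (fun _ => 0) :=
  (b.sol₂ _ _ (isLogDomain_slit le_rfl)).restrict_slit le_rfl |>.congr isOpen_Ioo
    (fun x hx => by simp only [exp_mul_log_ofReal hx.1])
    (fun x hx => by simp only [exp_mul_log_ofReal hx.1]) (fun x hx => rfl)

theorem real_wronskian {N : ℝ} (b : FrobeniusBasis (N : ℂ) A B) {x : ℝ} (hx : x ∈ Ioo (0 : ℝ) 1) :
    (b.h₁ x + Real.log x * (b.Z x * b.h₂ x)) * (((x ^ N : ℝ) : ℂ) * b.k₂ x)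
      - (((x ^ N : ℝ) : ℂ) * b.h₂ x) * (b.k₁ x + Real.log x * (b.Z x * b.k₂ x)) ≠ 0 := by
  have := b.wronskian_ne_zero (isLogDomain_slit le_rfl) (ofReal_mem_slit_ball hx)
  rwa [exp_mul_log_ofReal hx.1, ← Complex.ofReal_log hx.1.le] at this

theorem real_Z {N : ℝ} (b : FrobeniusBasis (N : ℂ) A B) {x : ℝ} (hx : x ∈ Ioo (0 : ℝ) 1) :
    b.Z x = b.K * ((x ^ N : ℝ) : ℂ) := by
  rw [b.Z_eq _ _ (isLogDomain_slit le_rfl) _ (ofReal_mem_slit_ball hx), exp_mul_log_ofReal hx.1]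

theorem exists_eq_combination {N : ℝ} (b : FrobeniusBasis (N : ℂ) A B) {r : ℝ} (hr : r ≤ 1)
    {F G : ℝ → ℂ} (h : RealEulerSys N A B (Ioo 0 r) F G fun _ => 0) :
    ∃ c₁ c₂ : ℂ, ∀ x ∈ Ioo 0 r,
      F x = c₁ * (b.h₁ x + Real.log x * (b.Z x * b.h₂ x)) + c₂ * (((x ^ N : ℝ) : ℂ) * b.h₂ x) ∧
      G x = c₁ * (b.k₁ x + Real.log x * (b.Z x * b.k₂ x)) + c₂ * (((x ^ N : ℝ) : ℂ) * b.k₂ x) :=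
  have hsub : Ioo 0 r ⊆ Ioo 0 1 := Ioo_subset_Ioo_right hr
  h.exists_eq_combination le_rfl hr (b.real₁.mono hsub) (b.real₂.mono hsub)
    (fun _ hx => b.real_wronskian (hsub hx))

end FrobeniusBasis

/-! ### Series of real powers with logarithmic polynomials -/

/-- The exponents grow at least linearly. -/
def LinearGrowth (E : ℕ → ℝ) : Prop := ∃ c : ℝ, 0 < c ∧ ∃ K : ℝ, ∀ n : ℕ, c * (n + 1) - K ≤ E n

/-- Coefficients of a series `∑_n y^{E n} ∑_{j ≤ M(n+1)} p_{n,j}(y) log(y)^j`. -/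
structure LogSeriesData (R : ℝ) (E : ℕ → ℝ) (M : ℕ) (C : ℝ) (p : ℕ → ℕ → ℂ → ℂ) : Prop where
  diff : ∀ n j, DifferentiableOn ℂ (p n j) (Metric.ball 0 R)
  supp : ∀ n j, M * (n + 1) < j → p n j = 0
  growth : LinearGrowth E ∨ ∃ n₀, ∀ n, n₀ ≤ n → ∀ j, p n j = 0
  one_le : 1 ≤ C
  bound : ∀ n j, ∀ z ∈ Metric.closedBall (0 : ℂ) (R / 2), ‖p n j z‖ ≤ C ^ (n + 1)

/-- A term of such a series. -/
noncomputable def logTerm (E : ℕ → ℝ) (M : ℕ) (p : ℕ → ℕ → ℂ → ℂ) (n : ℕ) (y : ℝ) : ℂ :=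
  ((y ^ E n : ℝ) : ℂ) * logSum (p n) (M * (n + 1)) (Real.log y) y

/-- `f` is given near `0` by a series of real powers with logarithmic polynomials. -/
def IsLogSeries (R : ℝ) (E : ℕ → ℝ) (f : ℝ → ℂ) : Prop :=
  ∃ (M : ℕ) (C : ℝ) (p : ℕ → ℕ → ℂ → ℂ), LogSeriesData R E M C p ∧
    ∀ᶠ y in 𝓝[>] (0 : ℝ), HasSum (fun n => logTerm E M p n y) (f y)

theorem sum_pow_le_one_add_pow {a : ℝ} (ha : 0 ≤ a) (J : ℕ) :
    ∑ j ∈ Finset.range (J + 1), a ^ j ≤ (1 + a) ^ J := by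
  induction J with
  | zero => simp
  | succ J ih =>
    rw [Finset.sum_range_succ]
    have : a ^ J ≤ (1 + a) ^ J := pow_le_pow_left₀ ha (by linarith) J
    calc _ ≤ (1 + a) ^ J + a ^ J * a := by rw [pow_succ a]; gcongr
      _ ≤ (1 + a) ^ J + (1 + a) ^ J * a := by gcongr
      _ = (1 + a) ^ (J + 1) := by ring

theorem norm_logSum_le {p : ℕ → ℂ → ℂ} {J : ℕ} {T : ℝ} {ℓ z : ℂ} (hp : ∀ j, ‖p j z‖ ≤ T) :
    ‖logSum p J ℓ z‖ ≤ T * (1 + ‖ℓ‖) ^ J := by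
  have hT : 0 ≤ T := (norm_nonneg _).trans (hp 0)
  refine (norm_sum_le _ _).trans ?_
  calc _ ≤ ∑ j ∈ Finset.range (J + 1), T * ‖ℓ‖ ^ j := Finset.sum_le_sum fun j _ => by
        rw [norm_mul, norm_pow]; gcongr; exact hp j
    _ ≤ _ := by
        rw [← Finset.mul_sum]
        exact mul_le_mul_of_nonneg_left (sum_pow_le_one_add_pow (norm_nonneg _) J) hT

theorem mem_closedBall_of_real {y ρ : ℝ} (h0 : 0 ≤ y) (h : y ≤ ρ) :
    (y : ℂ) ∈ Metric.closedBall (0 : ℂ) ρ := by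
  simpa [abs_of_nonneg h0] using h

/-- Degree `M(n+1)` and size `C^(n+1)` are normalised alike, so that apart from `y^(E n)` the bound
is a pure power with exponent `n + 1`. -/
theorem LogSeriesData.norm_logTerm_le {R : ℝ} {E : ℕ → ℝ} {M : ℕ} {C : ℝ} {p : ℕ → ℕ → ℂ → ℂ}
    (h : LogSeriesData R E M C p) (n : ℕ) {y : ℝ} (h0 : 0 < y) (hy : y ≤ R / 2) :
    ‖logTerm E M p n y‖ ≤ y ^ E n * (C * (1 + |Real.log y|) ^ M) ^ (n + 1) := by
  rw [logTerm, norm_mul, Complex.norm_real, Real.norm_of_nonneg (Real.rpow_nonneg h0.le _), mul_pow,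
    ← pow_mul]
  refine mul_le_mul_of_nonneg_left ?_ (Real.rpow_nonneg h0.le _)
  have := norm_logSum_le (J := M * (n + 1)) (ℓ := (Real.log y : ℂ))
    (fun j => h.bound n j y (mem_closedBall_of_real h0.le hy))
  simpa using this

/-- This is the ratio of the geometric majorant of a logarithmic series. Writing `y^c` as an
`(M+1)`-st power reduces the limit to that of `y^(c/(M+1)) log y`. -/
theorem tendsto_rpow_mul_one_add_abs_log {c : ℝ} (hc : 0 < c) (M : ℕ) (C : ℝ) :
    Tendsto (fun y : ℝ => y ^ c * (C * (1 + |Real.log y|) ^ M)) (𝓝[>] 0) (𝓝 0) := by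
  have hc' : 0 < c / (M + 1) := by positivity
  have h1 : Tendsto (fun y : ℝ => y ^ (c / (M + 1)) * (1 + |Real.log y|)) (𝓝[>] 0) (𝓝 0) := by
    have a1 := (tendsto_log_mul_rpow_nhdsGT_zero hc').abs
    have a2 : Tendsto (fun y : ℝ => y ^ (c / (M + 1))) (𝓝[>] 0) (𝓝 0) := by
      have := (Real.continuousAt_rpow_const 0 (c / (M + 1)) (Or.inr hc'.le)).tendsto
      rw [Real.zero_rpow hc'.ne'] at this
      exact this.mono_left nhdsWithin_le_nhds
    have := a2.add a1
    simp only [abs_zero, add_zero] at this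
    refine this.congr' ?_
    filter_upwards [self_mem_nhdsWithin] with y hy
    rw [abs_mul, abs_of_nonneg (Real.rpow_nonneg (le_of_lt hy) _)]
    ring
  have h2 := (h1.pow (M + 1)).const_mul |C|
  simp only [ne_eq, Nat.add_eq_zero_iff, one_ne_zero, and_false, not_false_eq_true, zero_pow,
    mul_zero] at h2
  refine squeeze_zero_norm' ?_ h2
  filter_upwards [self_mem_nhdsWithin] with y hy
  have hy0 : 0 < y := hy
  have h3 : y ^ c = (y ^ (c / (M + 1))) ^ (M + 1) := by
    rw [← Real.rpow_natCast, ← Real.rpow_mul hy0.le]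
    congr 1
    push_cast
    field_simp
  have h4 : (1 : ℝ) ≤ 1 + |Real.log y| := by linarith [abs_nonneg (Real.log y)]
  rw [norm_mul, norm_mul, Real.norm_of_nonneg (Real.rpow_nonneg hy0.le _), Real.norm_eq_abs C,
    Real.norm_of_nonneg (by positivity), h3, mul_pow]
  calc _ = |C| * ((y ^ (c / (M + 1))) ^ (M + 1) * (1 + |Real.log y|) ^ M) := by ring
    _ ≤ _ := by
      gcongr
      omega

/-- Linear growth gives a geometric majorant with ratio `1/2` near `0`. The interval stays away from
`0` because exponents may be negative, which leaves a factor like `y₀^(-|K|)`. -/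
theorem LogSeriesData.exists_summable_bound {R : ℝ} (hR : 0 < R) {E : ℕ → ℝ} {M : ℕ} {C : ℝ}
    {p : ℕ → ℕ → ℂ → ℂ} (h : LogSeriesData R E M C p) :
    ∀ᶠ ε in 𝓝[>] (0 : ℝ), ∀ y₀ ∈ Ioo 0 ε, ∃ u : ℕ → ℝ, Summable u ∧
      ∀ n, ∀ y ∈ Ioo y₀ ε, ‖logTerm E M p n y‖ ≤ u n := by
  have hev : ∀ᶠ ε in 𝓝[>] (0 : ℝ), ε ≤ R / 2 ∧ ε ≤ 1 := by
    have h1 : Iic (min (R / 2) 1) ∈ 𝓝[>] (0 : ℝ) :=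
      mem_nhdsWithin_of_mem_nhds (Iic_mem_nhds (lt_min (by linarith) one_pos))
    filter_upwards [h1] with ε hε using ⟨hε.trans (min_le_left _ _), hε.trans (min_le_right _ _)⟩
  rcases h.growth with ⟨c, hc, K, hE⟩ | ⟨n₀, hn₀⟩
  · have hlim := (tendsto_rpow_mul_one_add_abs_log hc M C).eventually_le_const
      (show (0 : ℝ) < 1 / 2 by norm_num)
    obtain ⟨δ, hδ, hδ'⟩ := mem_nhdsGT_iff_exists_Ioo_subset.1 hlim
    have hev2 : ∀ᶠ ε in 𝓝[>] (0 : ℝ), ε ≤ δ :=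
      mem_nhdsWithin_of_mem_nhds (Iic_mem_nhds hδ)
    filter_upwards [hev, hev2] with ε hε hεδ y₀ hy₀
    refine ⟨fun n => y₀ ^ (-|K|) * (1 / 2) ^ (n + 1), ?_, fun n y hy => ?_⟩
    · refine Summable.mul_left _ ?_
      exact (summable_nat_add_iff 1).2 (summable_geometric_of_lt_one (by norm_num) (by norm_num))
    · have hy0 : 0 < y := hy₀.1.trans hy.1
      have hy1 : y ≤ 1 := hy.2.le.trans hε.2
      refine (h.norm_logTerm_le n hy0 (hy.2.le.trans hε.1)).trans ?_
      have a1 : y ^ E n ≤ y₀ ^ (-|K|) * (y ^ c) ^ (n + 1) := by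
        calc y ^ E n ≤ y ^ (-|K| + c * ((n + 1 : ℕ) : ℝ)) := by
              refine Real.rpow_le_rpow_of_exponent_ge hy0 hy1 ?_
              have := hE n
              push_cast
              linarith [le_abs_self K]
          _ = y ^ (-|K|) * (y ^ c) ^ (n + 1) := by
              rw [Real.rpow_add hy0, Real.rpow_mul hy0.le, Real.rpow_natCast]
          _ ≤ _ := by
              refine mul_le_mul_of_nonneg_right ?_ (by positivity)
              exact Real.rpow_le_rpow_of_nonpos hy₀.1 hy.1.le (by simp)
      have hC := h.one_le
      calc _ ≤ (y₀ ^ (-|K|) * (y ^ c) ^ (n + 1)) * (C * (1 + |Real.log y|) ^ M) ^ (n + 1) :=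
            mul_le_mul_of_nonneg_right a1 (by positivity)
        _ = y₀ ^ (-|K|) * (y ^ c * (C * (1 + |Real.log y|) ^ M)) ^ (n + 1) := by
            rw [mul_pow (y ^ c)]; ring
        _ ≤ _ := by
            refine mul_le_mul_of_nonneg_left ?_ (Real.rpow_nonneg hy₀.1.le _)
            refine pow_le_pow_left₀ (by positivity) (hδ' ⟨hy0, hy.2.trans_le hεδ⟩) _
  · filter_upwards [hev] with ε hε y₀ hy₀
    refine ⟨fun n => if n < n₀ then y₀ ^ (-|E n|) * (C * (1 + |Real.log y₀|) ^ M) ^ (n + 1) else 0,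
      ?_, fun n y hy => ?_⟩
    · refine summable_of_ne_finset_zero (s := Finset.range n₀) fun n hn => ?_
      rw [if_neg (by simpa using hn)]
    · have hy0 : 0 < y := hy₀.1.trans hy.1
      have hy1 : y ≤ 1 := hy.2.le.trans hε.2
      by_cases hn : n < n₀
      · simp only [hn, if_true]
        refine (h.norm_logTerm_le n hy0 (hy.2.le.trans hε.1)).trans ?_
        have hC := h.one_le
        have a1 : y ^ E n ≤ y₀ ^ (-|E n|) :=
          (Real.rpow_le_rpow_of_exponent_ge hy0 hy1 (neg_abs_le _)).trans
            (Real.rpow_le_rpow_of_nonpos hy₀.1 hy.1.le (by simp))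
        have a2 : |Real.log y| ≤ |Real.log y₀| := by
          rw [abs_of_nonpos (Real.log_nonpos hy0.le hy1),
            abs_of_nonpos (Real.log_nonpos hy₀.1.le (hy.1.le.trans hy1))]
          exact neg_le_neg (Real.log_le_log hy₀.1 hy.1.le)
        gcongr
        exact Real.rpow_nonneg hy₀.1.le _
      · have : logTerm E M p n y = 0 := by
          simp [logTerm, logSum, hn₀ n (not_lt.1 hn)]
        simp [this, hn]

theorem LogSeriesData.eventually_summable {R : ℝ} (hR : 0 < R) {E : ℕ → ℝ} {M : ℕ} {C : ℝ}
    {p : ℕ → ℕ → ℂ → ℂ} (h : LogSeriesData R E M C p) :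
    ∀ᶠ y in 𝓝[>] (0 : ℝ), Summable fun n => logTerm E M p n y := by
  obtain ⟨ε, hε, hε0⟩ := ((h.exists_summable_bound hR).and self_mem_nhdsWithin).exists
  filter_upwards [Ioo_mem_nhdsGT hε0] with y hy
  obtain ⟨u, hu, hb⟩ := hε (y / 2) ⟨by linarith [hy.1], by linarith [hy.1, hy.2]⟩
  exact Summable.of_norm_bounded hu fun n => hb n y ⟨by linarith [hy.1], hy.2⟩

/-- Bounds for all but finitely many terms suffice. -/
theorem exists_logSeriesData {R : ℝ} (hR : 0 < R) {E : ℕ → ℝ} {M : ℕ} {p : ℕ → ℕ → ℂ → ℂ}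
    (hd : ∀ n j, DifferentiableOn ℂ (p n j) (Metric.ball 0 R))
    (hs : ∀ n j, M * (n + 1) < j → p n j = 0)
    (hg : LinearGrowth E ∨ ∃ n₀, ∀ n, n₀ ≤ n → ∀ j, p n j = 0)
    (hb : ∃ (n₀ : ℕ) (C : ℝ), ∀ n, n₀ ≤ n → ∀ j, ∀ z ∈ Metric.closedBall (0 : ℂ) (R / 2),
      ‖p n j z‖ ≤ C ^ (n + 1)) : ∃ C, LogSeriesData R E M C p := by
  obtain ⟨n₀, C, hC⟩ := hb
  have h1 : ∀ n j, ∃ c, ∀ z ∈ Metric.closedBall (0 : ℂ) (R / 2), ‖p n j z‖ ≤ c := fun n j =>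
    exists_norm_le_of_differentiableOn (by linarith) (hd n j)
  choose c hc using h1
  set D : ℝ := 1 + |C| + ∑ n ∈ Finset.range n₀, ∑ j ∈ Finset.range (M * (n + 1) + 1), |c n j|
    with hD
  have hsum : 0 ≤ ∑ n ∈ Finset.range n₀, ∑ j ∈ Finset.range (M * (n + 1) + 1), |c n j| :=
    Finset.sum_nonneg fun n _ => Finset.sum_nonneg fun j _ => abs_nonneg _
  have hD1 : 1 ≤ D := by linarith [abs_nonneg C]
  refine ⟨D, hd, hs, hg, hD1, fun n j z hz => ?_⟩
  rcases le_or_gt n₀ n with hn | hn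
  · refine (hC n hn j z hz).trans ((le_abs_self _).trans ?_)
    rw [abs_pow]
    exact pow_le_pow_left₀ (abs_nonneg _) (by linarith) _
  · by_cases hj : M * (n + 1) < j
    · rw [hs n j hj]; simpa using (zero_le_one.trans (one_le_pow₀ hD1))
    · refine (hc n j z hz).trans ((le_abs_self _).trans ?_)
      have a1 : |c n j| ≤ D := by
        have b1 := Finset.single_le_sum (f := fun j => |c n j|) (fun j _ => abs_nonneg _)
          (Finset.mem_range.2 (show j < M * (n + 1) + 1 by omega))
        have b2 := Finset.single_le_sum
          (f := fun n => ∑ j ∈ Finset.range (M * (n + 1) + 1), |c n j|)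
          (fun n _ => Finset.sum_nonneg fun j _ => abs_nonneg _) (Finset.mem_range.2 hn)
        have hc0 := abs_nonneg C
        linarith
      exact a1.trans (le_self_pow₀ hD1 (by omega))

namespace IsLogSeries

variable {R : ℝ} {E E' : ℕ → ℝ} {f g : ℝ → ℂ}

theorem congr (hf : IsLogSeries R E f) (h : ∀ᶠ y in 𝓝[>] (0 : ℝ), g y = f y) :
    IsLogSeries R E g := by
  obtain ⟨M, C, p, hp, hs⟩ := hf
  refine ⟨M, C, p, hp, ?_⟩
  filter_upwards [hs, h] with y h1 h2
  rwa [h2]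

theorem add (hf : IsLogSeries R E f) (hg : IsLogSeries R E g) :
    IsLogSeries R E fun y => f y + g y := by
  obtain ⟨M, C, p, hp, hs⟩ := hf
  obtain ⟨M', C', p', hp', hs'⟩ := hg
  have hM : ∀ n, M * (n + 1) ≤ (max M M') * (n + 1) := fun n =>
    Nat.mul_le_mul_right _ (le_max_left _ _)
  have hM' : ∀ n, M' * (n + 1) ≤ (max M M') * (n + 1) := fun n =>
    Nat.mul_le_mul_right _ (le_max_right _ _)
  refine ⟨max M M', C + C', fun n j z => p n j z + p' n j z,
    ⟨fun n j => (hp.diff n j).fun_add (hp'.diff n j), fun n j hj => ?_, ?_, ?_, ?_⟩, ?_⟩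
  · funext z
    simp [hp.supp n j ((hM n).trans_lt hj), hp'.supp n j ((hM' n).trans_lt hj)]
  · rcases hp.growth with h | ⟨n₀, h⟩
    · exact Or.inl h
    · rcases hp'.growth with h' | ⟨n₁, h'⟩
      · exact Or.inl h'
      · refine Or.inr ⟨max n₀ n₁, fun n hn j => ?_⟩
        funext z
        simp [h n ((le_max_left _ _).trans hn) j, h' n ((le_max_right _ _).trans hn) j]
  · linarith [hp.one_le, hp'.one_le]
  · intro n j z hz
    refine (norm_add_le _ _).trans ((add_le_add (hp.bound n j z hz) (hp'.bound n j z hz)).trans ?_)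
    exact pow_add_pow_le (by linarith [hp.one_le]) (by linarith [hp'.one_le]) (by omega)
  · filter_upwards [hs, hs'] with y h1 h2
    refine (h1.add h2).congr_fun fun n => ?_
    simp only [logTerm]
    rw [logSum_add, logSum_of_le (hM n) (hp.supp n), logSum_of_le (hM' n) (hp'.supp n), mul_add]

theorem mul_analytic (hR : 0 < R) (hf : IsLogSeries R E f) {a : ℂ → ℂ}
    (ha : DifferentiableOn ℂ a (Metric.ball 0 R)) :
    IsLogSeries R E fun y => a y * f y := by
  obtain ⟨M, C, p, hp, hs⟩ := hf
  obtain ⟨c, hc⟩ := exists_norm_le_of_differentiableOn (show R / 2 < R by linarith) ha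
  have hC := hp.one_le
  refine ⟨M, (1 + |c|) * C, fun n j z => a z * p n j z,
    ⟨fun n j => ha.fun_mul (hp.diff n j), fun n j hj => ?_, ?_, ?_, ?_⟩, ?_⟩
  · funext z; simp [hp.supp n j hj]
  · refine hp.growth.imp_right fun ⟨n₀, h⟩ => ⟨n₀, fun n hn j => ?_⟩
    funext z; simp [h n hn j]
  · nlinarith [abs_nonneg c]
  · intro n j z hz
    rw [norm_mul, mul_pow]
    have : ‖a z‖ ≤ (1 + |c|) ^ (n + 1) := by
      refine ((hc z hz).trans (le_abs_self c)).trans ?_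
      exact (by linarith : |c| ≤ 1 + |c|).trans
        (le_self_pow₀ (by linarith [abs_nonneg c]) (by omega))
    exact mul_le_mul this (hp.bound n j z hz) (norm_nonneg _) (by positivity)
  · filter_upwards [hs] with y h1
    refine (h1.mul_left (a y)).congr_fun fun n => ?_
    simp only [logTerm]
    rw [logSum_mul]; ring

theorem const_mul (hR : 0 < R) (hf : IsLogSeries R E f) (c : ℂ) :
    IsLogSeries R E fun y => c * f y :=
  hf.mul_analytic hR (a := fun _ => c) (differentiableOn_const c)

theorem mul_rpow (hf : IsLogSeries R E f) (m : ℝ) :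
    IsLogSeries R (fun n => E n + m) fun y => ((y ^ m : ℝ) : ℂ) * f y := by
  obtain ⟨M, C, p, hp, hs⟩ := hf
  refine ⟨M, C, p, ⟨hp.diff, hp.supp, ?_, hp.one_le, hp.bound⟩, ?_⟩
  · refine hp.growth.imp_left fun ⟨c, hc, K, h⟩ => ⟨c, hc, K - m, fun n => ?_⟩
    linarith [h n]
  · filter_upwards [hs, self_mem_nhdsWithin] with y h1 hy
    refine (h1.mul_left ((y ^ m : ℝ) : ℂ)).congr_fun fun n => ?_
    simp only [logTerm]
    rw [Real.rpow_add hy]; push_cast; ring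

/-- A single term. -/
theorem single (hR : 0 < R) (k : ℕ) {a c : ℂ → ℂ} (ha : DifferentiableOn ℂ a (Metric.ball 0 R))
    (hc : DifferentiableOn ℂ c (Metric.ball 0 R)) :
    IsLogSeries R E fun y => ((y ^ E k : ℝ) : ℂ) * (a y + Real.log y * c y) := by
  set p : ℕ → ℕ → ℂ → ℂ := fun n j => if n = k then (if j = 0 then a else if j = 1 then c else 0)
    else 0 with hp
  obtain ⟨C, hC⟩ := exists_logSeriesData hR (E := E) (M := 1) (p := p) (fun n j => by
      simp only [hp]
      split_ifs
      exacts [ha, hc, differentiableOn_const 0, differentiableOn_const 0])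
    (fun n j hj => by
      simp only [hp]
      have h1 : j ≠ 0 := by omega
      have h2 : j ≠ 1 := by omega
      simp [h1, h2])
    (Or.inr ⟨k + 1, fun n hn j => by simp [hp, show n ≠ k by omega]⟩)
    ⟨k + 1, 0, fun n hn j z hz => by simp [hp, show n ≠ k by omega]⟩
  refine ⟨1, C, p, hC, Eventually.of_forall fun y => ?_⟩
  have : logTerm E 1 p k y = ((y ^ E k : ℝ) : ℂ) * (a y + Real.log y * c y) := by
    rw [logTerm, logSum_of_le (J := 1) (by omega) (fun j hj => by
      simp [hp, show j ≠ 0 by omega, show j ≠ 1 by omega])]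
    simp [logSum, hp, Finset.sum_range_succ]
    ring_nf
    simp
  simp only [← this]
  refine hasSum_single k fun n hn => ?_
  simp [logTerm, logSum, hp, hn]

/-- Passage to a larger list of exponents. -/
theorem reindex (hf : IsLogSeries R E f) {ι : ℕ → ℕ} (hι : Function.Injective ι)
    (hle : ∀ n, n ≤ ι n) (hE : ∀ n, E' (ι n) = E n) (hg : LinearGrowth E → LinearGrowth E') :
    IsLogSeries R E' f := by
  classical
  obtain ⟨M, C, p, hp, hs⟩ := hf
  have hC := hp.one_le
  set p' : ℕ → ℕ → ℂ → ℂ := Function.extend ι p 0 with hp'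
  have h1 : ∀ n, p' (ι n) = p n := fun n => hι.extend_apply _ _ _
  have h2 : ∀ m, m ∉ range ι → p' m = 0 := fun m hm => Function.extend_apply' _ _ _ (by simpa using hm)
  have key : ∀ (P : ℕ → (ℕ → ℂ → ℂ) → Prop), (∀ m, P m 0) → (∀ n, P (ι n) (p n)) →
      ∀ m, P m (p' m) := by
    intro P h0 hn m
    by_cases hm : m ∈ range ι
    · obtain ⟨n, rfl⟩ := hm
      rw [h1]; exact hn n
    · rw [h2 m hm]; exact h0 m
  refine ⟨M, C, p', ⟨?_, ?_, ?_, hC, ?_⟩, ?_⟩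
  · exact key (fun _ q => ∀ j, DifferentiableOn ℂ (q j) (Metric.ball 0 R))
      (fun m j => differentiableOn_const 0) hp.diff
  -- Degree and size bounds are indexed by position; they persist because `n ≤ ι n` means that terms
  -- only move to later positions.
  · exact key (fun m q => ∀ j, M * (m + 1) < j → q j = 0) (fun m j _ => rfl) fun n j hj =>
      hp.supp n j ((Nat.mul_le_mul_left M (by simpa using hle n)).trans_lt hj)
  · refine hp.growth.imp hg fun ⟨n₀, h⟩ => ?_
    refine ⟨(Finset.range n₀).sup ι + 1, key (fun m q => (Finset.range n₀).sup ι + 1 ≤ m →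
      ∀ j, q j = 0) (fun m _ j => rfl) fun n hn j => h n ?_ j⟩
    by_contra hlt
    have := Finset.le_sup (f := ι) (Finset.mem_range.2 (not_le.1 hlt))
    omega
  · exact key (fun m q => ∀ j, ∀ z ∈ Metric.closedBall (0 : ℂ) (R / 2), ‖q j z‖ ≤ C ^ (m + 1))
      (fun m j z _ => by simp; positivity) fun n j z hz => (hp.bound n j z hz).trans
        (pow_le_pow_right₀ hC (by simpa using hle n))
  · filter_upwards [hs] with y hy
    rw [← hι.hasSum_iff]
    · refine hy.congr_fun fun n => ?_
      simp only [logTerm, Function.comp, h1, hE]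
      rw [logSum_of_le (Nat.mul_le_mul_left M (by simpa using hle n)) (hp.supp n)]
    · intro m hm
      simp [logTerm, logSum, h2 m hm]

end IsLogSeries

/-! ### Solutions with a series source -/

/-- Termwise differentiation is justified by the equation itself: away from `0` and `1` it bounds
the derivatives by `F`, `G` and `S`. Passing to `ε' < ε ≤ 1` keeps `1 - y` bounded below. -/
theorem RealEulerSys.tsum {N A B : ℂ} {y₀ ε : ℝ} (hε : ε ≤ 1) (h0 : 0 < y₀)
    {F G S : ℕ → ℝ → ℂ} (h : ∀ n, RealEulerSys N A B (Ioo y₀ ε) (F n) (G n) (S n))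
    {u : ℕ → ℝ} (hu : Summable u)
    (hF : ∀ n, ∀ y ∈ Ioo y₀ ε, ‖F n y‖ ≤ u n) (hG : ∀ n, ∀ y ∈ Ioo y₀ ε, ‖G n y‖ ≤ u n)
    (hS : ∀ n, ∀ y ∈ Ioo y₀ ε, ‖S n y‖ ≤ u n) {ε' : ℝ} (hε' : ε' < ε) :
    RealEulerSys N A B (Ioo y₀ ε') (fun y => ∑' n, F n y) (fun y => ∑' n, G n y)
      (fun y => ∑' n, S n y) := by
  have hsub : Ioo y₀ ε' ⊆ Ioo y₀ ε := Ioo_subset_Ioo_right hε'.le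
  have sF : ∀ y ∈ Ioo y₀ ε, Summable fun n => F n y := fun y hy =>
    Summable.of_norm_bounded hu fun n => hF n y hy
  have sG : ∀ y ∈ Ioo y₀ ε, Summable fun n => G n y := fun y hy =>
    Summable.of_norm_bounded hu fun n => hG n y hy
  have sS : ∀ y ∈ Ioo y₀ ε, Summable fun n => S n y := fun y hy =>
    Summable.of_norm_bounded hu fun n => hS n y hy
  have hy1 : ∀ y ∈ Ioo y₀ ε', 0 < 1 - y := fun y hy => by linarith [hy.2]
  have hpos : ∀ y ∈ Ioo y₀ ε', y₀ * (1 - ε') ≤ y * (1 - y) ∧ 0 < y₀ * (1 - ε') := fun y hy => by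
    have h1 : 0 < 1 - ε' := by linarith
    exact ⟨mul_le_mul hy.1.le (by linarith [hy.2]) h1.le (h0.trans hy.1).le, by positivity⟩
  have hnorm : ∀ y ∈ Ioo y₀ ε', ‖(y : ℂ)‖ ≤ 1 := fun y hy => by
    rw [Complex.norm_real, Real.norm_of_nonneg (h0.trans hy.1).le]; linarith [hy1 y hy]
  refine ⟨fun y hy => ?_, fun y hy => ?_⟩
  · have := hasDerivAt_tsum_of_isPreconnected (u := fun n => u n / y₀) (hu.div_const y₀) isOpen_Ioo
      isPreconnected_Ioo (fun n y hy => (h n).1 y (hsub hy)) (fun n y hy => by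
        rw [norm_div, Complex.norm_real, Real.norm_of_nonneg (h0.trans hy.1).le]
        exact div_le_div₀ ((norm_nonneg _).trans (hG n y (hsub hy))) (hG n y (hsub hy)) h0 hy.1.le)
      hy (sF y (hsub hy)) hy
    rwa [tsum_div_const] at this
  · set c : ℝ := ‖N‖ + ‖A + B‖ + ‖A * B‖ + 1 with hc
    have := hasDerivAt_tsum_of_isPreconnected (u := fun n => c * u n / (y₀ * (1 - ε')))
      ((hu.mul_left c).div_const _) isOpen_Ioo
      isPreconnected_Ioo (fun n y hy => (h n).2 y (hsub hy)) (fun n y hy => by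
        have hun : 0 ≤ u n := (norm_nonneg _).trans (hG n y (hsub hy))
        have e1 : ‖(y : ℂ) * (1 - y)‖ = y * (1 - y) := by
          have : (y : ℂ) * (1 - y) = ((y * (1 - y) : ℝ) : ℂ) := by push_cast; ring
          rw [this, Complex.norm_real,
            Real.norm_of_nonneg (mul_nonneg (h0.trans hy.1).le (hy1 y hy).le)]
        rw [norm_div, e1]
        refine div_le_div₀ (by positivity) ?_ (hpos y hy).2 (hpos y hy).1
        have a1 : ‖(N + y * (A + B)) * G n y‖ ≤ (‖N‖ + ‖A + B‖) * u n := by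
          rw [norm_mul]
          refine mul_le_mul ((norm_add_le _ _).trans ?_) (hG n y (hsub hy)) (norm_nonneg _)
            (by positivity)
          rw [norm_mul]
          have := mul_le_of_le_one_left (norm_nonneg (A + B)) (hnorm y hy)
          linarith
        have a2 : ‖y * A * B * F n y‖ ≤ ‖A * B‖ * u n := by
          rw [norm_mul, mul_assoc (y : ℂ), norm_mul]
          exact mul_le_mul (mul_le_of_le_one_left (norm_nonneg _) (hnorm y hy)) (hF n y (hsub hy))
            (norm_nonneg _) (norm_nonneg _)
        have a3 := hS n y (hsub hy)
        refine (norm_add_le _ _).trans ((add_le_add_left (norm_add_le _ _) _).trans ?_)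
        rw [hc]; linarith)
      hy (sG y (hsub hy)) hy
    rw [tsum_div_const] at this
    have e := (((sG y (hsub hy)).mul_left (N + y * (A + B))).tsum_add
      ((sF y (hsub hy)).mul_left (y * A * B)))
    have e' := (((sG y (hsub hy)).mul_left (N + y * (A + B))).add
      ((sF y (hsub hy)).mul_left (y * A * B))).tsum_add (sS y (hsub hy))
    rw [e', e, tsum_mul_left, tsum_mul_left] at this
    exact this

/-- The terms are solved separately. For linearly growing exponents, `M(n+1) + 1` is at most a fixed
multiple of `E n - N` once `n` is large, so the loss `(1+Θ)^(M(n+1)+1)` is geometric; finitely many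
early terms need no uniform bound. -/
theorem IsLogSeries.exists_solution {A B : ℂ} {N : ℝ} (hN : 0 ≤ N)
    (b : FrobeniusBasis (N : ℂ) A B) {R : ℝ} (hR0 : 0 < R) (hR : R ≤ 1) {E : ℕ → ℝ} {S : ℝ → ℂ}
    (hS : IsLogSeries R E S) : ∃ (F G : ℝ → ℂ) (ε : ℝ), 0 < ε ∧ ε ≤ 1 ∧ IsLogSeries R E F ∧
      IsLogSeries R E G ∧ RealEulerSys N A B (Ioo 0 ε) F G S := by
  classical
  obtain ⟨M, C, p, hp, hs⟩ := hS
  have hC := hp.one_le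
  obtain ⟨C₀, hC₀, hsol⟩ := b.exists_solution_logSum hN hR (show R / 2 < R by linarith)
  have hex : ∀ n, ∃ P Q : ℕ → ℂ → ℂ, (∀ j, DifferentiableOn ℂ (P j) (Metric.ball 0 R)) ∧
        (∀ j, DifferentiableOn ℂ (Q j) (Metric.ball 0 R)) ∧
        (∀ j, (M + 2) * (n + 1) < j → P j = 0) ∧ (∀ j, (M + 2) * (n + 1) < j → Q j = 0) ∧
        ((∀ j, p n j = 0) → ∀ j, P j = 0 ∧ Q j = 0) ∧
        RealEulerSys N A B (Ioo 0 R)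
          (fun y => ((y ^ E n : ℝ) : ℂ) * logSum P ((M + 2) * (n + 1)) (Real.log y) y)
          (fun y => ((y ^ E n : ℝ) : ℂ) * logSum Q ((M + 2) * (n + 1)) (Real.log y) y)
          (fun y => ((y ^ E n : ℝ) : ℂ) * logSum (p n) (M * (n + 1)) (Real.log y) y) ∧
        ∀ Θ : ℝ, 1 ≤ E n - N → 0 ≤ Θ → (((M * (n + 1) : ℕ) : ℝ)) + 1 ≤ Θ * (E n - N) →
          ∀ j, ∀ z ∈ Metric.closedBall (0 : ℂ) (R / 2),
            ‖P j z‖ ≤ C₀ * (C ^ (n + 1) * (1 + Θ) ^ (M * (n + 1) + 1)) ∧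
            ‖Q j z‖ ≤ C₀ * (C ^ (n + 1) * (1 + Θ) ^ (M * (n + 1) + 1)) := by
    intro n
    have hMn : M * (n + 1) + 2 ≤ (M + 2) * (n + 1) := by nlinarith
    -- Zero terms receive the zero solution, so a finite series remains finite even when its
    -- exponents do not grow.
    by_cases hz : ∀ j, p n j = 0
    · refine ⟨0, 0, fun j => differentiableOn_const 0, fun j => differentiableOn_const 0,
        fun _ _ => rfl, fun _ _ => rfl, fun _ _ => ⟨rfl, rfl⟩, ?_, fun Θ _ hΘ _ j z _ => ?_⟩
      · simp only [logSum, hz, Pi.zero_apply, zero_mul, Finset.sum_const_zero, mul_zero]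
        refine ⟨fun x _ => ?_, fun x _ => ?_⟩ <;>
        simpa using hasDerivAt_const (x := x) (c := (0 : ℂ))
      · simp only [Pi.zero_apply, norm_zero, and_self]
        positivity
    · obtain ⟨P, Q, dP, dQ, sP, sQ, hsys, hb⟩ := hsol (E n) (M * (n + 1)) (p n) (hp.diff n)
        (hp.supp n)
      refine ⟨P, Q, dP, dQ, fun j hj => sP j (by omega), fun j hj => sQ j (by omega),
        fun h => (hz h).elim, ?_, fun Θ h1 hΘ h2 => hb Θ _ h1 hΘ h2 (by positivity) (hp.bound n)⟩
      refine ((hsys _ _ (isLogDomain_slit hR) inter_subset_right).restrict_slit hR).congr isOpen_Ioo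
        (fun y hy => ?_) (fun y hy => ?_) (fun y hy => ?_)
      · simp only [exp_mul_log_ofReal hy.1, Complex.ofReal_log hy.1.le]
        rw [logSum_of_le hMn sP]
      · simp only [exp_mul_log_ofReal hy.1, Complex.ofReal_log hy.1.le]
        rw [logSum_of_le hMn sQ]
      · simp only [exp_mul_log_ofReal hy.1, Complex.ofReal_log hy.1.le]
  choose P Q dP dQ sP sQ hPQ0 hsys hb using hex
  have hgr : LinearGrowth E ∨ ∃ n₀, ∀ n, n₀ ≤ n → ∀ j, P n j = 0 ∧ Q n j = 0 :=
    hp.growth.imp_right fun ⟨n₀, h⟩ => ⟨n₀, fun n hn => hPQ0 n (h n hn)⟩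
  have hbd : ∃ (n₀ : ℕ) (D : ℝ), ∀ n, n₀ ≤ n → ∀ j, ∀ z ∈ Metric.closedBall (0 : ℂ) (R / 2),
      ‖P n j z‖ ≤ D ^ (n + 1) ∧ ‖Q n j z‖ ≤ D ^ (n + 1) := by
    rcases hgr with ⟨c, hc, K, hE⟩ | ⟨n₀, h⟩
    -- Chosen from `M(n+1) + 1 ≤ (M+1)(n+1)` and `E n - N ≥ (c/2)(n+1)`. The latter holds from the
    -- `n₀` below on, where also `(c/2)(n+1) ≥ 1`, which excludes resonances.
    · set Θ : ℝ := (M + 1) * (2 / c) with hΘ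
      have hΘ0 : 0 ≤ Θ := by positivity
      obtain ⟨n₀, hn₀⟩ := exists_nat_ge (max (2 * (K + N) / c) (2 / c))
      refine ⟨n₀, (1 + C₀) * (C * (1 + Θ) ^ (M + 1)), fun n hn j z hz => ?_⟩
      have hn' : (n₀ : ℝ) ≤ n := by exact_mod_cast hn
      have a1 : 2 * (K + N) ≤ (n + 1) * c := by
        have := (div_le_iff₀ hc).1 ((le_max_left _ _).trans hn₀)
        nlinarith
      have a2 : 2 ≤ (n + 1) * c := by
        have := (div_le_iff₀ hc).1 ((le_max_right _ _).trans hn₀)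
        nlinarith
      have a3 : c / 2 * (n + 1) ≤ E n - N := by linarith [hE n]
      have hbn := hb n Θ (by linarith) hΘ0 (by
        calc ((M * (n + 1) : ℕ) : ℝ) + 1 ≤ (M + 1) * (n + 1) := by
              push_cast
              have : (0 : ℝ) ≤ n := n.cast_nonneg
              linarith
          _ = Θ * (c / 2 * (n + 1)) := by rw [hΘ]; field_simp
          _ ≤ _ := mul_le_mul_of_nonneg_left a3 hΘ0) j z hz
      have fin : C₀ * (C ^ (n + 1) * (1 + Θ) ^ (M * (n + 1) + 1))
          ≤ ((1 + C₀) * (C * (1 + Θ) ^ (M + 1))) ^ (n + 1) := by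
        rw [mul_pow, mul_pow, ← pow_mul]
        have b1 : C₀ ≤ (1 + C₀) ^ (n + 1) :=
          (by linarith : C₀ ≤ 1 + C₀).trans (le_self_pow₀ (by linarith) (by omega))
        have b2 : (1 + Θ) ^ (M * (n + 1) + 1) ≤ (1 + Θ) ^ ((M + 1) * (n + 1)) :=
          pow_le_pow_right₀ (by linarith) (by nlinarith)
        gcongr
      exact ⟨hbn.1.trans fin, hbn.2.trans fin⟩
    · exact ⟨n₀, 0, fun n hn j z _ => by simp [(h n hn j).1, (h n hn j).2]⟩
  obtain ⟨n₀, D, hD⟩ := hbd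
  obtain ⟨C₁, LP⟩ := exists_logSeriesData hR0 dP sP
    (hgr.imp_right fun ⟨n₀, h⟩ => ⟨n₀, fun n hn j => (h n hn j).1⟩)
    ⟨n₀, D, fun n hn j z hz => (hD n hn j z hz).1⟩
  obtain ⟨C₂, LQ⟩ := exists_logSeriesData hR0 dQ sQ
    (hgr.imp_right fun ⟨n₀, h⟩ => ⟨n₀, fun n hn j => (h n hn j).2⟩)
    ⟨n₀, D, fun n hn j z hz => (hD n hn j z hz).2⟩
  have hR' : Iic (min R 1) ∈ 𝓝[>] (0 : ℝ) :=
    mem_nhdsWithin_of_mem_nhds (Iic_mem_nhds (lt_min hR0 one_pos))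
  obtain ⟨δ, hδ0, hδ⟩ := mem_nhdsGT_iff_exists_Ioo_subset.1 hs
  have hδ' : Iic δ ∈ 𝓝[>] (0 : ℝ) := mem_nhdsWithin_of_mem_nhds (Iic_mem_nhds hδ0)
  obtain ⟨ε, hεP, hεQ, hεp, hεR, hεδ, hε0⟩ := ((LP.exists_summable_bound hR0).and
    ((LQ.exists_summable_bound hR0).and ((hp.exists_summable_bound hR0).and
      (Filter.Eventually.and hR' (Filter.Eventually.and hδ' self_mem_nhdsWithin))))).exists
  have hε0 : 0 < ε := hε0
  have hεR' : ε ≤ R := hεR.trans (min_le_left _ _)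
  have hε1 : ε ≤ 1 := hεR.trans (min_le_right _ _)
  have hloc : ∀ y₀ ∈ Ioo 0 ε, ∀ ε' < ε, RealEulerSys N A B (Ioo y₀ ε')
      (fun y => ∑' n, logTerm E (M + 2) P n y) (fun y => ∑' n, logTerm E (M + 2) Q n y)
      (fun y => ∑' n, logTerm E M p n y) := by
    intro y₀ hy₀ ε' hε'
    obtain ⟨u₁, hu₁, hb₁⟩ := hεP y₀ hy₀
    obtain ⟨u₂, hu₂, hb₂⟩ := hεQ y₀ hy₀
    obtain ⟨u₃, hu₃, hb₃⟩ := hεp y₀ hy₀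
    have hsub : Ioo y₀ ε ⊆ Ioo 0 R := Ioo_subset_Ioo hy₀.1.le hεR'
    refine RealEulerSys.tsum (u := fun n => |u₁ n| + |u₂ n| + |u₃ n|) hε1 hy₀.1
      (fun n => (hsys n).mono hsub) ((hu₁.abs.add hu₂.abs).add hu₃.abs)
      (fun n y hy => ?_) (fun n y hy => ?_) (fun n y hy => ?_) hε'
    · exact (hb₁ n y hy).trans (by
        linarith [le_abs_self (u₁ n), abs_nonneg (u₂ n), abs_nonneg (u₃ n)])
    · exact (hb₂ n y hy).trans (by
        linarith [le_abs_self (u₂ n), abs_nonneg (u₁ n), abs_nonneg (u₃ n)])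
    · exact (hb₃ n y hy).trans (by
        linarith [le_abs_self (u₃ n), abs_nonneg (u₁ n), abs_nonneg (u₂ n)])
  refine ⟨fun y => ∑' n, logTerm E (M + 2) P n y, fun y => ∑' n, logTerm E (M + 2) Q n y, ε, hε0,
    hε1, ⟨M + 2, C₁, P, LP, ?_⟩, ⟨M + 2, C₂, Q, LQ, ?_⟩, ?_⟩
  · filter_upwards [LP.eventually_summable hR0] with y hy using hy.hasSum
  · filter_upwards [LQ.eventually_summable hR0] with y hy using hy.hasSum
  · have hS' : ∀ y ∈ Ioo 0 ε, S y = ∑' n, logTerm E M p n y := fun y hy =>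
      (hδ ⟨hy.1, hy.2.trans_le hεδ⟩ : HasSum _ _).tsum_eq.symm
    have hmem : ∀ y ∈ Ioo 0 ε, y ∈ Ioo (y / 2) ((y + ε) / 2) ∧ y / 2 ∈ Ioo 0 ε ∧ (y + ε) / 2 < ε :=
      fun y hy => ⟨⟨by linarith [hy.1], by linarith [hy.2]⟩,
        ⟨by linarith [hy.1], by linarith [hy.1, hy.2]⟩, by linarith [hy.2]⟩
    refine ⟨fun y hy => ?_, fun y hy => ?_⟩
    · obtain ⟨h1, h2, h3⟩ := hmem y hy
      exact (hloc _ h2 _ h3).1 y h1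
    · obtain ⟨h1, h2, h3⟩ := hmem y hy
      have := (hloc _ h2 _ h3).2 y h1
      rwa [← hS' y hy] at this

/-! ### Profiles -/

/-- `f` has a holomorphic extension from `(0,1)` to `U`. -/
def HasHolExtension (U : Set ℂ) (f : ℝ → ℂ) : Prop :=
  ∃ g : ℂ → ℂ, DifferentiableOn ℂ g U ∧ ∀ x ∈ Ioo (0 : ℝ) 1, g x = f x

/-- Near `0`, `f` is `x^m` times a logarithmic polynomial. -/
def IsLogPolyAtZero (R m : ℝ) (f : ℝ → ℂ) : Prop :=
  ∃ (J : ℕ) (p : ℕ → ℂ → ℂ), (∀ j, DifferentiableOn ℂ (p j) (Metric.ball 0 R)) ∧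
    (∀ j, J < j → p j = 0) ∧
    ∀ᶠ x in 𝓝[>] (0 : ℝ), f x = ((x ^ m : ℝ) : ℂ) * logSum p J (Real.log x) x

/-- Near `1`, `f` is the sum of a holomorphic function and a logarithmic series in `1 - x`. -/
def IsLogSeriesAtOne (R : ℝ) (E : ℕ → ℝ) (f : ℝ → ℂ) : Prop :=
  ∃ h : ℂ → ℂ, DifferentiableOn ℂ h (Metric.ball 0 R) ∧
    IsLogSeries R E fun y => f (1 - y) - h y

/-- The three regularity properties of a profile function on `(0,1)`. -/
structure IsProfile (U : Set ℂ) (R m : ℝ) (E : ℕ → ℝ) (f : ℝ → ℂ) : Prop where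
  hol : HasHolExtension U f
  zero : IsLogPolyAtZero R m f
  one : IsLogSeriesAtOne R E f

section Closure

variable {U : Set ℂ} {R m : ℝ} {E : ℕ → ℝ} {f g : ℝ → ℂ}

theorem HasHolExtension.lin (hf : HasHolExtension U f) (hg : HasHolExtension U g) (c d : ℂ) :
    HasHolExtension U fun x => c * f x + d * g x := by
  obtain ⟨F, dF, hF⟩ := hf
  obtain ⟨G, dG, hG⟩ := hg
  exact ⟨fun z => c * F z + d * G z, (dF.const_mul c).fun_add (dG.const_mul d), fun x hx => by
    simp only [hF x hx, hG x hx]⟩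

theorem HasHolExtension.mul (hf : HasHolExtension U f) (hg : HasHolExtension U g) :
    HasHolExtension U fun x => f x * g x := by
  obtain ⟨F, dF, hF⟩ := hf
  obtain ⟨G, dG, hG⟩ := hg
  exact ⟨fun z => F z * G z, dF.fun_mul dG, fun x hx => by simp only [hF x hx, hG x hx]⟩

theorem HasHolExtension.congr (hf : HasHolExtension U f) (h : ∀ x ∈ Ioo (0 : ℝ) 1, g x = f x) :
    HasHolExtension U g := by
  obtain ⟨F, dF, hF⟩ := hf
  exact ⟨F, dF, fun x hx => by rw [hF x hx, h x hx]⟩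

theorem IsLogPolyAtZero.lin (hf : IsLogPolyAtZero R m f) (hg : IsLogPolyAtZero R m g) (c d : ℂ) :
    IsLogPolyAtZero R m fun x => c * f x + d * g x := by
  obtain ⟨J, p, dp, sp, hp⟩ := hf
  obtain ⟨J', p', dp', sp', hp'⟩ := hg
  refine ⟨max J J', fun j z => c * p j z + d * p' j z, fun j =>
    ((dp j).const_mul c).fun_add ((dp' j).const_mul d), fun j hj => ?_, ?_⟩
  · funext z
    simp [sp j ((le_max_left _ _).trans_lt hj), sp' j ((le_max_right _ _).trans_lt hj)]
  · filter_upwards [hp, hp'] with x h1 h2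
    rw [logSum_add, logSum_mul (fun _ => c), logSum_mul (fun _ => d),
      logSum_of_le (le_max_left J J') sp, logSum_of_le (le_max_right J J') sp', h1, h2]
    ring

theorem IsLogPolyAtZero.mul_analytic (hf : IsLogPolyAtZero R m f) {a : ℂ → ℂ}
    (ha : DifferentiableOn ℂ a (Metric.ball 0 R)) : IsLogPolyAtZero R m fun x => a x * f x := by
  obtain ⟨J, p, dp, sp, hp⟩ := hf
  refine ⟨J, fun j z => a z * p j z, fun j => ha.fun_mul (dp j), fun j hj => ?_, ?_⟩
  · funext z; simp [sp j hj]
  · filter_upwards [hp] with x h1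
    rw [logSum_mul, h1]; ring

theorem IsLogPolyAtZero.mul_rpow (hf : IsLogPolyAtZero R m f) (μ : ℝ) :
    IsLogPolyAtZero R (m + μ) fun x => ((x ^ μ : ℝ) : ℂ) * f x := by
  obtain ⟨J, p, dp, sp, hp⟩ := hf
  refine ⟨J, p, dp, sp, ?_⟩
  filter_upwards [hp, self_mem_nhdsWithin] with x h1 hx
  rw [h1, Real.rpow_add hx]; push_cast; ring

theorem differentiableOn_conj_conj {R : ℝ} {f : ℂ → ℂ}
    (hf : DifferentiableOn ℂ f (Metric.ball 0 R)) :
    DifferentiableOn ℂ (fun z => (starRingEnd ℂ) (f ((starRingEnd ℂ) z))) (Metric.ball 0 R) := by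
  intro z hz
  have hz' : (starRingEnd ℂ) z ∈ Metric.ball (0 : ℂ) R := by simpa using hz
  have := ((hf.differentiableAt (Metric.isOpen_ball.mem_nhds hz')).hasDerivAt).conj_conj
  simp only [Complex.conj_conj] at this
  exact this.differentiableAt.differentiableWithinAt

/-- The function `conj (p (conj z))` is holomorphic and equals `conj p` on the real axis; averaging
it with `p` represents the real part. -/
theorem IsLogPolyAtZero.re (hf : IsLogPolyAtZero R m f) :
    IsLogPolyAtZero R m fun x => ((f x).re : ℂ) := by
  obtain ⟨J, p, dp, sp, hp⟩ := hf
  refine ⟨J, fun j z => 1 / 2 * (p j z + (starRingEnd ℂ) (p j ((starRingEnd ℂ) z))), fun j =>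
    ((dp j).fun_add (differentiableOn_conj_conj (dp j))).const_mul _, fun j hj => ?_, ?_⟩
  · funext z; simp [sp j hj]
  · filter_upwards [hp] with x h1
    rw [logSum_mul (fun _ => 1 / 2), logSum_add, Complex.re_eq_add_conj, h1]
    have : logSum (fun j z => (starRingEnd ℂ) (p j ((starRingEnd ℂ) z))) J (Real.log x) x
        = (starRingEnd ℂ) (logSum p J (Real.log x) x) := by
      simp only [logSum, map_sum, map_mul, map_pow, Complex.conj_ofReal]
    rw [this, map_mul, Complex.conj_ofReal]
    ring

theorem IsLogSeriesAtOne.lin (hR : 0 < R) (hf : IsLogSeriesAtOne R E f)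
    (hg : IsLogSeriesAtOne R E g) (c d : ℂ) :
    IsLogSeriesAtOne R E fun x => c * f x + d * g x := by
  obtain ⟨h, dh, hs⟩ := hf
  obtain ⟨h', dh', hs'⟩ := hg
  refine ⟨fun z => c * h z + d * h' z, (dh.const_mul c).fun_add (dh'.const_mul d),
    ((hs.const_mul hR c).add (hs'.const_mul hR d)).congr (Eventually.of_forall fun y => ?_)⟩
  simp only; ring

theorem IsLogSeriesAtOne.mul_analytic (hR : 0 < R) (hf : IsLogSeriesAtOne R E f) {a : ℝ → ℂ}
    {a' : ℂ → ℂ} (ha : DifferentiableOn ℂ a' (Metric.ball 0 R))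
    (haa : ∀ᶠ y in 𝓝[>] (0 : ℝ), a (1 - y) = a' y) :
    IsLogSeriesAtOne R E fun x => a x * f x := by
  obtain ⟨h, dh, hs⟩ := hf
  refine ⟨fun z => a' z * h z, ha.fun_mul dh, (hs.mul_analytic hR ha).congr ?_⟩
  filter_upwards [haa] with y hy
  rw [hy]; ring

/-- A factor `y` is moved into the holomorphic coefficients. This puts solutions and their Euler
derivatives, which lose one power at `1`, into a common class. -/
theorem IsLogSeriesAtOne.sub_one (hR : 0 < R) (hf : IsLogSeriesAtOne R E f) :
    IsLogSeriesAtOne R (fun n => E n - 1) f := by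
  obtain ⟨h, dh, hs⟩ := hf
  refine ⟨h, dh, ((hs.mul_analytic hR (a := fun z => z) differentiableOn_id).mul_rpow (-1)).congr ?_⟩
  filter_upwards [self_mem_nhdsWithin] with y hy
  have : (y : ℂ) ≠ 0 := by exact_mod_cast (ne_of_gt hy)
  rw [Real.rpow_neg_one]
  push_cast
  field_simp

theorem IsProfile.lin (hR : 0 < R) (hf : IsProfile U R m E f) (hg : IsProfile U R m E g)
    (c d : ℂ) : IsProfile U R m E fun x => c * f x + d * g x :=
  ⟨hf.hol.lin hg.hol c d, hf.zero.lin hg.zero c d, hf.one.lin hR hg.one c d⟩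

theorem IsProfile.sub_one (hR : 0 < R) (hf : IsProfile U R m E f) :
    IsProfile U R m (fun n => E n - 1) f :=
  ⟨hf.hol, hf.zero, hf.one.sub_one hR⟩

theorem IsProfile.mul_self (hR : 0 < R) (hf : IsProfile U R m E f) :
    IsProfile U R m E fun x => x * f x := by
  refine ⟨HasHolExtension.mul ⟨fun z => z, differentiableOn_id, fun x _ => rfl⟩ hf.hol,
    hf.zero.mul_analytic (a := fun z => z) differentiableOn_id,
    hf.one.mul_analytic hR (a' := fun z => 1 - z) ((differentiableOn_const 1).fun_sub
      differentiableOn_id) (Eventually.of_forall fun y => by push_cast; rfl)⟩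

theorem slitPlane_one_sub {R : ℝ} (hR : R ≤ 1) {z : ℂ} (hz : z ∈ Metric.ball (0 : ℂ) R) :
    1 - z ∈ Complex.slitPlane := by
  refine Or.inl ?_
  have h1 : ‖z‖ < R := by simpa using hz
  have := (Complex.abs_re_le_norm z).trans_lt h1
  simp only [Complex.sub_re, Complex.one_re]
  linarith [(abs_lt.1 this).2]

/-- The power is holomorphic on `U` through the logarithm there and holomorphic near `1` through the
principal branch, so only the exponent at `0` changes. -/
theorem IsProfile.mul_rpow (hU : IsProfileDomain U) (hR : 0 < R) (hR1 : R ≤ 1)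
    (hf : IsProfile U R m E f) (μ : ℝ) :
    IsProfile U R (m + μ) E fun x => ((x ^ μ : ℝ) : ℂ) * f x := by
  obtain ⟨ℓ, hℓ, -, hℓx⟩ := hU.exists_log
  refine ⟨HasHolExtension.mul ⟨fun z => Complex.exp (μ * ℓ z), fun z hz =>
    ((hℓ z hz).const_mul (μ : ℂ)).cexp.differentiableAt.differentiableWithinAt, fun x hx => ?_⟩
    hf.hol, hf.zero.mul_rpow μ, hf.one.mul_analytic hR
    (a' := fun z => Complex.exp (μ * Complex.log (1 - z))) (fun z hz => ?_) ?_⟩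
  · simp only [hℓx x hx, Complex.ofReal_log hx.1.le, exp_mul_log_ofReal hx.1]
  · exact ((((hasDerivAt_id' z).const_sub 1).clog (slitPlane_one_sub hR1 hz)).const_mul
      (μ : ℂ)).cexp.differentiableAt.differentiableWithinAt
  · filter_upwards [Ioo_mem_nhdsGT one_pos] with y hy
    have : (1 : ℂ) - y = ((1 - y : ℝ) : ℂ) := by push_cast; rfl
    rw [this, exp_mul_log_ofReal (by linarith [hy.2])]

end Closure

/-! ### The equation with a profile as source -/

theorem FrobeniusBasis.hasHolExtension₁ {N A B : ℂ} (b : FrobeniusBasis N A B) {U : Set ℂ}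
    (hU : IsProfileDomain U) :
    HasHolExtension U (fun x => b.h₁ x + Real.log x * (b.Z x * b.h₂ x)) ∧
    HasHolExtension U (fun x => b.k₁ x + Real.log x * (b.Z x * b.k₂ x)) := by
  obtain ⟨ℓ, hℓ, -, hℓx⟩ := hU.exists_log
  have dℓ : DifferentiableOn ℂ ℓ U := fun z hz => (hℓ z hz).differentiableAt.differentiableWithinAt
  have hs := hU.subset_ball
  refine ⟨⟨fun z => b.h₁ z + ℓ z * (b.Z z * b.h₂ z), (b.diff_h₁.mono hs).fun_add (dℓ.fun_mul
    ((b.diff_Z.mono hs).fun_mul (b.diff_h₂.mono hs))), fun x hx => by simp only [hℓx x hx]⟩,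
    ⟨fun z => b.k₁ z + ℓ z * (b.Z z * b.k₂ z), (b.diff_k₁.mono hs).fun_add (dℓ.fun_mul
    ((b.diff_Z.mono hs).fun_mul (b.diff_k₂.mono hs))), fun x hx => by simp only [hℓx x hx]⟩⟩

theorem FrobeniusBasis.hasHolExtension₂ {A B : ℂ} {N : ℝ} (b : FrobeniusBasis (N : ℂ) A B)
    {U : Set ℂ} (hU : IsProfileDomain U) :
    HasHolExtension U (fun x => ((x ^ N : ℝ) : ℂ) * b.h₂ x) ∧
    HasHolExtension U (fun x => ((x ^ N : ℝ) : ℂ) * b.k₂ x) := by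
  obtain ⟨ℓ, hℓ, -, hℓx⟩ := hU.exists_log
  have dM : DifferentiableOn ℂ (fun z => Complex.exp (N * ℓ z)) U := fun z hz =>
    ((hℓ z hz).const_mul (N : ℂ)).cexp.differentiableAt.differentiableWithinAt
  have hM : ∀ x ∈ Ioo (0 : ℝ) 1, Complex.exp (N * ℓ x) = ((x ^ N : ℝ) : ℂ) := fun x hx => by
    rw [hℓx x hx, Complex.ofReal_log hx.1.le, exp_mul_log_ofReal hx.1]
  have hs := hU.subset_ball
  exact ⟨⟨fun z => Complex.exp (N * ℓ z) * b.h₂ z, dM.fun_mul (b.diff_h₂.mono hs),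
    fun x hx => by simp only [hM x hx]⟩,
    ⟨fun z => Complex.exp (N * ℓ z) * b.k₂ z, dM.fun_mul (b.diff_k₂.mono hs),
    fun x hx => by simp only [hM x hx]⟩⟩

/-- The basis functions are holomorphic in the whole unit disc and `U` carries a logarithm, so
variation of constants works on `U` with primitives taken along the domain. -/
theorem exists_holomorphic_solution {A B : ℂ} {N : ℝ} (b : FrobeniusBasis (N : ℂ) A B)
    {U : Set ℂ} (hU : IsProfileDomain U) {S : ℝ → ℂ} (hS : HasHolExtension U S) :
    ∃ F G : ℝ → ℂ, HasHolExtension U F ∧ HasHolExtension U G ∧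
      RealEulerSys N A B (Ioo 0 1) F G S := by
  obtain ⟨s, ds, hs⟩ := hS
  obtain ⟨ℓ, hℓ, hℓe, hℓx⟩ := hU.exists_log
  have hlog : IsLogDomain U ℓ := ⟨hU.isOpen, hU.subset_ball, fun z hz h => hU.zero_notMem (h ▸ hz),
    hℓ, hℓe⟩
  have s₁ := b.sol₁ U ℓ hlog
  have s₂ := b.sol₂ U ℓ hlog
  set φ₁ := fun z => b.h₁ z + ℓ z * (b.Z z * b.h₂ z)
  set γ₁ := fun z => b.k₁ z + ℓ z * (b.Z z * b.k₂ z)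
  set φ₂ := fun z => Complex.exp (N * ℓ z) * b.h₂ z
  set γ₂ := fun z => Complex.exp (N * ℓ z) * b.k₂ z
  have hw : ∀ z ∈ U, φ₁ z * γ₂ z - φ₂ z * γ₁ z ≠ 0 := fun z hz => b.wronskian_ne_zero hlog hz
  have dd : ∀ {f : ℂ → ℂ}, (∀ z ∈ U, DifferentiableAt ℂ f z) → DifferentiableOn ℂ f U :=
    fun h z hz => (h z hz).differentiableWithinAt
  have hden : ∀ z ∈ U, z * (1 - z) * (φ₁ z * γ₂ z - φ₂ z * γ₁ z) ≠ 0 := fun z hz =>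
    mul_ne_zero (mul_ne_zero (hlog.ne_zero z hz) (sub_ne_zero.2 (hlog.ne_one hz).symm)) (hw z hz)
  have dden : DifferentiableOn ℂ (fun z => z * (1 - z) * (φ₁ z * γ₂ z - φ₂ z * γ₁ z)) U :=
    (differentiableOn_id.fun_mul ((differentiableOn_const 1).fun_sub differentiableOn_id)).fun_mul
      (((dd s₁.1).fun_mul (dd s₂.2)).fun_sub ((dd s₂.1).fun_mul (dd s₁.2)))
  obtain ⟨P₁, hP₁⟩ := hU.simplyConnected.exists_primitive hU.isOpen
    (((dd s₁.1).fun_mul ds).fun_div dden hden)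
  obtain ⟨P₂, hP₂⟩ := hU.simplyConnected.exists_primitive hU.isOpen
    (((dd s₂.1).fun_mul ds).fun_div dden hden)
  have sol := s₁.variation s₂ (S := s) hw (fun z hz => (hP₁ z hz).differentiableAt)
    (fun z hz => (hP₂ z hz).differentiableAt)
    (fun z hz => by
      rw [(hP₁ z hz).deriv, mul_div_assoc', div_mul_eq_mul_div, div_mul_eq_mul_div,
        div_eq_iff (hden z hz)]
      ring)
    (fun z hz => by
      rw [(hP₂ z hz).deriv, mul_div_assoc', div_mul_eq_mul_div, div_mul_eq_mul_div,
        div_eq_iff (hden z hz)]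
      ring)
    (fun z hz => hlog.ne_one hz)
  have real := sol.restrict_real (I := Ioo 0 1) hU.contains_interval hlog.ne_zero
    (fun z hz => hlog.ne_one hz)
  exact ⟨_, _, ⟨_, dd sol.1, fun x hx => rfl⟩, ⟨_, dd sol.2, fun x hx => rfl⟩,
    real.congr isOpen_Ioo (fun x hx => rfl) (fun x hx => rfl) (fun x hx => (hs x hx).symm)⟩

theorem RealEulerSys.re {N A B : ℝ} {I : Set ℝ} {F G : ℝ → ℂ} {S : ℝ → ℝ}
    (h : RealEulerSys N A B I F G fun x => S x) :
    RealEulerSys N A B I (fun x => ((F x).re : ℂ)) (fun x => ((G x).re : ℂ)) fun x => S x := by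
  have key : ∀ {f : ℝ → ℂ} {f' : ℂ} {x : ℝ}, HasDerivAt f f' x →
      HasDerivAt (fun x => ((f x).re : ℂ)) (f'.re : ℂ) x := fun hf =>
    (Complex.reCLM.hasFDerivAt.comp_hasDerivAt _ hf).ofReal_comp
  refine ⟨fun x hx => (key (h.1 x hx)).congr_deriv ?_, fun x hx => (key (h.2 x hx)).congr_deriv ?_⟩
  · rw [Complex.div_ofReal_re]; push_cast; rfl
  · have : (x : ℂ) * (1 - x) = ((x * (1 - x) : ℝ) : ℂ) := by push_cast; rfl
    rw [this, Complex.div_ofReal_re]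
    push_cast
    congr 1
    have e1 : ((N : ℂ) + x * (A + B)) = ((N + x * (A + B) : ℝ) : ℂ) := by push_cast; rfl
    have e2 : ((x : ℂ) * A * B) = ((x * A * B : ℝ) : ℂ) := by push_cast; rfl
    rw [e1, e2]
    simp only [Complex.add_re, Complex.re_ofReal_mul, Complex.ofReal_re]
    push_cast; rfl

theorem exists_solution_at_zero {A B : ℂ} {N : ℝ} (hN : 0 ≤ N) (b : FrobeniusBasis (N : ℂ) A B)
    {R m : ℝ} (hR0 : 0 < R) (hR : R ≤ 1) {S : ℝ → ℂ} (hS : IsLogPolyAtZero R m S) :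
    ∃ (F G : ℝ → ℂ) (ε : ℝ), 0 < ε ∧ ε ≤ 1 ∧ IsLogPolyAtZero R m F ∧ IsLogPolyAtZero R m G ∧
      RealEulerSys N A B (Ioo 0 ε) F G S := by
  obtain ⟨J, p, dp, sp, hp⟩ := hS
  obtain ⟨C₀, -, hsol⟩ := b.exists_solution_logSum hN hR (show R / 2 < R by linarith)
  obtain ⟨P, Q, dP, dQ, sP, sQ, hsys, -⟩ := hsol m J p dp sp
  obtain ⟨δ, hδ0, hδ⟩ := mem_nhdsGT_iff_exists_Ioo_subset.1 hp
  refine ⟨fun x => ((x ^ m : ℝ) : ℂ) * logSum P (J + 2) (Real.log x) x,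
    fun x => ((x ^ m : ℝ) : ℂ) * logSum Q (J + 2) (Real.log x) x, min δ R, lt_min hδ0 hR0,
    (min_le_right _ _).trans hR, ⟨J + 2, P, dP, sP, Eventually.of_forall fun _ => rfl⟩,
    ⟨J + 2, Q, dQ, sQ, Eventually.of_forall fun _ => rfl⟩, ?_⟩
  refine (((hsys _ _ (isLogDomain_slit hR) inter_subset_right).restrict_slit hR).mono
    (Ioo_subset_Ioo_right (min_le_right δ R))).congr isOpen_Ioo
    (fun y hy => ?_) (fun y hy => ?_) (fun y hy => ?_)
  · simp only [exp_mul_log_ofReal hy.1, Complex.ofReal_log hy.1.le]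
  · simp only [exp_mul_log_ofReal hy.1, Complex.ofReal_log hy.1.le]
  · have hy' := hδ ⟨hy.1, hy.2.trans_le (min_le_left _ _)⟩
    simp only [mem_ofPred_eq] at hy'
    simp only [hy', exp_mul_log_ofReal hy.1, Complex.ofReal_log hy.1.le]

/-- A real solution on `(0,1)` that extends to `U` and has a pure expansion at `0`. -/
theorem exists_real_solution {N A B : ℝ} (hN : 0 ≤ N)
    {U : Set ℂ} (hU : IsProfileDomain U) {R m : ℝ} (hR0 : 0 < R) (hR : R ≤ 1) {S : ℝ → ℝ}
    (hS : HasHolExtension U fun x => S x) (hS0 : IsLogPolyAtZero R m fun x => S x) :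
    ∃ F G : ℝ → ℝ, HasHolExtension U (fun x => F x) ∧ HasHolExtension U (fun x => G x) ∧
      IsLogPolyAtZero R m (fun x => F x) ∧ IsLogPolyAtZero R m (fun x => G x) ∧
      RealEulerSys N A B (Ioo 0 1) (fun x => F x) (fun x => G x) (fun x => S x) := by
  obtain ⟨b⟩ := exists_frobeniusBasis hN (A : ℂ) B
  obtain ⟨F₀, G₀, hF₀, hG₀, hsol₀⟩ := exists_holomorphic_solution b hU hS
  obtain ⟨F₁, G₁, ε, hε0, hε1, hF₁, hG₁, hsol₁⟩ := exists_solution_at_zero hN b hR0 hR hS0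
  have hsub : Ioo 0 ε ⊆ Ioo (0 : ℝ) 1 := Ioo_subset_Ioo_right hε1
  -- Near `0` the global and the local solution differ by a homogeneous solution. That one exists on
  -- all of `(0,1)` and extends to `U`, so subtracting it gives the local expansion without losing
  -- the extension.
  obtain ⟨c₁, c₂, hc⟩ := b.exists_eq_combination hε1 ((hsol₀.mono hsub).sub_self_source hsol₁)
  have hφ := b.hasHolExtension₁ hU
  have hψ := b.hasHolExtension₂ hU
  set φ₁ : ℝ → ℂ := fun x => b.h₁ x + Real.log x * (b.Z x * b.h₂ x) with hφ₁
  set γ₁ : ℝ → ℂ := fun x => b.k₁ x + Real.log x * (b.Z x * b.k₂ x) with hγ₁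
  set φ₂ : ℝ → ℂ := fun x => ((x ^ N : ℝ) : ℂ) * b.h₂ x with hφ₂
  set γ₂ : ℝ → ℂ := fun x => ((x ^ N : ℝ) : ℂ) * b.k₂ x with hγ₂
  have hev : ∀ᶠ x in 𝓝[>] (0 : ℝ), x ∈ Ioo 0 ε := Ioo_mem_nhdsGT hε0
  have hsol₂ := hsol₀.lin (b.real₁.lin b.real₂ c₁ c₂) 1 (-1)
  have hsol₂' : RealEulerSys N A B (Ioo 0 1)
      (fun x => 1 * F₀ x + -1 * (c₁ * φ₁ x + c₂ * φ₂ x))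
      (fun x => 1 * G₀ x + -1 * (c₁ * γ₁ x + c₂ * γ₂ x)) (fun x => S x) :=
    hsol₂.congr isOpen_Ioo (fun x hx => rfl) (fun x hx => rfl) (fun x hx => by simp)
  have hhol₂ := hF₀.lin (hφ.1.lin hψ.1 c₁ c₂) 1 (-1)
  have hhol₂' := hG₀.lin (hφ.2.lin hψ.2 c₁ c₂) 1 (-1)
  set F₂ : ℝ → ℂ := fun x => 1 * F₀ x + -1 * (c₁ * φ₁ x + c₂ * φ₂ x) with hF₂
  set G₂ : ℝ → ℂ := fun x => 1 * G₀ x + -1 * (c₁ * γ₁ x + c₂ * γ₂ x) with hG₂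
  have hz₂ : IsLogPolyAtZero R m F₂ := by
    obtain ⟨J, p, dp, sp, hp⟩ := hF₁
    refine ⟨J, p, dp, sp, ?_⟩
    filter_upwards [hp, hev] with x hx hxε
    rw [← hx]
    have := (hc x hxε).1
    simp only [hF₂, hφ₁, hφ₂]
    linear_combination this
  have hz₂' : IsLogPolyAtZero R m G₂ := by
    obtain ⟨J, p, dp, sp, hp⟩ := hG₁
    refine ⟨J, p, dp, sp, ?_⟩
    filter_upwards [hp, hev] with x hx hxε
    rw [← hx]
    have := (hc x hxε).2
    simp only [hG₂, hγ₁, hγ₂]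
    linear_combination this
  have hre := hsol₂'.re
  -- `U` need not be symmetric under conjugation, so the extension of the real part is not obtained
  -- by conjugating. Instead `F₂ - Re F₂` is a homogeneous solution, and these extend to `U`.
  obtain ⟨d₁, d₂, hd⟩ := b.exists_eq_combination le_rfl (hsol₂'.sub_self_source hre)
  refine ⟨fun x => (F₂ x).re, fun x => (G₂ x).re, ?_, ?_, hz₂.re, hz₂'.re, hre⟩
  · refine (hhol₂.lin (hφ.1.lin hψ.1 d₁ d₂) 1 (-1)).congr fun x hx => ?_
    have := (hd x hx).1
    simp only [hφ₁, hφ₂]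
    linear_combination -this
  · refine (hhol₂'.lin (hφ.2.lin hψ.2 d₁ d₂) 1 (-1)).congr fun x hx => ?_
    have := (hd x hx).2
    simp only [hγ₁, hγ₂]
    linear_combination -this

/-- Regularity of solutions at `1`. -/
theorem RealEulerSys.isLogSeriesAtOne {A B : ℂ} {N : ℂ} {κ : ℝ} (hκ : 0 ≤ κ)
    (hκN : (κ : ℂ) = 1 - N - A - B) {R : ℝ} (hR0 : 0 < R) (hR : R ≤ 1) {E : ℕ → ℝ}
    (hE : ∃ k, E k = κ) {F G S : ℝ → ℂ} (h : RealEulerSys N A B (Ioo 0 1) F G S)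
    (hS : IsLogSeriesAtOne R (fun n => E n - 1) S) :
    IsLogSeriesAtOne R E F ∧ IsLogSeriesAtOne R (fun n => E n - 1) G := by
  obtain ⟨k, hk⟩ := hE
  -- After reflection `κ` plays the role of `N`, so this basis describes homogeneous solutions near
  -- `x = 1`.
  obtain ⟨b⟩ := exists_frobeniusBasis hκ A B
  obtain ⟨h₀, dh₀, hser⟩ := hS
  have hsub : Metric.ball (0 : ℂ) R ⊆ Metric.ball 0 1 := Metric.ball_subset_ball hR
  have hne : ∀ z ∈ Metric.ball (0 : ℂ) R, 1 - z ≠ 0 := fun z hz =>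
    Complex.slitPlane_ne_zero (slitPlane_one_sub hR hz)
  have d1 : DifferentiableOn ℂ (fun z : ℂ => 1 - z) (Metric.ball 0 R) :=
    (differentiableOn_const 1).fun_sub differentiableOn_id
  have d1i : DifferentiableOn ℂ (fun z : ℂ => (1 - z)⁻¹) (Metric.ball 0 R) := d1.fun_inv hne
  -- The holomorphic part of the source. The factor `z` from the reflection makes it vanish at `0`,
  -- as required. A nonzero residue forces `n = κ`, so the resonant monomial has the listed exponent
  -- `κ` and joins the series part.
  obtain ⟨e, r, n, de, -, hrn, hesys⟩ := EulerSys.exists_powerSum hR hR0 (κ : ℂ) A B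
    (s := fun z => z * h₀ z * (1 - z)⁻¹) ((differentiableOn_id.fun_mul dh₀).fun_mul d1i) (by simp) 0
  have hesys' := (hesys.mono (inter_subset_right (s := Complex.slitPlane))).restrict_slit hR
  have hrn' : ∀ y : ℝ, 0 < y → r * (y : ℂ) ^ n = r * ((y ^ κ : ℝ) : ℂ) := by
    intro y hy
    rcases hrn with ⟨h1, -⟩ | h1
    · have : (n : ℝ) = κ := by exact_mod_cast h1
      rw [← this, Real.rpow_natCast]; push_cast; rfl
    · simp [h1]
  have single : ∀ {a c : ℂ → ℂ}, DifferentiableOn ℂ a (Metric.ball 0 R) →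
      DifferentiableOn ℂ c (Metric.ball 0 R) → IsLogSeries R E fun y =>
        ((y ^ κ : ℝ) : ℂ) * (a y + Real.log y * c y) := fun ha hc => by
    have := IsLogSeries.single (E := E) hR0 k ha hc
    rwa [hk] at this
  -- The factor `y` of the reflected source raises the exponents `E n - 1` to `E n`; this is the
  -- improvement from `β` to `β + 1`.
  have hsrc : IsLogSeries R E fun y => (1 - (y : ℂ))⁻¹ * (((y ^ (1 : ℝ) : ℝ) : ℂ) *
      (S (1 - y) - h₀ y)) + ((y ^ κ : ℝ) : ℂ) * (r + Real.log y * 0) := by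
    have h1 := (hser.mul_rpow 1).mul_analytic hR0 d1i
    simp only [sub_add_cancel] at h1
    exact h1.add (single (a := fun _ => r) (c := fun _ => 0) (differentiableOn_const r)
      (differentiableOn_const 0))
  obtain ⟨F₂, G₂, ε, hε0, hε1, hF₂, hG₂, hsol₂⟩ := hsrc.exists_solution hκ b hR0 hR
  set δ := min ε R with hδ
  have hδ0 : 0 < δ := lt_min hε0 hR0
  have hδ1 : δ ≤ 1 := (min_le_left _ _).trans hε1
  have hloc := (hesys'.mono (Ioo_subset_Ioo_right (min_le_right ε R))).lin
    (hsol₂.mono (Ioo_subset_Ioo_right (min_le_left ε R))) 1 1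
  have hrefl := h.reflect (fun x hx => hx)
  rw [← hκN] at hrefl
  have hrefl' := hrefl.mono (I' := Ioo 0 δ) (fun y hy =>
    ⟨by linarith [hy.2], by linarith [hy.1]⟩)
  have hloc' := hloc.congr isOpen_Ioo (fun y hy => rfl) (fun y hy => rfl)
    (S' := fun y => (y : ℂ) / (1 - y) * S (1 - y)) (fun y hy => by
      have h1 : (1 : ℂ) - y ≠ 0 := by
        have : (1 : ℝ) - y ≠ 0 := by linarith [hy.2]
        exact_mod_cast this
      simp only [Real.rpow_one, hrn' y hy.1]
      field_simp
      ring)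
  obtain ⟨c₁, c₂, hc⟩ := b.exists_eq_combination hδ1 (hrefl'.sub_self_source hloc')
  have dh₁ := b.diff_h₁.mono hsub
  have dh₂ := b.diff_h₂.mono hsub
  have dk₂ := b.diff_k₂.mono hsub
  have de' := de.deriv Metric.isOpen_ball
  have dh₁' := dh₁.deriv Metric.isOpen_ball
  have hev : ∀ᶠ y in 𝓝[>] (0 : ℝ), y ∈ Ioo 0 δ := Ioo_mem_nhdsGT hδ0
  constructor
  · refine ⟨fun z => e z + c₁ * b.h₁ z, de.fun_add (dh₁.const_mul c₁),
      (hF₂.add (single (dh₂.const_mul c₂) (dh₂.const_mul (c₁ * b.K)))).congr ?_⟩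
    filter_upwards [hev] with y hy
    have h1 := (hc y hy).1
    rw [b.real_Z ⟨hy.1, hy.2.trans_le hδ1⟩] at h1
    linear_combination h1
  -- Undoing the reflection divides by `y/(1-y)`. The parts `z e'` and `z h₁'` are divisible by `z`
  -- and stay holomorphic; the rest has the exponents of `E` and drops to `E n - 1`.
  · refine ⟨fun z => -((1 - z) * (deriv e z + c₁ * deriv b.h₁ z)),
      (d1.fun_mul (de'.fun_add (dh₁'.const_mul c₁))).fun_neg, ?_⟩
    refine ((((hG₂.add (single ((dh₂.const_mul (c₁ * b.K)).fun_add (dk₂.const_mul c₂))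
      (dk₂.const_mul (c₁ * b.K)))).mul_analytic hR0 d1).const_mul hR0 (-1)).mul_rpow (-1)).congr ?_
    filter_upwards [hev] with y hy
    have hy1 : y ∈ Ioo (0 : ℝ) 1 := ⟨hy.1, hy.2.trans_le hδ1⟩
    have h1 := (hc y hy).2
    have hymem : (y : ℂ) ∈ Metric.ball (0 : ℂ) 1 := (ofReal_mem_slit_ball hy1).2
    rw [b.k₁_eq y hymem, b.real_Z hy1] at h1
    have hy0 : (y : ℂ) ≠ 0 := by exact_mod_cast hy.1.ne'
    have h2 : (1 : ℂ) - y ≠ 0 := by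
      have : (1 : ℝ) - y ≠ 0 := by linarith [hy1.2]
      exact_mod_cast this
    rw [Real.rpow_neg_one]
    push_cast
    field_simp at h1 ⊢
    linear_combination -h1

/-- Solvability of the profile equation in the class of profiles. -/
theorem exists_profile_solution {N A B κ : ℝ} (hN : 0 ≤ N) (hκ : 0 ≤ κ) (hκN : κ = 1 - N - A - B)
    {U : Set ℂ} (hU : IsProfileDomain U) {R m : ℝ} (hR0 : 0 < R) (hR : R ≤ 1) {E : ℕ → ℝ}
    (hE : ∃ k, E k = κ) {S : ℝ → ℝ} (hS : IsProfile U R m (fun n => E n - 1) fun x => S x) :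
    ∃ F G : ℝ → ℝ, IsProfile U R m E (fun x => F x) ∧
      IsProfile U R m (fun n => E n - 1) (fun x => G x) ∧
      RealEulerSys N A B (Ioo 0 1) (fun x => F x) (fun x => G x) (fun x => S x) := by
  obtain ⟨F, G, hF, hG, hF0, hG0, hsol⟩ := exists_real_solution (A := A) (B := B) hN hU hR0 hR
    hS.hol hS.zero
  obtain ⟨h1, h2⟩ := hsol.isLogSeriesAtOne hκ (by rw [hκN]; push_cast; ring) hR0 hR hE hS.one
  exact ⟨F, G, ⟨hF, hF0, h1⟩, ⟨hG, hG0, h2⟩, hsol⟩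

/-! ### Exponent lists and the class `Q̃_β` -/

/-- Exponents at least `β` that either do not grow (for series with finitely many terms) or increase
strictly and at least linearly. -/
def IsExponentList (β : ℝ) (E : ℕ → ℝ) : Prop :=
  (∀ n, β ≤ E n) ∧ (¬ LinearGrowth E ∨
    StrictMono E ∧ ∃ c : ℝ, 0 < c ∧ ∀ n : ℕ, 1 ≤ n → c * (n + 1) ≤ E n - β)

theorem LinearGrowth.add_const {E : ℕ → ℝ} (h : LinearGrowth E) (a : ℝ) :
    LinearGrowth fun n => E n + a := by
  obtain ⟨c, hc, K, hK⟩ := h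
  exact ⟨c, hc, K - a, fun n => by linarith [hK n]⟩

theorem linearGrowth_of_le {E : ℕ → ℝ} {β c : ℝ} (hc : 0 < c) (h0 : β ≤ E 0)
    (h : ∀ n : ℕ, 1 ≤ n → c * (n + 1) ≤ E n - β) : LinearGrowth E := by
  refine ⟨c, hc, c - β, fun n => ?_⟩
  rcases Nat.eq_zero_or_pos n with rfl | hn
  · simp only [Nat.cast_zero]; linarith
  · linarith [h n hn]

theorem LinearGrowth.tendsto_atTop {E : ℕ → ℝ} (h : LinearGrowth E) : Tendsto E atTop atTop := by
  obtain ⟨c, hc, K, hK⟩ := h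
  refine tendsto_atTop_mono hK ?_
  simp only [sub_eq_add_neg]
  refine tendsto_atTop_add_const_right _ _ (Tendsto.const_mul_atTop hc ?_)
  exact tendsto_atTop_add_const_right _ _ tendsto_natCast_atTop_atTop

/-- A new exponent can be inserted into a list of exponents raised by one. -/
theorem IsExponentList.exists_insert {β κ : ℝ} {E₀ : ℕ → ℝ} (h : IsExponentList β E₀) :
    ∃ (E : ℕ → ℝ) (ι : ℕ → ℕ), (∃ k, E k = κ) ∧ Function.Injective ι ∧ (∀ n, n ≤ ι n) ∧
      (∀ n, E (ι n) - 1 = E₀ n) ∧ (LinearGrowth E₀ → LinearGrowth fun n => E n - 1) ∧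
      IsExponentList (min (β + 1) κ) E := by
  obtain ⟨hβ, hfin | ⟨hmono, c, hc, hgrow⟩⟩ := h
  -- Without linear growth a series has only finitely many terms and the order of exponents is
  -- irrelevant, so `κ` is put in front.
  · refine ⟨fun n => n.casesOn κ fun n => E₀ n + 1, Nat.succ, ⟨0, rfl⟩, Nat.succ_injective,
      Nat.le_succ, fun n => add_sub_cancel_right _ _, fun h => (hfin h).elim, fun n => ?_,
      Or.inl fun ⟨c, hc, K, hK⟩ => hfin ⟨c, hc, K - c + 1, fun n => ?_⟩⟩
    · cases n with
      | zero => exact min_le_right _ _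
      | succ n => exact (min_le_left _ _).trans (by simpa using hβ n)
    · have := hK (n + 1)
      push_cast at this
      linarith
  · have hg0 : LinearGrowth E₀ := linearGrowth_of_le hc (hβ 0) hgrow
    by_cases hκ : ∃ k, E₀ k + 1 = κ
    · refine ⟨fun n => E₀ n + 1, id, hκ, Function.injective_id, fun n => le_rfl,
        fun n => add_sub_cancel_right _ _, fun h => by simpa using h,
        fun n => (min_le_left _ _).trans (by simpa using hβ n), Or.inr ⟨fun a b hab => by
          simpa using hmono hab, c, hc, fun n hn => ?_⟩⟩
      linarith [hgrow n hn, min_le_left (β + 1) κ]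
    · push Not at hκ
      obtain ⟨n₀, hn₀⟩ : ∃ n, κ < E₀ n + 1 := by
        obtain ⟨n, hn⟩ := (hg0.tendsto_atTop.eventually_gt_atTop (κ - 1)).exists
        exact ⟨n, by linarith⟩
      classical
      -- The position at which `κ` must be inserted to keep the list strictly increasing.
      set k := Nat.find (⟨n₀, hn₀⟩ : ∃ n, κ < E₀ n + 1) with hk
      have hk1 : κ < E₀ k + 1 := Nat.find_spec (⟨n₀, hn₀⟩ : ∃ n, κ < E₀ n + 1)
      have hk2 : ∀ n, n < k → E₀ n + 1 < κ := fun n hn =>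
        lt_of_le_of_ne (not_lt.1 (Nat.find_min (⟨n₀, hn₀⟩ : ∃ n, κ < E₀ n + 1) hn)) (hκ n)
      set E : ℕ → ℝ := fun n => if n < k then E₀ n + 1 else if n = k then κ else E₀ (n - 1) + 1
        with hE
      have e1 : ∀ n, n < k → E n = E₀ n + 1 := fun n hn => by simp [hE, hn]
      have e2 : E k = κ := by simp [hE]
      have e3 : ∀ n, k ≤ n → E (n + 1) = E₀ n + 1 := fun n hn => by
        simp only [hE]
        rw [if_neg (by omega), if_neg (by omega), Nat.add_sub_cancel]
      have hEmono : StrictMono E := by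
        refine strictMono_nat_of_lt_succ fun n => ?_
        rcases lt_trichotomy n k with h | h | h
        · rw [e1 n h]
          rcases (Nat.succ_le_of_lt h).lt_or_eq with h' | h'
          · rw [e1 _ h']; simpa using hmono (Nat.lt_succ_self n)
          · have : n + 1 = k := h'
            rw [this, e2]; exact hk2 n h
        · rw [e3 n h.ge, h, e2]; exact hk1
        · obtain ⟨m, rfl⟩ : ∃ m, n = m + 1 := ⟨n - 1, by omega⟩
          rw [e3 m (by omega), e3 _ (by omega)]
          simpa using hmono (Nat.lt_succ_self m)
      have hle : ∀ n, E₀ n + 1 ≤ E (n + 1) := fun n => by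
        rcases lt_trichotomy (n + 1) k with h | h | h
        · rw [e1 _ h]; simpa using (hmono (Nat.lt_succ_self n)).le
        · rw [h, e2]; exact (hk2 n (by omega)).le
        · rw [e3 n (by omega)]
      have h0 : min (β + 1) κ ≤ E 0 := by
        rcases Nat.eq_zero_or_pos k with h | h
        · rw [← h, e2]; exact min_le_right _ _
        · rw [e1 0 h]; exact (min_le_left _ _).trans (by linarith [hβ 0])
      have h01 : E 0 < E 1 := hEmono zero_lt_one
      -- Halving `c` pays for the shift by one position when `n ≥ 2`. At `n = 1` the old growth says
      -- nothing, and the second entry of the minimum, positive since `E 0 < E 1`, takes over.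
      have hgE : ∀ n : ℕ, 1 ≤ n → min (c / 2) ((E 1 - min (β + 1) κ) / 2) * (n + 1) ≤
          E n - min (β + 1) κ := by
        intro n hn
        rcases hn.eq_or_lt with rfl | hn
        · have := min_le_right (c / 2) ((E 1 - min (β + 1) κ) / 2)
          push_cast
          linarith
        · obtain ⟨m, rfl⟩ : ∃ m, n = m + 1 := ⟨n - 1, by omega⟩
          have a1 := hgrow m (by omega)
          have a2 := hle m
          have a3 := min_le_left (β + 1) κ
          have a4 := min_le_left (c / 2) ((E 1 - min (β + 1) κ) / 2)
          have a5 := mul_le_mul_of_nonneg_right a4 (show (0 : ℝ) ≤ ((m + 1 : ℕ) : ℝ) + 1 by positivity)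
          refine a5.trans ?_
          push_cast
          nlinarith [Nat.cast_nonneg (α := ℝ) m]
      have hc' : 0 < min (c / 2) ((E 1 - min (β + 1) κ) / 2) :=
        lt_min (by linarith) (by linarith)
      refine ⟨E, fun n => if n < k then n else n + 1, ⟨k, e2⟩, fun a b hab => ?_, fun n => ?_,
        fun n => ?_, fun _ => (linearGrowth_of_le hc' h0 hgE).add_const (-1),
        fun n => h0.trans (hEmono.monotone (Nat.zero_le n)), Or.inr ⟨hEmono, _, hc', hgE⟩⟩
      · simp only at hab
        split_ifs at hab <;> omega
      · beta_reduce
        split_ifs <;> omega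
      · beta_reduce
        split_ifs with h
        · rw [e1 n h]; ring
        · rw [e3 n (not_lt.1 h)]; ring

/-! ### Translation between `IsProfile` and `MemQTilde` -/

theorem IsProfile.reindex {U : Set ℂ} {R m : ℝ} {E E' : ℕ → ℝ} {f : ℝ → ℂ}
    (hf : IsProfile U R m E f) {ι : ℕ → ℕ} (hι : Function.Injective ι) (hle : ∀ n, n ≤ ι n)
    (hE : ∀ n, E' (ι n) = E n) (hg : LinearGrowth E → LinearGrowth E') : IsProfile U R m E' f := by
  obtain ⟨h, dh, hs⟩ := hf.one
  exact ⟨hf.hol, hf.zero, h, dh, hs.reindex hι hle hE hg⟩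

theorem eventually_one_sub {P : ℝ → Prop} (h : ∀ᶠ x in 𝓝[<] (1 : ℝ), P x) :
    ∀ᶠ y in 𝓝[>] (0 : ℝ), P (1 - y) := by
  refine (tendsto_nhdsWithin_iff.2 ⟨?_, ?_⟩ : Tendsto (fun y : ℝ => 1 - y) (𝓝[>] 0) (𝓝[<] 1)) h
  · have : Tendsto (fun y : ℝ => 1 - y) (𝓝 0) (𝓝 (1 - 0)) := by
      exact (continuous_const.sub continuous_id).tendsto _
    rw [sub_zero] at this
    exact this.mono_left nhdsWithin_le_nhds
  · filter_upwards [self_mem_nhdsWithin] with y hy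
    have : 0 < y := hy
    simpa using this

theorem eventually_one_sub' {P : ℝ → Prop} (h : ∀ᶠ y in 𝓝[>] (0 : ℝ), P y) :
    ∀ᶠ x in 𝓝[<] (1 : ℝ), P (1 - x) := by
  refine (tendsto_nhdsWithin_iff.2 ⟨?_, ?_⟩ : Tendsto (fun y : ℝ => 1 - y) (𝓝[<] 1) (𝓝[>] 0)) h
  · have : Tendsto (fun y : ℝ => 1 - y) (𝓝 1) (𝓝 (1 - 1)) := by
      exact (continuous_const.sub continuous_id).tendsto _
    rw [sub_self] at this
    exact this.mono_left nhdsWithin_le_nhds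
  · filter_upwards [self_mem_nhdsWithin] with y hy
    have : y < 1 := hy
    simpa using this

theorem HasLogExpansionAtZero.isLogPolyAtZero {R : ℝ} {q : ℝ → ℝ}
    (h : HasLogExpansionAtZero R q) : IsLogPolyAtZero R 0 fun x => q x := by
  obtain ⟨L, p, dp, hp⟩ := h
  refine ⟨L, fun j => if j ≤ L then p j else 0, fun j => ?_, fun j hj => if_neg (not_le.2 hj), ?_⟩
  · beta_reduce
    split_ifs with hj
    · exact dp j hj
    · exact differentiableOn_const 0
  · filter_upwards [hp] with x hx
    rw [hx, Real.rpow_zero, Complex.ofReal_one, one_mul, logSum]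
    refine Finset.sum_congr rfl fun j hj => ?_
    rw [if_pos (by simpa [Nat.lt_succ_iff] using hj)]

theorem IsLogPolyAtZero.hasLogExpansionAtZero {R : ℝ} {q : ℝ → ℝ}
    (h : IsLogPolyAtZero R 0 fun x => q x) : HasLogExpansionAtZero R q := by
  obtain ⟨L, p, dp, -, hp⟩ := h
  refine ⟨L, p, fun j _ => dp j, ?_⟩
  filter_upwards [hp] with x hx
  rw [hx, Real.rpow_zero, Complex.ofReal_one, one_mul, logSum]

theorem HasLogPowerExpansionAtOne.exists_isLogSeriesAtOne {R β : ℝ} (hR : 0 < R) {q : ℝ → ℝ}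
    (h : HasLogPowerExpansionAtOne R β q) :
    ∃ E, IsExponentList β E ∧ IsLogSeriesAtOne R E fun x => q x := by
  classical
  obtain ⟨p₀, b, L, p, dp₀, dp, ⟨M, hM⟩, hb, hlist, ⟨C, hC, hbound⟩, hsum⟩ := h
  -- Indices start at `0` here. Coefficients beyond the degree, or vanishing on the disc, become the
  -- zero function, so that finiteness of the series is literal vanishing.
  set p' : ℕ → ℕ → ℂ → ℂ := fun n j =>
    if j ≤ L (n + 1) ∧ ∃ y ∈ Metric.ball (0 : ℂ) R, p (n + 1) j y ≠ 0 then p (n + 1) j else 0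
    with hp'
  have hL : ∀ n, L (n + 1) ≤ ⌈M⌉₊ * (n + 1) := fun n => by
    have h1 := (div_le_iff₀ (by positivity)).1 (hM (n + 1) (by omega))
    have h2 : M * ((n + 1 : ℕ) : ℝ) ≤ (⌈M⌉₊ : ℝ) * ((n + 1 : ℕ) : ℝ) :=
      mul_le_mul_of_nonneg_right (Nat.le_ceil M) (by positivity)
    exact_mod_cast h1.trans h2
  have hpp : ∀ n j, j ≤ L (n + 1) → ∀ y ∈ Metric.ball (0 : ℂ) R, p' n j y = p (n + 1) j y := by
    intro n j hj y hy
    by_cases h : ∃ y ∈ Metric.ball (0 : ℂ) R, p (n + 1) j y ≠ 0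
    · simp only [hp', if_pos (And.intro hj h)]
    · have : p' n j = 0 := if_neg fun h' => h h'.2
      push Not at h
      rw [this, h y hy, Pi.zero_apply]
  have hzero : ∀ n j, L (n + 1) < j → p' n j = 0 := fun n j hj => if_neg fun h => by omega
  have main : ∀ E : ℕ → ℝ, (∀ n, E n = b (n + 1) ∨ ∀ j, p' n j = 0) →
      (LinearGrowth E ∨ ∃ n₀, ∀ n, n₀ ≤ n → ∀ j, p' n j = 0) →
      IsLogSeriesAtOne R E fun x => q x := by
    intro E hE hgrowth
    refine ⟨p₀, dp₀, ⌈M⌉₊, max C 1, p', ⟨fun n j => ?_, fun n j hj => hzero n j ((hL n).trans_lt hj),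
      hgrowth, le_max_right _ _, fun n j z hz => ?_⟩, ?_⟩
    · simp only [hp']
      split_ifs with h
      · exact dp _ (by omega) j h.1
      · exact differentiableOn_const 0
    · simp only [hp']
      split_ifs with h
      · exact (hbound _ (by omega) j h.1 z hz).trans
          (pow_le_pow_left₀ hC.le (le_max_left _ _) _)
      · simp only [Pi.zero_apply, norm_zero]; positivity
    · filter_upwards [eventually_one_sub hsum, Ioo_mem_nhdsGT hR] with y hy hyR
      have hyb : (y : ℂ) ∈ Metric.ball (0 : ℂ) R := by
        simpa [abs_of_pos hyR.1] using hyR.2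
      have e1 : (1 : ℂ) - ((1 - y : ℝ) : ℂ) = y := by push_cast; ring
      simp only [e1, sub_sub_cancel] at hy
      refine hy.congr_fun fun n => ?_
      rw [logTerm, logSum_of_le (hL n) (hzero n), logSum]
      have e2 : ∑ j ∈ Finset.range (L (n + 1) + 1), p' n j y * ((Real.log y : ℝ) : ℂ) ^ j =
          ∑ j ∈ Finset.range (L (n + 1) + 1), p (n + 1) j y * ((Real.log y : ℝ) : ℂ) ^ j :=
        Finset.sum_congr rfl fun j hj => by
          rw [hpp n j (by simpa [Nat.lt_succ_iff] using hj) _ hyb]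
      rcases hE n with h | h
      · rw [h, e2]
      · rw [← e2, Finset.sum_eq_zero fun j _ => by rw [h j, Pi.zero_apply, zero_mul], mul_zero,
          mul_zero]
  rcases hlist with hfin | ⟨hmono, hlim, c, hc, hgrow⟩
  · obtain ⟨n₀, hn₀⟩ := (hfin.image Prod.fst).bddAbove
    have hvan : ∀ n, n₀ ≤ n → ∀ j, p' n j = 0 := fun n hn j => if_neg fun h => by
      have := hn₀ ⟨(n + 1, j), ⟨Nat.succ_pos n, h.1, h.2⟩, rfl⟩
      simp only at this
      omega
    -- In the finite case the given exponents may grow without being ordered. Making them constant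
    -- after the last nonzero term gives a list without linear growth, which `IsExponentList`
    -- accepts.
    refine ⟨fun n => if n < n₀ then b (n + 1) else β, ⟨fun n => ?_, Or.inl ?_⟩,
      main _ (fun n => ?_) (Or.inr ⟨n₀, hvan⟩)⟩
    · beta_reduce
      split_ifs
      · exact hb _ (by omega)
      · exact le_rfl
    · intro hg
      obtain ⟨n, hn, hn'⟩ := ((hg.tendsto_atTop.eventually_gt_atTop β).and
        (eventually_ge_atTop n₀)).exists
      rw [if_neg (not_lt.2 hn')] at hn
      exact lt_irrefl _ hn
    · by_cases h : n < n₀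
      · exact Or.inl (if_pos h)
      · exact Or.inr (hvan n (not_lt.1 h))
  · have hgrow' : ∀ n : ℕ, 1 ≤ n → c * (n + 1) ≤ b (n + 1) - β := fun n hn => by
      have := (le_div_iff₀ (by positivity)).1 (hgrow (n + 1) (by omega))
      exact_mod_cast this
    refine ⟨fun n => b (n + 1), ⟨fun n => hb _ (by omega), Or.inr
      ⟨strictMono_nat_of_lt_succ fun n => hmono _ (by omega), c, hc, hgrow'⟩⟩,
      main _ (fun n => Or.inl rfl) (Or.inl (linearGrowth_of_le hc (hb _ le_rfl) hgrow'))⟩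

theorem IsLogSeriesAtOne.hasLogPowerExpansionAtOne {R β : ℝ} {q : ℝ → ℝ} {E : ℕ → ℝ}
    (hE : IsExponentList β E) (h : IsLogSeriesAtOne R E fun x => q x) :
    HasLogPowerExpansionAtOne R β q := by
  obtain ⟨p₀, dp₀, M, C, p, hp, hs⟩ := h
  refine ⟨p₀, fun i => E (i - 1), fun i => M * i, fun i => p (i - 1), dp₀,
    fun i _ j _ => hp.diff _ _, ⟨M, fun i hi => ?_⟩, fun i _ => hE.1 _, ?_,
    ⟨C, by linarith [hp.one_le], fun i hi j _ y hy => ?_⟩, ?_⟩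
  · have : (0 : ℝ) < i := by exact_mod_cast hi
    push_cast
    rw [mul_div_cancel_right₀ _ this.ne']
  · rcases hE.2 with hfin | ⟨hmono, c, hc, hgrow⟩
    · left
      -- A list without linear growth carries only finite series, so the first alternative of the
      -- dichotomy holds.
      obtain ⟨n₀, hn₀⟩ := hp.growth.resolve_left hfin
      refine ((Finset.range (n₀ + 1) ×ˢ Finset.range (M * n₀ + 1)).finite_toSet).subset ?_
      rintro ⟨i, j⟩ ⟨h1, h2, y, -, hy⟩
      simp only at h1 h2 hy
      have hi : i - 1 < n₀ := by
        by_contra h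
        rw [hn₀ _ (not_lt.1 h)] at hy
        exact hy rfl
      have hi' : i ≤ n₀ := by omega
      simp only [Finset.coe_product, Finset.coe_range, mem_prod, mem_Iio]
      exact ⟨by omega, Nat.lt_succ_of_le (h2.trans (Nat.mul_le_mul_left M hi'))⟩
    · right
      refine ⟨fun i hi => hmono (by omega), ?_, c, hc, fun i hi => ?_⟩
      · exact (linearGrowth_of_le hc (hE.1 0) hgrow).tendsto_atTop.comp (tendsto_sub_atTop_nat 1)
      · obtain ⟨n, rfl⟩ : ∃ n, i = n + 1 := ⟨i - 1, by omega⟩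
        rw [le_div_iff₀ (by positivity)]
        simpa using hgrow n (by omega)
  · obtain ⟨n, rfl⟩ : ∃ n, i = n + 1 := ⟨i - 1, by omega⟩
    exact hp.bound n j y hy
  · filter_upwards [eventually_one_sub' hs] with x hx
    simp only [sub_sub_cancel, logTerm, logSum] at hx
    push_cast at hx ⊢
    exact hx

theorem MemQTilde.exists_isProfile {U : Set ℂ} {R β : ℝ} (hR : 0 < R) {q : ℝ → ℝ}
    (h : MemQTilde U R β q) :
    ∃ E, IsExponentList β E ∧ IsProfile U R 0 E fun x => q x := by
  obtain ⟨E, hE, hone⟩ := h.at_one.exists_isLogSeriesAtOne hR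
  exact ⟨E, hE, h.holomorphic_extension, h.at_zero.isLogPolyAtZero, hone⟩

theorem HasHolExtension.analyticOnNhd {U : Set ℂ} (hU : IsProfileDomain U) {f : ℝ → ℝ}
    (hf : HasHolExtension U fun x => f x) : AnalyticOnNhd ℝ f (Ioo 0 1) := by
  obtain ⟨F, dF, hF⟩ := hf
  intro x hx
  have h1 : AnalyticAt ℂ F x := dF.analyticAt (hU.isOpen.mem_nhds (hU.contains_interval x hx))
  refine h1.re_ofReal.congr ?_
  filter_upwards [isOpen_Ioo.mem_nhds hx] with y hy
  rw [hF y hy, Complex.ofReal_re]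

theorem IsProfile.memQTilde {U : Set ℂ} (hU : IsProfileDomain U) {R β : ℝ} {E : ℕ → ℝ}
    (hE : IsExponentList β E) {q : ℝ → ℝ} (h : IsProfile U R 0 E fun x => q x) :
    MemQTilde U R β q :=
  ⟨h.hol.analyticOnNhd hU, h.hol, h.zero.hasLogExpansionAtZero, h.one.hasLogPowerExpansionAtOne hE⟩

/-! ### The cascade of equations for the coefficients of powers of a logarithm -/

/-- The first-order coupling between coefficients of consecutive powers. -/
noncomputable def firstCoupling (N A B γ : ℝ) (f g : ℝ → ℝ) (x : ℝ) : ℝ :=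
  2 * g x - N * f x - γ * x * (2 * g x + (A + B) * f x)

/-- The source seen by the `l`-th coefficient. -/
noncomputable def cascadeSource (N A B γ : ℝ) (k : ℕ) (S : ℝ → ℝ) (f g : ℕ → ℝ → ℝ) (l : ℕ)
    (x : ℝ) : ℝ :=
  (if l = k then S x else 0) - ((l + 1) / 2 * firstCoupling N A B γ (f (l + 1)) (g (l + 1)) x +
    (l + 2) * (l + 1) / 4 * ((1 - γ ^ 2 * x) * f (l + 2) x))

theorem IsProfile.zero_fun {U : Set ℂ} {R m : ℝ} {E : ℕ → ℝ} {f : ℝ → ℂ} (hR : 0 < R)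
    (h : IsProfile U R m E f) : IsProfile U R m E fun _ => 0 := by
  simpa using h.lin hR h 0 0

/-- The Euler derivatives `g` force exponents `E n - 1`, which is exactly what a source may have.
The solution again has exponents `E n`, so the list does not deteriorate along the cascade. -/
theorem IsProfile.cascadeSource {U : Set ℂ} {R m : ℝ} {E : ℕ → ℝ} (hR : 0 < R) (N A B γ : ℝ)
    {k : ℕ} {S : ℝ → ℝ} (hS : IsProfile U R m (fun n => E n - 1) fun x => S x)
    {f g : ℕ → ℝ → ℝ} (hf : ∀ l, IsProfile U R m E fun x => f l x)
    (hg : ∀ l, IsProfile U R m (fun n => E n - 1) fun x => g l x) (l : ℕ) :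
    IsProfile U R m (fun n => E n - 1) fun x => cascadeSource N A B γ k S f g l x := by
  have h0 : IsProfile U R m (fun n => E n - 1) fun x => ((if l = k then S x else 0 : ℝ) : ℂ) := by
    split_ifs
    · exact hS
    · simpa using hS.zero_fun hR
  have f1 := (hf (l + 1)).sub_one hR
  have f2 := (hf (l + 2)).sub_one hR
  have g1 := hg (l + 1)
  have c1 := (g1.lin hR f1 2 (-N)).lin hR ((g1.lin hR f1 2 (A + B)).mul_self hR) 1 (-γ)
  have c2 := f2.lin hR (f2.mul_self hR) 1 (-γ ^ 2)
  have := h0.lin hR (c1.lin hR c2 ((l + 1) / 2) ((l + 2) * (l + 1) / 4)) 1 (-1)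
  convert! this using 2 with x
  simp only [_root_.cascadeSource, firstCoupling]
  push_cast
  ring

/-- The system is triangular: equation `l` involves besides `f l` only indices `l + 1` and `l + 2`.
It is solved from `l = k` downwards, all higher coefficients being zero. -/
theorem exists_profile_cascade {N A B κ : ℝ} (hN : 0 ≤ N) (hκ : 0 ≤ κ) (hκN : κ = 1 - N - A - B)
    {U : Set ℂ} (hU : IsProfileDomain U) {R m : ℝ} (hR0 : 0 < R) (hR : R ≤ 1) {E : ℕ → ℝ}
    (hE : ∃ k, E k = κ) {S : ℝ → ℝ} (hS : IsProfile U R m (fun n => E n - 1) fun x => S x)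
    (γ : ℝ) (k : ℕ) :
    ∃ f g : ℕ → ℝ → ℝ, (∀ l, k < l → f l = 0 ∧ g l = 0) ∧
      (∀ l, IsProfile U R m E fun x => f l x) ∧
      (∀ l, IsProfile U R m (fun n => E n - 1) fun x => g l x) ∧
      ∀ l, RealEulerSys N A B (Ioo 0 1) (fun x => f l x) (fun x => g l x)
        fun x => cascadeSource N A B γ k S f g l x := by
  suffices h : ∀ n ≤ k + 1, ∃ f g : ℕ → ℝ → ℝ, (∀ l, k < l → f l = 0 ∧ g l = 0) ∧
      (∀ l, IsProfile U R m E fun x => f l x) ∧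
      (∀ l, IsProfile U R m (fun n => E n - 1) fun x => g l x) ∧
      ∀ l, k + 1 ≤ l + n → RealEulerSys N A B (Ioo 0 1) (fun x => f l x) (fun x => g l x)
        fun x => cascadeSource N A B γ k S f g l x by
    obtain ⟨f, g, h1, h2, h3, h4⟩ := h (k + 1) le_rfl
    exact ⟨f, g, h1, h2, h3, fun l => h4 l (by omega)⟩
  intro n
  induction n with
  | zero =>
    intro _
    -- Only used to see that the zero function is a profile with exponents `E`.
    obtain ⟨F, _, hF, -⟩ := exists_profile_solution (A := A) (B := B) hN hκ hκN hU hR0 hR hE hS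
    refine ⟨0, 0, fun l _ => ⟨rfl, rfl⟩, fun l => by simpa using hF.zero_fun hR0,
      fun l => by simpa using hS.zero_fun hR0, fun l hl => ?_⟩
    have : ∀ x, cascadeSource N A B γ k S 0 0 l x = 0 := fun x => by
      simp [cascadeSource, firstCoupling, show l ≠ k by omega]
    simp only [this]
    refine ⟨fun x _ => ?_, fun x _ => ?_⟩ <;> simpa using hasDerivAt_const x (0 : ℂ)
  | succ n ih =>
    intro hn
    obtain ⟨f, g, h1, h2, h3, h4⟩ := ih (by omega)
    obtain ⟨F, G, hF, hG, hsys⟩ := exists_profile_solution (A := A) (B := B) hN hκ hκN hU hR0 hR hE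
      (IsProfile.cascadeSource hR0 N A B γ (k := k) hS h2 h3 (k - n))
    -- Replacing the entry at `k - n` leaves the sources at `l ≥ k - n` unchanged, so the equations
    -- already solved remain valid.
    have e1 : ∀ l, k - n ≤ l → cascadeSource N A B γ k S (Function.update f (k - n) F)
        (Function.update g (k - n) G) l = cascadeSource N A B γ k S f g l := fun l hl => by
      funext x
      simp only [cascadeSource, Function.update_of_ne (show l + 1 ≠ k - n by omega),
        Function.update_of_ne (show l + 2 ≠ k - n by omega)]
    refine ⟨Function.update f (k - n) F, Function.update g (k - n) G, fun l hl => ?_, fun l => ?_,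
      fun l => ?_, fun l hl => ?_⟩
    · rw [Function.update_of_ne (by omega), Function.update_of_ne (by omega)]
      exact h1 l hl
    · rcases eq_or_ne l (k - n) with rfl | hne
      · simpa using hF
      · simpa only [Function.update_of_ne hne] using h2 l
    · rcases eq_or_ne l (k - n) with rfl | hne
      · simpa using hG
      · simpa only [Function.update_of_ne hne] using h3 l
    · rw [e1 l (by omega)]
      rcases eq_or_ne l (k - n) with rfl | hne
      · simpa using hsys
      · simpa only [Function.update_of_ne hne] using h4 l (by omega)

/-! ### Waves with logarithmic profiles -/

theorem hasDerivAt_of_ofReal {f : ℝ → ℝ} {c : ℂ} {x : ℝ}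
    (h : HasDerivAt (fun x => (f x : ℂ)) c x) : HasDerivAt f c.re x := by
  exact Complex.reCLM.hasFDerivAt.comp_hasDerivAt x h

/-- Derivative of a logarithmic polynomial along a curve on which the prefactor, the profile
variable and the logarithm are homogeneous. -/
theorem hasDerivAt_logPoly {P X Λ : ℝ → ℝ} {s p a b : ℝ} {f g : ℕ → ℝ → ℝ} {n : ℕ}
    (hP : HasDerivAt P (p * P s / s) s) (hX : HasDerivAt X (a * X s / s) s)
    (hΛ : HasDerivAt Λ (b / s) s) (hX0 : X s ≠ 0)
    (hf : ∀ l, HasDerivAt (f l) (g l (X s) / X s) (X s)) (hn : f n = 0) :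
    HasDerivAt (fun s => P s * ∑ l ∈ Finset.range n, f l (X s) * Λ s ^ l)
      (P s * (∑ l ∈ Finset.range n,
        (p * f l (X s) + a * g l (X s) + b * ((l + 1) * f (l + 1) (X s))) * Λ s ^ l) / s) s := by
  have h1 : HasDerivAt (fun s => ∑ l ∈ Finset.range n, f l (X s) * Λ s ^ l)
      (∑ l ∈ Finset.range n, ((g l (X s) / X s * (a * X s / s)) * Λ s ^ l +
        f l (X s) * (l * Λ s ^ (l - 1) * (b / s)))) s :=
    HasDerivAt.fun_sum fun l _ => ((hf l).comp s hX).fun_mul (hΛ.fun_pow l)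
  -- Index shift in the derivative of the logarithmic powers: the factor `l` removes the lowest term
  -- and `f n = 0` closes the sum at the top.
  have h2 : ∑ l ∈ Finset.range n, f l (X s) * (l * Λ s ^ (l - 1)) =
      ∑ l ∈ Finset.range n, (l + 1) * f (l + 1) (X s) * Λ s ^ l := by
    have a1 := Finset.sum_range_succ (fun l : ℕ => f l (X s) * (l * Λ s ^ (l - 1))) n
    rw [Finset.sum_range_succ', hn] at a1
    simp only [Nat.cast_add, Nat.cast_one, Nat.add_sub_cancel, Nat.cast_zero, zero_mul, mul_zero,
      Pi.zero_apply, add_zero] at a1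
    rw [← a1]
    exact Finset.sum_congr rfl fun l _ => by ring
  refine (hP.fun_mul h1).congr_deriv ?_
  have h3 : ∑ l ∈ Finset.range n, ((g l (X s) / X s * (a * X s / s)) * Λ s ^ l +
        f l (X s) * (l * Λ s ^ (l - 1) * (b / s))) = a / s * ∑ l ∈ Finset.range n,
        g l (X s) * Λ s ^ l + b / s * ∑ l ∈ Finset.range n, f l (X s) * (l * Λ s ^ (l - 1)) := by
    rw [Finset.mul_sum, Finset.mul_sum, ← Finset.sum_add_distrib]
    refine Finset.sum_congr rfl fun l _ => ?_
    field_simp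
  have h4 : ∑ l ∈ Finset.range n,
      (p * f l (X s) + a * g l (X s) + b * ((l + 1) * f (l + 1) (X s))) * Λ s ^ l =
      p * ∑ l ∈ Finset.range n, f l (X s) * Λ s ^ l + a * ∑ l ∈ Finset.range n,
        g l (X s) * Λ s ^ l + b * ∑ l ∈ Finset.range n, (l + 1) * f (l + 1) (X s) * Λ s ^ l := by
    simp only [Finset.mul_sum, ← Finset.sum_add_distrib]
    exact Finset.sum_congr rfl fun l _ => by ring
  rw [h3, h4, h2]
  ring

/-- This is `s² f'' = (s d/ds)² f - (s d/ds) f`, in a form suited to Euler derivatives. -/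
theorem iteratedDeriv_two_of_hasDerivAt {f F : ℝ → ℝ} {F' s : ℝ} (hs : s ≠ 0)
    (h : ∀ᶠ r in 𝓝 s, HasDerivAt f (F r / r) r) (hF : HasDerivAt F (F' / s) s) :
    iteratedDeriv 2 f s = (F' - F s) / s ^ 2 := by
  rw [iteratedDeriv_succ, iteratedDeriv_one]
  have h1 : deriv f =ᶠ[𝓝 s] fun r => F r / r := h.mono fun r hr => hr.deriv
  rw [h1.deriv_eq, (hF.fun_div (hasDerivAt_id' s) hs).deriv]
  field_simp

/-- The wave `t^τ r^μ ∑_{l<n} f_l((r/t)²) (log r - γ log t)^l`. -/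
noncomputable def logWave (τ μ γ : ℝ) (n : ℕ) (f : ℕ → ℝ → ℝ) (r t : ℝ) : ℝ :=
  t ^ τ * r ^ μ * ∑ l ∈ Finset.range n, f l ((r / t) ^ 2) * (Real.log r - γ * Real.log t) ^ l

/-- Coefficients of an Euler field (`r ∂_r` or `t ∂_t`) applied to a `logWave`, where `g` lists the
Euler derivatives of the profiles `f`. -/
def eulerCoeff (p a b : ℝ) (f g : ℕ → ℝ → ℝ) (l : ℕ) (x : ℝ) : ℝ :=
  p * f l x + a * g l x + b * ((l + 1) * f (l + 1) x)

theorem sq_div_mem_Ioo {r t : ℝ} (hr : 0 < r) (hrt : r < t) : (r / t) ^ 2 ∈ Ioo (0 : ℝ) 1 := by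
  have ht := hr.trans hrt
  have h1 : r / t < 1 := (div_lt_one ht).2 hrt
  have h0 : 0 < r / t := div_pos hr ht
  exact ⟨by positivity, by nlinarith⟩

section Wave

variable {τ μ γ : ℝ} {n : ℕ} {f g : ℕ → ℝ → ℝ}

theorem hasDerivAt_logWave_fst (hf : ∀ l, ∀ x ∈ Ioo (0 : ℝ) 1, HasDerivAt (f l) (g l x / x) x)
    (hn : f n = 0) {r t : ℝ} (hr : 0 < r) (hrt : r < t) :
    HasDerivAt (fun r => logWave τ μ γ n f r t)
      (logWave τ μ γ n (eulerCoeff μ 2 1 f g) r t / r) r := by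
  have ht := hr.trans hrt
  have hx := sq_div_mem_Ioo hr hrt
  refine hasDerivAt_logPoly (P := fun r => t ^ τ * r ^ μ) (X := fun r => (r / t) ^ 2)
    (Λ := fun r => Real.log r - γ * Real.log t) (p := μ) (a := 2) (b := 1) (g := g)
    ?_ ?_ ?_ hx.1.ne' (fun l => hf l _ hx) hn
  · refine ((Real.hasDerivAt_rpow_const (Or.inl hr.ne')).const_mul _).congr_deriv ?_
    rw [Real.rpow_sub_one hr.ne']; ring
  · refine (((hasDerivAt_id' r).div_const t).fun_pow 2).congr_deriv ?_
    norm_num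
    field_simp
  · refine ((Real.hasDerivAt_log hr.ne').sub_const _).congr_deriv (by ring)

theorem hasDerivAt_logWave_snd (hf : ∀ l, ∀ x ∈ Ioo (0 : ℝ) 1, HasDerivAt (f l) (g l x / x) x)
    (hn : f n = 0) {r t : ℝ} (hr : 0 < r) (hrt : r < t) :
    HasDerivAt (fun t => logWave τ μ γ n f r t)
      (logWave τ μ γ n (eulerCoeff τ (-2) (-γ) f g) r t / t) t := by
  have ht := hr.trans hrt
  have hx := sq_div_mem_Ioo hr hrt
  refine hasDerivAt_logPoly (P := fun t => t ^ τ * r ^ μ) (X := fun t => (r / t) ^ 2)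
    (Λ := fun t => Real.log r - γ * Real.log t) (p := τ) (a := -2) (b := -γ) (g := g)
    ?_ ?_ ?_ hx.1.ne' (fun l => hf l _ hx) hn
  · refine ((Real.hasDerivAt_rpow_const (Or.inl ht.ne')).mul_const _).congr_deriv ?_
    rw [Real.rpow_sub_one ht.ne']; ring
  · refine ((((hasDerivAt_id' t).fun_inv ht.ne').const_mul r).fun_pow 2).congr_deriv ?_ |>.congr_of_eventuallyEq ?_
    · norm_num
      field_simp
    · exact Eventually.of_forall fun t => by simp only [div_eq_mul_inv]
  · refine (((Real.hasDerivAt_log ht.ne').const_mul γ).const_sub _).congr_deriv (by ring)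

theorem contDiffOn_logWave (hf : ∀ l, ContDiffOn ℝ 2 (f l) (Ioo 0 1)) :
    ContDiffOn ℝ 2 (fun x : ℝ × ℝ => logWave τ μ γ n f x.1 x.2)
      {x : ℝ × ℝ | 0 < x.1 ∧ x.1 < x.2} := by
  have h1 : ∀ x ∈ {x : ℝ × ℝ | 0 < x.1 ∧ x.1 < x.2}, x.1 ≠ 0 := fun x hx => hx.1.ne'
  have h2 : ∀ x ∈ {x : ℝ × ℝ | 0 < x.1 ∧ x.1 < x.2}, x.2 ≠ 0 := fun x hx => (hx.1.trans hx.2).ne'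
  refine ((contDiffOn_snd.rpow_const_of_ne h2).mul (contDiffOn_fst.rpow_const_of_ne h1)).mul
    (ContDiffOn.sum fun l _ => ContDiffOn.mul ?_ ?_)
  · exact (hf l).comp ((contDiffOn_fst.div contDiffOn_snd h2).pow 2) fun x hx =>
      sq_div_mem_Ioo hx.1 hx.2
  · exact ((contDiffOn_fst.log h1).sub (contDiffOn_const.mul (contDiffOn_snd.log h2))).pow l

/-- The radial wave operator on a `logWave`. -/
theorem radialWave_logWave {h : ℕ → ℝ → ℝ} {e : ℕ → ℝ → ℝ} {D : ℝ}
    (hf : ∀ l, ∀ x ∈ Ioo (0 : ℝ) 1, HasDerivAt (f l) (g l x / x) x)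
    (hg : ∀ l, ∀ x ∈ Ioo (0 : ℝ) 1, HasDerivAt (g l) (h l x / x) x)
    (hn : ∀ l, n ≤ l → f l = 0 ∧ g l = 0)
    (heq : ∀ l, ∀ x ∈ Ioo (0 : ℝ) 1,
      eulerCoeff μ 2 1 (eulerCoeff μ 2 1 f g) (eulerCoeff μ 2 1 g h) l x +
        (D - 2) * eulerCoeff μ 2 1 f g l x -
        x * (eulerCoeff τ (-2) (-γ) (eulerCoeff τ (-2) (-γ) f g) (eulerCoeff τ (-2) (-γ) g h) l x -
        eulerCoeff τ (-2) (-γ) f g l x) = x * e l x)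
    {r t : ℝ} (hr : 0 < r) (hrt : r < t) :
    t ^ 2 * (-(iteratedDeriv 2 (fun t => logWave τ μ γ n f r t) t) +
      iteratedDeriv 2 (fun r => logWave τ μ γ n f r t) r +
      (D - 1) / r * deriv (fun r => logWave τ μ γ n f r t) r) = logWave τ μ γ n e r t := by
  have ht := hr.trans hrt
  have hcoeff : ∀ p a b : ℝ, eulerCoeff p a b f g n = 0 := fun p a b => by
    funext x
    simp [eulerCoeff, (hn n le_rfl).1, (hn n le_rfl).2, (hn (n + 1) (Nat.le_succ n)).1]
  have hder : ∀ p a b : ℝ, ∀ l, ∀ x ∈ Ioo (0 : ℝ) 1,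
      HasDerivAt (eulerCoeff p a b f g l) (eulerCoeff p a b g h l x / x) x := by
    intro p a b l x hx
    refine ((((hf l x hx).const_mul p).fun_add ((hg l x hx).const_mul a)).fun_add
      (((hf (l + 1) x hx).const_mul ((l : ℝ) + 1)).const_mul b)).congr_deriv ?_
    simp only [eulerCoeff]; ring
  have hr2 := iteratedDeriv_two_of_hasDerivAt hr.ne'
    (F := fun r => logWave τ μ γ n (eulerCoeff μ 2 1 f g) r t)
    (by filter_upwards [Ioo_mem_nhds hr hrt] with ρ hρ using
          hasDerivAt_logWave_fst (τ := τ) (μ := μ) (γ := γ) hf (hn n le_rfl).1 hρ.1 hρ.2)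
    (hasDerivAt_logWave_fst (hder μ 2 1) (hcoeff μ 2 1) hr hrt)
  have ht2 := iteratedDeriv_two_of_hasDerivAt ht.ne'
    (F := fun t => logWave τ μ γ n (eulerCoeff τ (-2) (-γ) f g) r t)
    (by filter_upwards [Ioi_mem_nhds hrt] with ρ hρ using
          hasDerivAt_logWave_snd (τ := τ) (μ := μ) (γ := γ) hf (hn n le_rfl).1 hr hρ)
    (hasDerivAt_logWave_snd (hder τ (-2) (-γ)) (hcoeff τ (-2) (-γ)) hr hrt)
  rw [hr2, ht2, (hasDerivAt_logWave_fst hf (hn n le_rfl).1 hr hrt).deriv]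
  have hx := sq_div_mem_Ioo hr hrt
  -- The equation multiplied by `r²/t² = x`: the radial part becomes `(r ∂_r)² + (D-2) r ∂_r`, and
  -- `r² ∂_t²` becomes `x ((t ∂_t)² - t ∂_t)`.
  have key : logWave τ μ γ n (eulerCoeff μ 2 1 (eulerCoeff μ 2 1 f g) (eulerCoeff μ 2 1 g h)) r t +
      (D - 2) * logWave τ μ γ n (eulerCoeff μ 2 1 f g) r t -
      (r / t) ^ 2 * (logWave τ μ γ n (eulerCoeff τ (-2) (-γ) (eulerCoeff τ (-2) (-γ) f g)
        (eulerCoeff τ (-2) (-γ) g h)) r t - logWave τ μ γ n (eulerCoeff τ (-2) (-γ) f g) r t) =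
      (r / t) ^ 2 * logWave τ μ γ n e r t := by
    simp only [logWave, Finset.mul_sum, ← Finset.sum_add_distrib, ← Finset.sum_sub_distrib]
    refine Finset.sum_congr rfl fun l _ => ?_
    linear_combination (t ^ τ * r ^ μ * (Real.log r - γ * Real.log t) ^ l) * heq l _ hx
  generalize logWave τ μ γ n (eulerCoeff μ 2 1 (eulerCoeff μ 2 1 f g) (eulerCoeff μ 2 1 g h)) r t = a1
    at key ⊢
  generalize logWave τ μ γ n (eulerCoeff μ 2 1 f g) r t = a2 at key ⊢
  generalize logWave τ μ γ n (eulerCoeff τ (-2) (-γ) (eulerCoeff τ (-2) (-γ) f g)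
    (eulerCoeff τ (-2) (-γ) g h)) r t = a3 at key ⊢
  generalize logWave τ μ γ n (eulerCoeff τ (-2) (-γ) f g) r t = a4 at key ⊢
  generalize logWave τ μ γ n e r t = a5 at key ⊢
  have hr0 := hr.ne'
  have ht0 := ht.ne'
  field_simp at key ⊢
  linear_combination key

end Wave

/-! ### Return to the variables `R`, `a`, `t` and conclusion -/

theorem rpow_homogeneity {r t : ℝ} (hr : 0 < r) (ht : 0 < t) (ν s i a b : ℝ) :
    t ^ s * (r * blowupRate ν t) ^ i * ((r / t) ^ a * ((r / t) ^ 2) ^ b) =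
      t ^ (s - ν * i - i - a - 2 * b) * r ^ (i + a + 2 * b) := by
  have h1 : 0 < r / t := div_pos hr ht
  have h2 : 0 < blowupRate ν t := Real.rpow_pos_of_pos ht _
  rw [Real.rpow_def_of_pos ht, Real.rpow_def_of_pos (mul_pos hr h2), Real.rpow_def_of_pos h1,
    Real.rpow_def_of_pos (pow_pos h1 2), Real.rpow_def_of_pos ht, Real.rpow_def_of_pos hr,
    Real.log_mul hr.ne' h2.ne', blowupRate, Real.log_rpow ht, Real.log_pow,
    Real.log_div hr.ne' ht.ne', ← Real.exp_add, ← Real.exp_add, ← Real.exp_add, ← Real.exp_add]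
  congr 1
  push_cast
  ring

theorem log_mul_blowupRate {r t : ℝ} (hr : 0 < r) (ht : 0 < t) (ν : ℝ) :
    Real.log (r * blowupRate ν t) = Real.log r - (1 + ν) * Real.log t := by
  rw [blowupRate, Real.log_mul hr.ne' (Real.rpow_pos_of_pos ht _).ne', Real.log_rpow ht]
  ring

theorem mainTheorem8
    (U : Set ℂ) (hU : IsProfileDomain U) (a₀ : ℝ) (ha₀ : 0 < a₀) (ha₀' : a₀ < 1)
    (d : ℕ) (hd : 1 ≤ d) (ν s i β δ : ℝ) (k : ℕ)
    (hs : -(((d : ℝ) - 1) / 2) < s - ν * i)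
    (q : ℝ → ℝ) (hq : MemPowMulQ U a₀ δ β q) :
    ∃ Q : ℕ → ℝ → ℝ,
      (∀ l ≤ k, MemPowMulQ U a₀ (δ + 2) (min (β + 1) (s - ν * i + ((d : ℝ) - 1) / 2)) (Q l)) ∧
      IsRadialWaveSolution d
        (inRadialCoords ν fun R a t =>
          t ^ s * R ^ i * ∑ l ∈ Finset.range (k + 1), Q l a * Real.log R ^ l)
        (inRadialCoords ν fun R a t => t ^ s * q a * R ^ i * Real.log R ^ k) := by
  obtain ⟨q₁, ⟨qt, hqt, hq₁⟩, hqq⟩ := hq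
  obtain ⟨E₀, hE₀, hprof⟩ := hqt.exists_isProfile ha₀
  set κ : ℝ := s - ν * i + ((d : ℝ) - 1) / 2 with hκ
  obtain ⟨E, ι, hEκ, hι, hle, hEι, hgrow, hElist⟩ := hE₀.exists_insert (κ := κ)
  -- `ρ` is the smaller root of the indicial equation of the radial Laplacian in `x`, so that the
  -- difference `N` of the two roots is nonnegative.
  obtain ⟨ρ, hρ, hN⟩ : ∃ ρ : ℝ, ρ * (ρ + d / 2 - 1) = 0 ∧ 0 ≤ 1 - (d : ℝ) / 2 - 2 * ρ := by
    by_cases h : (d : ℝ) / 2 ≤ 1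
    · exact ⟨0, by ring, by linarith⟩
    · exact ⟨1 - d / 2, by ring, by linarith⟩
  set σ : ℝ := s - ν * i with hσ
  set N : ℝ := 1 - (d : ℝ) / 2 - 2 * ρ with hNdef
  set A : ℝ := -σ / 2 + ρ with hA
  set B : ℝ := (1 - σ) / 2 + ρ with hB
  -- Chosen so that `t^s R^i a^(δ+2) x^(-m)` equals `t^(σ-2ρ) r^(2ρ)`. The profiles `f l` then carry
  -- `x^m` at `0`, and `x^(-m) f l` has a pure logarithmic expansion.
  set m : ℝ := (i + δ) / 2 + 1 - ρ with hm
  set γ : ℝ := 1 + ν with hγ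
  have hκ0 : 0 ≤ κ := by linarith
  have hκN : κ = 1 - N - A - B := by rw [hκ, hNdef, hA, hB]; ring
  -- The factor `1/4` comes from `r ∂_r = 2ϑ` on functions of `x`, which enters squared.
  have hsrc : IsProfile U a₀ m (fun n => E n - 1) fun x => ((x ^ m * (qt x / 4) : ℝ) : ℂ) := by
    have h1 := (hprof.reindex hι hle hEι hgrow).mul_rpow hU ha₀ ha₀'.le m
    rw [zero_add] at h1
    convert! h1.lin ha₀ h1 (1 / 4) 0 using 2 with x
    push_cast; ring
  obtain ⟨f, g, hvan, hf, hg, hsys⟩ := exists_profile_cascade hN hκ0 hκN hU ha₀ ha₀'.le hEκ hsrc γ k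
  set S : ℝ → ℝ := fun x => x ^ m * (qt x / 4) with hS
  set h : ℕ → ℝ → ℝ := fun l x => ((N + x * (A + B)) * g l x + x * A * B * f l x +
    cascadeSource N A B γ k S f g l x) / (1 - x) with hh
  have df : ∀ l, ∀ x ∈ Ioo (0 : ℝ) 1, HasDerivAt (f l) (g l x / x) x := fun l x hx => by
    have := hasDerivAt_of_ofReal ((hsys l).1 x hx)
    rwa [← Complex.ofReal_div, Complex.ofReal_re] at this
  have dg : ∀ l, ∀ x ∈ Ioo (0 : ℝ) 1, HasDerivAt (g l) (h l x / x) x := fun l x hx => by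
    have := hasDerivAt_of_ofReal ((hsys l).2 x hx)
    refine this.congr_deriv ?_
    rw [← Complex.ofReal_re (h l x / x)]
    congr 1
    simp only [hh]
    push_cast
    rw [div_div, mul_comm (1 - (x : ℂ))]
  -- The exponent is `m - 1` because the wave equation was multiplied by `x`; this accounts for `δ +
  -- 2` in the solution against `δ` in the source.
  set e : ℕ → ℝ → ℝ := fun l x => if l = k then x ^ (m - 1) * qt x else 0 with he
  have heq : ∀ l, ∀ x ∈ Ioo (0 : ℝ) 1,
      eulerCoeff (2 * ρ) 2 1 (eulerCoeff (2 * ρ) 2 1 f g) (eulerCoeff (2 * ρ) 2 1 g h) l x +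
        (d - 2) * eulerCoeff (2 * ρ) 2 1 f g l x -
        x * (eulerCoeff (σ - 2 * ρ) (-2) (-γ) (eulerCoeff (σ - 2 * ρ) (-2) (-γ) f g)
          (eulerCoeff (σ - 2 * ρ) (-2) (-γ) g h) l x -
        eulerCoeff (σ - 2 * ρ) (-2) (-γ) f g l x) = x * e l x := by
    intro l x hx
    have hx1 : 1 - x ≠ 0 := by linarith [hx.2]
    have h1 : (1 - x) * h l x = (N + x * (A + B)) * g l x + x * A * B * f l x +
        cascadeSource N A B γ k S f g l x := mul_div_cancel₀ _ hx1
    have h2 : (if l = k then S x else 0) = x * e l x / 4 := by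
      simp only [he, hS]
      split_ifs
      · rw [Real.rpow_sub_one hx.1.ne']
        have := hx.1.ne'
        field_simp
      · simp
    simp only [cascadeSource, firstCoupling, h2] at h1
    simp only [eulerCoeff]
    rw [hNdef, hA, hB] at h1
    push_cast
    -- The indicial equation `hρ` removes the term of order zero in `ϑ` that has no factor `x`.
    linear_combination 4 * h1 + 4 * f l x * hρ
  have hwave : ∀ r t : ℝ, 0 < r → r < t →
      inRadialCoords ν (fun R a t => t ^ s * R ^ i * ∑ l ∈ Finset.range (k + 1),
        (a ^ (δ + 2) * ((a ^ 2) ^ (-m) * f l (a ^ 2))) * Real.log R ^ l) r t =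
      logWave (σ - 2 * ρ) (2 * ρ) γ (k + 1) f r t := by
    intro r t hr hrt
    have ht := hr.trans hrt
    have h1 := rpow_homogeneity hr ht ν s i (δ + 2) (-m)
    rw [show s - ν * i - i - (δ + 2) - 2 * -m = σ - 2 * ρ by rw [hm, hσ]; ring,
      show i + (δ + 2) + 2 * -m = 2 * ρ by rw [hm]; ring] at h1
    simp only [inRadialCoords, logWave, ← h1, log_mul_blowupRate hr ht, Finset.mul_sum]
    exact Finset.sum_congr rfl fun l _ => by ring
  have hsource : ∀ r t : ℝ, 0 < r → r < t →
      inRadialCoords ν (fun R a t => t ^ s * q a * R ^ i * Real.log R ^ k) r t =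
      logWave (σ - 2 * ρ) (2 * ρ) γ (k + 1) e r t := by
    intro r t hr hrt
    have ht := hr.trans hrt
    have hx := sq_div_mem_Ioo hr hrt
    have h1 := rpow_homogeneity hr ht ν s i δ (1 - m)
    rw [show s - ν * i - i - δ - 2 * (1 - m) = σ - 2 * ρ by rw [hm, hσ]; ring,
      show i + δ + 2 * (1 - m) = 2 * ρ by rw [hm]; ring] at h1
    have h2 : (r / t) ∈ Ioo (0 : ℝ) 1 := ⟨div_pos hr ht, (div_lt_one ht).2 hrt⟩
    have h3 : ((r / t) ^ 2) ^ (1 - m) * ((r / t) ^ 2) ^ (m - 1) = 1 := by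
      rw [← Real.rpow_add hx.1]; simp
    simp only [inRadialCoords, logWave, ← h1, log_mul_blowupRate hr ht, he, hqq _ h2, hq₁ _ h2]
    rw [Finset.sum_eq_single_of_mem k (by simp) fun l _ hl => by simp [hl], if_pos rfl]
    linear_combination -(t ^ s * (r * blowupRate ν t) ^ i * (r / t) ^ δ * qt ((r / t) ^ 2) *
      (Real.log r - γ * Real.log t) ^ k) * h3
  refine ⟨fun l a => a ^ (δ + 2) * ((a ^ 2) ^ (-m) * f l (a ^ 2)), fun l _ => ?_, ?_, ?_⟩
  · refine ⟨fun a => (a ^ 2) ^ (-m) * f l (a ^ 2), ⟨fun x => x ^ (-m) * f l x, ?_, fun a _ => rfl⟩,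
      fun a _ => rfl⟩
    have h1 := (hf l).mul_rpow hU ha₀ ha₀'.le (-m)
    rw [add_neg_cancel] at h1
    refine IsProfile.memQTilde hU hElist ?_
    simpa only [Complex.ofReal_mul] using h1
  · refine (contDiffOn_logWave (τ := σ - 2 * ρ) (μ := 2 * ρ) (γ := γ) (n := k + 1) (f := f)
      fun l => ?_).congr fun x hx => hwave x.1 x.2 hx.1 hx.2
    exact ((hf l).hol.analyticOnNhd hU).contDiffOn isOpen_Ioo.uniqueDiffOn
  · intro r t hr hrt
    have er := Filter.Eventually.mono (Ioo_mem_nhds hr hrt) fun ρ hρ => hwave ρ t hρ.1 hρ.2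
    have et := Filter.Eventually.mono (Ioi_mem_nhds hrt) fun τ hτ => hwave r τ hr hτ
    rw [Filter.EventuallyEq.iteratedDeriv_eq 2 et, Filter.EventuallyEq.iteratedDeriv_eq 2 er,
      Filter.EventuallyEq.deriv_eq er, hsource r t hr hrt]
    exact radialWave_logWave df dg (fun l hl => hvan l (by omega)) heq hr hrt
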